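/- **Setting.** Here $[\,\cdot\,]$ denotes closed linear span. *Partial automorphisms.* Let $B$ be a $C^*$-algebra. A partial automorphism of $B$ is a $*$-isomorphism $\theta\colon \mathrm{Dom}(\theta)\to \mathrm{Img}(\theta)$ between closed two-sided ideals of $B$. The set $\mathrm{PAut}(B)$ of all of them is an inverse semigroup under composition (where defined), with $\theta^*=\theta^{-1}$. It is ordered by extension: $\theta'\le\theta$ iff $\theta$ extends $\theta'$. The meet is denoted $\theta\wedge\theta'$. *Bimodules.* A right $C^*$-$B$-$B$-bimodule is a full right Hilbert $C^*$-module $E$ over $B$ with a nondegenerate $*$-homomorphism from $B$ to the adjointable operators on $E$, written $(b,\xi)\mapsto b\xi$. For $B=E$ we use $\langle b|c\rangle=b^*c$ and left multiplication. For $\theta\in \mathrm{PAut}(B)$ put $$E_\theta=\{\xi\in E\,\mathrm{Dom}(\theta) : \xi b=\theta(b)\xi \text{ for all } b\in \mathrm{Dom}(\theta)\}.$$ For $\Theta\subseteq\mathrm{PAut}(B)$, $E$ is $\Theta$-decomposable if $[\bigcup_{\theta\in\Theta}E_\theta]=E$. $B$ is decomposable if it is $\mathrm{PAut}(B)$-decomposable,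 and it is $\Theta$-supported if $B_\theta=[\bigcup_{\theta'\in\Theta,\ \theta'\le\theta}B_{\theta'}]$ for all $\theta\in\mathrm{PAut}(B)$. An inverse semigroup $\Theta\subseteq \mathrm{PAut}(B)$ is admissible if $B$ is $\Theta$-supported, $\mathrm{id}_B\in\Theta$, and $\theta\wedge\theta'\in\Theta$ for all $\theta,\theta'\in\Theta$. *Homogeneous operators.* Let $E,F$ be right $C^*$-$B$-$B$-bimodules and $\rho,\sigma\in \mathrm{PAut}(B)$. An operator $T\colon E\to F$ is $(\rho,\sigma)$-homogeneous if the following hold: * $TE\subseteq[\mathrm{Img}(\rho)F]$; * $Ta\xi=\rho(a)T\xi$ for all $a\in\mathrm{Dom}(\rho)$ and $\xi\in E$; * there is an operator $S=T^*\colon F\to E$ such that, for all $\xi,\eta$, $\langle S\eta|\xi\rangle\in\mathrm{Dom}(\sigma)$ and $\langle\eta|T\xi\rangle=\sigma(\langle S\eta|\xi\rangle)$. We consider families $\mathcal C=(\mathcal C^\rho_\sigma)_{\rho,\sigma\in\mathrm{PAut}(B)}$ of sets of operators. The adjoint family is given by $(\mathcal C^*)^\rho_\sigma=(\mathcal C^{\rho^*}_{\sigma^*})^*$.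 The component $[\mathcal D\mathcal C]^{\rho''}_{\sigma''}$ of a product is the closed linear span of all $T'T$ with $T'\in\mathcal D^{\rho'}_{\sigma'}$, $T\in\mathcal C^\rho_\sigma$, $\rho'\rho\le\rho''$ and $\sigma'\sigma\le\sigma''$. For $\xi\in E$ define $|\xi\rangle,|\xi]\colon B\to E$ by $|\xi\rangle b=\xi b$ and $|\xi]b=b\xi$. For $b\in B$ define $l_b,r_b\colon E\to E$ by $l_b\xi=b\xi$ and $r_b\xi=\xi b$. Let $|E\rangle$ be the family with $|E\rangle^\theta_{\mathrm{id}}=\{|\xi\rangle:\xi\in E_\theta\}$, and let $|E]$ be the family with $|E]^{\mathrm{id}}_{\theta}=\{|\xi]:\xi\in E_{\theta^*}\}$, for all $\theta\in\mathrm{PAut}(B)$; all other components are $0$. A right $C^*$-$B$-$B$-bimodule $E$ is $\Theta$-admissible if it is $\Theta$-decomposable, $[|E\rangle^*|E\rangle]=|B\rangle$ and $[|E]^*|E]]=|B]$. *Representations.* A covariant representation of $(B,\Theta)$ on a Hilbert space $\mathfrak K$ consists of a $*$-representation $\pi\colon B\to\mathcal L(\mathfrak K)$ and a $*$-homomorphism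 $\upsilon\colon\Theta\to\mathcal L(\mathfrak K)$ (that is, $\upsilon(\theta\theta')=\upsilon(\theta)\upsilon(\theta')$ and $\upsilon(\theta^*)=\upsilon(\theta)^*$) such that $\upsilon(\theta)\mathfrak K=[\pi(\mathrm{Img}(\theta))\mathfrak K]$ and $\upsilon(\theta)\pi(b)\upsilon(\theta)^*=\pi(\theta(b))$ for all $\theta\in\Theta$ and $b\in \mathrm{Dom}(\theta)$. Given such a representation, let $F(E)=E\otimes_\pi\mathfrak K$, and for a $(\rho,\sigma)$-homogeneous operator $T$ with $\rho,\sigma\in\Theta$ let $F(T)=T\otimes\upsilon(\sigma)$, that is, $F(T)(\xi\otimes\zeta)=T\xi\otimes\upsilon(\sigma)\zeta$. For a family $\mathcal C$ let $F_*(\mathcal C)=[F(c): c\in\mathcal C^\rho_\sigma,\ \rho,\sigma\in\Theta]$. *$C^*$-bases.* A $C^*$-base $(\mathfrak H,\mathfrak B,\mathfrak B^\dagger)$ is a Hilbert space $\mathfrak H$ with two commuting nondegenerate $C^*$-algebras $\mathfrak B,\mathfrak B^\dagger\subseteq\mathcal L(\mathfrak H)$. A $C^*$-factorization of a Hilbert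 space $H$ with respect to it is a closed subspace $\alpha\subseteq\mathcal L(\mathfrak H,H)$ with $[\alpha^*\alpha]=\mathfrak B$, $[\alpha\mathfrak B]=\alpha$ and $[\alpha\mathfrak H]=H$. The associated representation $\rho_\alpha\colon\mathfrak B^\dagger\to\mathcal L(H)$ is determined by $\rho_\alpha(b)\xi\zeta=\xi b\zeta$ for $b\in\mathfrak B^\dagger$, $\xi\in\alpha$ and $\zeta\in\mathfrak H$. A $C^*$-factorization $\alpha$ with respect to $(\mathfrak H,\mathfrak B,\mathfrak B^\dagger)$ and a $C^*$-factorization $\beta$ of the same $H$ with respect to $(\mathfrak K',\mathfrak C,\mathfrak C^\dagger)$ are compatible if $[\rho_\alpha(\mathfrak B^\dagger)\beta]=\beta$ and $[\rho_\beta(\mathfrak C^\dagger)\alpha]=\alpha$. **Theorem.** Let $B$ be a decomposable $C^*$-algebra, $\Theta\subseteq\mathrm{PAut}(B)$ an admissible inverse semigroup, and $(\pi,\upsilon)$ a covariant representation of $(B,\Theta)$ on a Hilbert space $\mathfrak K$ with $\pi$ faithful. Put $$\mathfrak H=F(B)=B\otimes_\pi\mathfrak K,\qquad \mathfrak B=F_*(|B\rangle),\qquad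 \mathfrak B^\dagger=F_*(|B]).$$ 1. $(\mathfrak H,\mathfrak B,\mathfrak B^\dagger)$ is a $C^*$-base: $\mathfrak B$ and $\mathfrak B^\dagger$ are commuting nondegenerate $C^*$-algebras on $\mathfrak H$. 2. For every $\Theta$-admissible right $C^*$-$B$-$B$-bimodule $E$, the spaces $$\alpha(E)=F_*(|E\rangle)\quad\text{and}\quad\beta(E)=F_*(|E])\qquad\text{in } \mathcal L(\mathfrak H,F(E))$$ are compatible $C^*$-factorizations of $F(E)$, with respect to $(\mathfrak H,\mathfrak B,\mathfrak B^\dagger)$ and $(\mathfrak H,\mathfrak B^\dagger,\mathfrak B)$, respectively. The representations $\rho_{\beta(E)}\colon\mathfrak B\to\mathcal L(F(E))$ and $\rho_{\alpha(E)}\colon\mathfrak B^\dagger\to\mathcal L(F(E))$ are given by $$\rho_{\beta(E)}(F(|b\rangle))=F(l_b),\qquad \rho_{\alpha(E)}(F(|b]))=F(r_b)\qquad\text{for all } b\in B_\theta,\ \theta\in\Theta.$$ Here, for $\theta\in\Theta$, the operators $|b\rangle$, $l_b$ with $b\in B_\theta$ and $|\xi\rangle$ with $\xi\in E_\theta$ are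 $(\theta,\mathrm{id})$-homogeneous, and the operators $|b]$, $r_b$ with $b\in B_\theta$ and $|\xi]$ with $\xi\in E_\theta$ are $(\mathrm{id},\theta^*)$-homogeneous, so that $F$ applies to them with $\sigma=\mathrm{id}$ and $\sigma=\theta^*$, respectively. -/

import Mathlib

open scoped TensorProduct InnerProductSpace RightActions
open MulOpposite ContinuousLinearMap

noncomputable section

namespace HomMod

/-- The closed linear span of a subset of a complex normed space. -/
def clspan {V : Type*} [SeminormedAddCommGroup V] [NormedSpace ℂ V] (S : Set V) :
    Submodule ℂ V :=
  (Submodule.span ℂ S).topologicalClosure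

/-! ### Right Hilbert modules

A right Hilbert module over `B` is a `CStarModule` over `Bᵐᵒᵖ`: with `E` written as a right
module, `op b • ξ` (also written `ξ <• b`) is `ξ b`, and the `B`-valued inner product, linear in
the second variable and with `⟨ξ | η b⟩ = ⟨ξ | η⟩ b`, is `ip`. -/

section Modules

variable {B : Type*} [NonUnitalCStarAlgebra B] [PartialOrder B] [StarOrderedRing B]
variable {E : Type*} [NormedAddCommGroup E] [NormedSpace ℂ E] [SMul Bᵐᵒᵖ E] [CStarModule Bᵐᵒᵖ E]

variable (B) in
/-- The `B`-valued inner product `⟨ξ | η⟩` of a right Hilbert `B`-module. -/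
def ip (ξ η : E) : B := unop (inner Bᵐᵒᵖ ξ η)

lemma ip_add_right (ξ η η' : E) : ip B ξ (η + η') = ip B ξ η + ip B ξ η' := by
  simp [ip]

lemma ip_add_left (ξ ξ' η : E) : ip B (ξ + ξ') η = ip B ξ η + ip B ξ' η := by
  simp [ip]

lemma ip_smul_right (c : ℂ) (ξ η : E) : ip B ξ (c • η) = c • ip B ξ η := by
  simp [ip]

lemma ip_smul_left (c : ℂ) (ξ η : E) : ip B (c • ξ) η = star c • ip B ξ η := by
  simp [ip]

lemma ip_rsmul_right (b : B) (ξ η : E) : ip B ξ (η <• b) = ip B ξ η * b := by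
  simp [ip]

lemma ip_rsmul_left (b : B) (ξ η : E) : ip B (ξ <• b) η = star b * ip B ξ η := by
  simp [ip]

lemma star_ip (ξ η : E) : star (ip B ξ η) = ip B η ξ := by
  rw [ip, ← unop_star, CStarModule.star_inner]; rfl

lemma norm_ip_le (ξ η : E) : ‖ip B ξ η‖ ≤ ‖ξ‖ * ‖η‖ :=
  CStarModule.norm_inner_le (A := Bᵐᵒᵖ) E

lemma norm_sq_eq_ip (ξ : E) : ‖ξ‖ ^ 2 = ‖ip B ξ ξ‖ :=
  CStarModule.norm_sq_eq Bᵐᵒᵖ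

lemma ip_self_eq_star_mul_self (ξ : E) : ∃ c : B, ip B ξ ξ = star c * c := by
  have h : (0 : B) ≤ ip B ξ ξ := CStarModule.inner_self_nonneg (A := Bᵐᵒᵖ) (x := ξ)
  exact CStarAlgebra.nonneg_iff_eq_star_mul_self.mp h

lemma ext_ip {ξ η : E} (h : ∀ ζ, ip B ζ ξ = ip B ζ η) : ξ = η := by
  have h0 : ip B (ξ - η) (ξ - η) = 0 := by
    have h1 : ip B (ξ - η) (ξ - η) = ip B (ξ - η) ξ - ip B (ξ - η) η := by simp [ip]
    rw [h1, h, sub_self]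
  have h2 := norm_sq_eq_ip (B := B) (ξ - η)
  rw [h0, norm_zero] at h2
  exact sub_eq_zero.mp (norm_eq_zero.mp (pow_eq_zero_iff (two_ne_zero) |>.mp h2))

lemma norm_rsmul_le (b : B) (ξ : E) : ‖ξ <• b‖ ≤ ‖ξ‖ * ‖b‖ := by
  have h : ‖ξ <• b‖ ^ 2 ≤ (‖ξ‖ * ‖b‖) ^ 2 := by
    rw [norm_sq_eq_ip (B := B), ip_rsmul_left, ip_rsmul_right]
    calc ‖star b * (ip B ξ ξ * b)‖ ≤ ‖star b‖ * (‖ip B ξ ξ‖ * ‖b‖) :=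
          (norm_mul_le _ _).trans (by gcongr; exact norm_mul_le _ _)
      _ = (‖ξ‖ * ‖b‖) ^ 2 := by rw [norm_star, ← norm_sq_eq_ip]; ring
  exact abs_le_of_sq_le_sq' h (by positivity) |>.2

variable (B E) in
/-- The right multiplication `(ξ, b) ↦ ξ b` of a right Hilbert module as a bounded bilinear map. -/
def rmul : E →L[ℂ] B →L[ℂ] E :=
  LinearMap.mkContinuous₂
    (LinearMap.mk₂ ℂ (fun (ξ : E) (b : B) => ξ <• b)
      (fun ξ ξ' b => ext_ip (B := B) fun ζ => by
        simp only [ip_rsmul_right, ip_add_right, add_mul])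
      (fun c ξ b => ext_ip (B := B) fun ζ => by
        simp only [ip_rsmul_right, ip_smul_right, smul_mul_assoc])
      (fun ξ b b' => ext_ip (B := B) fun ζ => by
        simp only [ip_rsmul_right, ip_add_right, mul_add])
      (fun c ξ b => ext_ip (B := B) fun ζ => by
        simp only [ip_rsmul_right, ip_smul_right, mul_smul_comm]))
    1 (fun ξ b => by simpa using norm_rsmul_le b ξ)

@[simp] lemma rmul_apply (ξ : E) (b : B) : rmul B E ξ b = ξ <• b := rfl

/-- `B` as a right Hilbert module over itself, with `⟨b | c⟩ = b* c`. -/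
instance selfModule : CStarModule Bᵐᵒᵖ B where
  inner b c := op (star b * c)
  inner_add_right := by intros; rw [mul_add, op_add]
  inner_self_nonneg {b} := show (0 : B) ≤ star b * b from star_mul_self_nonneg b
  inner_self {b} := by rw [op_eq_zero_iff]; exact CStarRing.star_mul_self_eq_zero_iff b
  inner_op_smul_right {a x y} := by
    rw [← op_unop a, ← op_mul, op_smul_eq_mul, mul_assoc]
  inner_smul_right_complex := by intros; rw [mul_smul_comm, op_smul]
  star_inner x y := by rw [← op_star]; simp
  norm_eq_sqrt_norm_inner_self b := by
    rw [norm_op, CStarRing.norm_star_mul_self, Real.sqrt_mul_self (norm_nonneg b)]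

@[simp] lemma ip_self (b c : B) : ip B b c = star b * c := rfl

variable (B E) in
/-- A left action of `B` on a right Hilbert `B`-module by adjointable operators, that is, a
`*`-homomorphism from `B` to the adjointable operators of `E` (such a `*`-homomorphism is
automatically bounded). -/
class LeftAction where
  /-- left multiplication `lact b ξ = b ξ` -/
  lact : B →L[ℂ] E →L[ℂ] E
  lact_mul : ∀ (b c : B) (ξ : E), lact (b * c) ξ = lact b (lact c ξ)
  ip_lact : ∀ (b : B) (ξ η : E), ip B (lact b ξ) η = ip B ξ (lact (star b) η)

/-- `B` acts on itself by left multiplication. -/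
instance selfAction : LeftAction B B where
  lact := ContinuousLinearMap.mul ℂ B
  lact_mul b c d := mul_assoc b c d
  ip_lact b c d := by simp [mul_assoc]

variable (B E) in
/-- The conditions for a complete right Hilbert `B`-module with a left action of `B` to be a right
`C*`-`B`-`B`-bimodule: it is full and the left action is nondegenerate. -/
structure IsRightBimodule [LeftAction B E] : Prop where
  complete : CompleteSpace E
  full : clspan {b : B | ∃ ξ η : E, b = ip B ξ η} = ⊤
  nondegenerate : clspan {ξ : E | ∃ (b : B) (η : E), ξ = LeftAction.lact b η} = ⊤

end Modules

/-! ### The internal tensor product of a right Hilbert module and a represented Hilbert space -/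

section Tensor

variable {B : Type*} [NonUnitalCStarAlgebra B] [PartialOrder B] [StarOrderedRing B]
variable {K : Type*} [NormedAddCommGroup K] [InnerProductSpace ℂ K] [CompleteSpace K]
variable {E : Type*} [NormedAddCommGroup E] [NormedSpace ℂ E] [SMul Bᵐᵒᵖ E] [CStarModule Bᵐᵒᵖ E]
variable {F : Type*} [NormedAddCommGroup F] [NormedSpace ℂ F] [SMul Bᵐᵒᵖ F] [CStarModule Bᵐᵒᵖ F]

/-- The algebraic tensor product of `E` and `K`, carrying the semi-inner product
`⟨ξ ⊗ ζ | ξ' ⊗ ζ'⟩ = ⟨ζ | π ⟨ξ | ξ'⟩ ζ'⟩`. -/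
def AlgTensor (_π : B →⋆ₙₐ[ℂ] (K →L[ℂ] K)) (E : Type*) [NormedAddCommGroup E] [NormedSpace ℂ E] :
    Type _ := E ⊗[ℂ] K

instance (π : B →⋆ₙₐ[ℂ] (K →L[ℂ] K)) : AddCommGroup (AlgTensor π E) :=
  inferInstanceAs (AddCommGroup (E ⊗[ℂ] K))

instance (π : B →⋆ₙₐ[ℂ] (K →L[ℂ] K)) : Module ℂ (AlgTensor π E) :=
  inferInstanceAs (Module ℂ (E ⊗[ℂ] K))

variable (π : B →⋆ₙₐ[ℂ] (K →L[ℂ] K))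

/-- The sesquilinear form `⟨ξ ⊗ ζ | ξ' ⊗ ζ'⟩ = ⟨ζ | π ⟨ξ | ξ'⟩ ζ'⟩`. -/
def tensorForm : E ⊗[ℂ] K →ₗ⋆[ℂ] E ⊗[ℂ] K →ₗ[ℂ] ℂ :=
  TensorProduct.lift
    (LinearMap.mk₂'ₛₗ (starRingEnd ℂ) (starRingEnd ℂ)
      (fun (ξ : E) (ζ : K) => TensorProduct.lift
        (LinearMap.mk₂ ℂ (fun (ξ' : E) (ζ' : K) => inner ℂ ζ (π (ip B ξ ξ') ζ'))
          (fun ξ₁ ξ₂ ζ' => by simp [ip_add_right])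
          (fun c ξ₁ ζ' => by simp [ip_smul_right])
          (fun ξ₁ ζ₁ ζ₂ => by simp)
          (fun c ξ₁ ζ' => by simp)))
      (fun ξ₁ ξ₂ ζ => by
        ext; simp [ip_add_left])
      (fun c ξ ζ => by
        ext; simp [ip_smul_left])
      (fun ξ ζ₁ ζ₂ => by
        ext; simp)
      (fun c ξ ζ => by
        ext; simp [mul_comm]))

@[simp] lemma tensorForm_tmul (ξ ξ' : E) (ζ ζ' : K) :
    tensorForm π (ξ ⊗ₜ ζ) (ξ' ⊗ₜ ζ') = inner ℂ ζ (π (ip B ξ ξ') ζ') := rfl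

lemma tensorForm_symm (x y : E ⊗[ℂ] K) :
    (starRingEnd ℂ) (tensorForm π y x) = tensorForm π x y := by
  induction x using TensorProduct.induction_on with
  | zero => simp
  | add x₁ x₂ h₁ h₂ => simp [h₁, h₂]
  | tmul ξ ζ =>
    induction y using TensorProduct.induction_on with
    | zero => simp
    | add y₁ y₂ h₁ h₂ => simp [h₁, h₂]
    | tmul ξ' ζ' =>
      rw [tensorForm_tmul, tensorForm_tmul, inner_conj_symm, ← star_ip, map_star,
        ContinuousLinearMap.star_eq_adjoint, ContinuousLinearMap.adjoint_inner_left]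

end Tensor

section
variable {B : Type*} [NonUnitalCStarAlgebra B] [PartialOrder B] [StarOrderedRing B]
variable {K : Type*} [NormedAddCommGroup K] [InnerProductSpace ℂ K] [CompleteSpace K]
variable {E : Type*} [NormedAddCommGroup E] [NormedSpace ℂ E] [SMul Bᵐᵒᵖ E] [CStarModule Bᵐᵒᵖ E]
variable (π : B →⋆ₙₐ[ℂ] (K →L[ℂ] K))

lemma ip_sum_left {ι : Type*} (s : Finset ι) (ξ : ι → E) (η : E) :
    ip B (∑ i ∈ s, ξ i) η = ∑ i ∈ s, ip B (ξ i) η := by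
  simp [ip, CStarModule.inner_sum_left]

lemma ip_sum_right {ι : Type*} (s : Finset ι) (ξ : ι → E) (η : E) :
    ip B η (∑ i ∈ s, ξ i) = ∑ i ∈ s, ip B η (ξ i) := by
  simp [ip, CStarModule.inner_sum_right]

lemma gram_cyclic {ι : Type*} [Fintype ι] (ξ : ι → E) (b : ι → B) (ω : K) :
    0 ≤ (∑ i, ∑ j, inner ℂ (π (b i) ω) (π (ip B (ξ i) (ξ j)) (π (b j) ω))).re := by
  obtain ⟨c, hc⟩ := ip_self_eq_star_mul_self (B := B) (∑ i, ξ i <• b i)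
  have key : ∑ i, ∑ j, inner ℂ (π (b i) ω) (π (ip B (ξ i) (ξ j)) (π (b j) ω))
      = inner ℂ (π c ω) (π c ω) := by
    have h : inner ℂ (π c ω) (π c ω) = inner ℂ ω (π (star c * c) ω) := by
      rw [map_mul, map_star, ContinuousLinearMap.star_eq_adjoint, mul_apply_eq_comp,
        ContinuousLinearMap.adjoint_inner_right]
    rw [h, ← hc]
    simp only [ip_sum_left, ip_sum_right, Finset.sum_mul, ip_rsmul_left, ip_rsmul_right, map_sum,
      _root_.sum_apply, inner_sum]
    rw [Finset.sum_comm]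
    refine Finset.sum_congr rfl fun i _ => Finset.sum_congr rfl fun j _ => ?_
    rw [map_mul, map_mul, map_star, ContinuousLinearMap.star_eq_adjoint,
      mul_apply_eq_comp, mul_apply_eq_comp,
      ContinuousLinearMap.adjoint_inner_right]
  rw [key]
  exact inner_self_nonneg (𝕜 := ℂ)

lemma gram_cyclic' {ι : Type*} [Fintype ι] (ξ : ι → E) (ζ : ι → K) (ω : K)
    (h : ∀ i, ζ i ∈ closure (Set.range fun b : B => π b ω)) :
    0 ≤ (∑ i, ∑ j, inner ℂ (ζ i) (π (ip B (ξ i) (ξ j)) (ζ j))).re := by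
  have hcl : IsClosed {ζ : ι → K |
      0 ≤ (∑ i, ∑ j, inner ℂ (ζ i) (π (ip B (ξ i) (ξ j)) (ζ j))).re} := by
    refine isClosed_le continuous_const (Complex.continuous_re.comp ?_)
    fun_prop
  have hmem : ζ ∈ closure (Set.univ.pi fun _ : ι => Set.range fun b : B => π b ω) := by
    rw [closure_pi_set]
    exact fun i _ => h i
  refine closure_minimal ?_ hcl hmem
  intro ζ' hζ'
  choose b hb using fun i => hζ' i (Set.mem_univ i)
  have : ζ' = fun i => π (b i) ω := funext fun i => (hb i).symm
  rw [this]
  exact gram_cyclic π ξ b ω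

lemma gram_nonneg_aux {ι : Type*} [Fintype ι] [DecidableEq ι] (ξ : ι → E) (s : Finset ι) :
    ∀ ζ : ι → K, (∀ i ∉ s, ∀ b, π b (ζ i) = 0) →
    0 ≤ (∑ i, ∑ j, inner ℂ (ζ i) (π (ip B (ξ i) (ξ j)) (ζ j))).re := by
  induction s using Finset.induction_on with
  | empty => intro ζ h; simp [h]
  | insert a s ha ih =>
    intro ζ h
    let R : Submodule ℂ K :=
      { carrier := Set.range fun b : B => π b (ζ a)
        add_mem' := by
          rintro _ _ ⟨b, rfl⟩ ⟨c, rfl⟩; exact ⟨b + c, by simp⟩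
        zero_mem' := ⟨0, by simp⟩
        smul_mem' := by rintro c _ ⟨b, rfl⟩; exact ⟨c • b, by simp⟩ }
    let M : Submodule ℂ K := R.topologicalClosure
    have hMc : IsClosed (M : Set K) := Submodule.isClosed_topologicalClosure R
    have : CompleteSpace M := hMc.completeSpace_coe
    have hinv : ∀ (b : B), ∀ x ∈ M, π b x ∈ M := by
      intro b x hx
      have hmaps : Set.MapsTo (π b) (R : Set K) (R : Set K) := by
        rintro _ ⟨c, rfl⟩; exact ⟨b * c, by simp⟩
      exact hmaps.closure (π b).continuous hx
    have hinv' : ∀ (b : B), ∀ x ∈ Mᗮ, π b x ∈ Mᗮ := by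
      intro b x hx u hu
      have h1 := hx _ (hinv (star b) u hu)
      rwa [map_star, ContinuousLinearMap.star_eq_adjoint,
        ContinuousLinearMap.adjoint_inner_left] at h1
    let P : K →L[ℂ] K := M.starProjection
    have hP : ∀ x, P x ∈ M := fun x => M.starProjection_apply_mem x
    have hQ : ∀ x, x - P x ∈ Mᗮ := fun x => M.sub_starProjection_mem_orthogonal x
    have hsplit : ∀ (b : B) (x y : K), inner ℂ x (π b y)
        = inner ℂ (P x) (π b (P y)) + inner ℂ (x - P x) (π b (y - P y)) := by
      intro b x y
      have e1 : inner ℂ (P x) (π b (y - P y)) = 0 := hinv' b _ (hQ y) _ (hP x)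
      have e2 : inner ℂ (x - P x) (π b (P y)) = 0 :=
        Submodule.inner_left_of_mem_orthogonal (hinv b _ (hP y)) (hQ x)
      calc inner ℂ x (π b y)
          = inner ℂ (P x + (x - P x)) (π b (P y + (y - P y))) := by
            rw [add_sub_cancel, add_sub_cancel]
        _ = _ := by rw [map_add (π b), inner_add_left, inner_add_right, inner_add_right, e1, e2]; ring
    have hsum : ∑ i, ∑ j, inner ℂ (ζ i) (π (ip B (ξ i) (ξ j)) (ζ j))
        = ∑ i, ∑ j, inner ℂ (P (ζ i)) (π (ip B (ξ i) (ξ j)) (P (ζ j)))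
          + ∑ i, ∑ j, inner ℂ (ζ i - P (ζ i)) (π (ip B (ξ i) (ξ j)) (ζ j - P (ζ j))) := by
      simp only [← Finset.sum_add_distrib]
      exact Finset.sum_congr rfl fun i _ => Finset.sum_congr rfl fun j _ => hsplit _ _ _
    rw [hsum, Complex.add_re]
    refine add_nonneg (gram_cyclic' π ξ (fun i => P (ζ i)) (ζ a) fun i => hP (ζ i))
      (ih (fun i => ζ i - P (ζ i)) ?_)
    intro i hi b
    by_cases hia : i = a
    · subst hia
      have h1 : π b (ζ i - P (ζ i)) ∈ Mᗮ := hinv' b _ (hQ _)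
      have h2 : π b (ζ i - P (ζ i)) ∈ M := by
        rw [map_sub]
        exact M.sub_mem (R.le_topologicalClosure ⟨b, rfl⟩) (hinv b _ (hP _))
      exact inner_self_eq_zero (𝕜 := ℂ).mp (h1 _ h2)
    · have h0 : ∀ c, π c (ζ i) = 0 := h i (by simp [hia, hi])
      have h3 : P (ζ i) = 0 := by
        refine (Submodule.starProjection_apply_eq_zero_iff M).mpr ?_
        rw [Submodule.orthogonal_closure]
        rintro _ ⟨c, rfl⟩
        change inner ℂ (π c (ζ a)) (ζ i) = 0
        rw [← star_star c, map_star, ContinuousLinearMap.star_eq_adjoint,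
          ContinuousLinearMap.adjoint_inner_left, h0, inner_zero_right]
      simp [h3, h0]

lemma tensorForm_nonneg (x : E ⊗[ℂ] K) : 0 ≤ (tensorForm π x x).re := by
  classical
  obtain ⟨n, ξ, ζ, rfl⟩ : ∃ (n : ℕ) (ξ : Fin n → E) (ζ : Fin n → K), x = ∑ i, ξ i ⊗ₜ[ℂ] ζ i := by
    induction x using TensorProduct.induction_on with
    | zero => exact ⟨0, Fin.elim0, Fin.elim0, by simp⟩
    | tmul ξ ζ => exact ⟨1, fun _ => ξ, fun _ => ζ, by simp⟩
    | add x y hx hy =>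
      obtain ⟨n, ξ, ζ, rfl⟩ := hx
      obtain ⟨m, ξ', ζ', rfl⟩ := hy
      exact ⟨n + m, Fin.append ξ ξ', Fin.append ζ ζ', by simp [Fin.sum_univ_add]⟩
  simp only [map_sum, LinearMap.sum_apply, tensorForm_tmul]
  rw [Finset.sum_comm]
  exact gram_nonneg_aux π ξ Finset.univ ζ (by simp)
end

section Completion

variable {B : Type*} [NonUnitalCStarAlgebra B] [PartialOrder B] [StarOrderedRing B]
variable {K : Type*} [NormedAddCommGroup K] [InnerProductSpace ℂ K] [CompleteSpace K]
variable {E : Type*} [NormedAddCommGroup E] [NormedSpace ℂ E] [SMul Bᵐᵒᵖ E] [CStarModule Bᵐᵒᵖ E]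
variable {F : Type*} [NormedAddCommGroup F] [NormedSpace ℂ F] [SMul Bᵐᵒᵖ F] [CStarModule Bᵐᵒᵖ F]

/-- The pre-inner product structure of `AlgTensor π E`. -/
@[reducible]
def tensorCore (π : B →⋆ₙₐ[ℂ] (K →L[ℂ] K)) : PreInnerProductSpace.Core ℂ (AlgTensor π E) where
  inner x y := tensorForm π x y
  conj_inner_symm x y := tensorForm_symm π x y
  re_inner_nonneg x := tensorForm_nonneg π x
  add_left x y z := LinearMap.map_add₂ (tensorForm (E := E) π) x y z
  smul_left x y c := LinearMap.map_smulₛₗ₂ (tensorForm (E := E) π) c x y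

instance (π : B →⋆ₙₐ[ℂ] (K →L[ℂ] K)) : SeminormedAddCommGroup (AlgTensor π E) :=
  @InnerProductSpace.Core.toSeminormedAddCommGroup ℂ (AlgTensor π E) _ _ _ (tensorCore π)

instance (π : B →⋆ₙₐ[ℂ] (K →L[ℂ] K)) : InnerProductSpace ℂ (AlgTensor π E) :=
  InnerProductSpace.ofCore (tensorCore π)

/-- The internal tensor product `E ⊗_π K`: the Hilbert space obtained from the algebraic tensor
product by dividing out the null space of the semi-inner product and completing. -/
abbrev ITensor (π : B →⋆ₙₐ[ℂ] (K →L[ℂ] K)) (E : Type*) [NormedAddCommGroup E] [NormedSpace ℂ E]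
    [SMul Bᵐᵒᵖ E] [CStarModule Bᵐᵒᵖ E] : Type _ :=
  UniformSpace.Completion (AlgTensor π E)

variable (π : B →⋆ₙₐ[ℂ] (K →L[ℂ] K))

/-- The canonical map from the algebraic tensor product to `E ⊗_π K`. -/
def toITensor : E ⊗[ℂ] K →ₗ[ℂ] ITensor π E :=
  (UniformSpace.Completion.toComplL (𝕜 := ℂ) (E := AlgTensor π E)).toLinearMap

/-- The elementary tensor `ξ ⊗ ζ` in `E ⊗_π K`. -/
def tmul (ξ : E) (ζ : K) : ITensor π E := toITensor π (ξ ⊗ₜ[ℂ] ζ)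

lemma inner_toITensor (x y : E ⊗[ℂ] K) :
    inner ℂ (toITensor π x) (toITensor π y) = tensorForm π x y :=
  UniformSpace.Completion.inner_coe (𝕜 := ℂ) (E := AlgTensor π E) x y

lemma inner_tmul_tmul (ξ ξ' : E) (ζ ζ' : K) :
    inner ℂ (tmul π ξ ζ) (tmul π ξ' ζ') = inner ℂ ζ (π (ip B ξ ξ') ζ') := by
  rw [tmul, tmul, inner_toITensor, tensorForm_tmul]

lemma denseRange_toITensor : DenseRange (toITensor (E := E) π) :=
  UniformSpace.Completion.denseRange_coe (α := AlgTensor π E)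

lemma norm_tmul_le (ξ : E) (ζ : K) : ‖tmul π ξ ζ‖ ≤ ‖ξ‖ * ‖ζ‖ := by
  have h : ‖tmul π ξ ζ‖ ^ 2 ≤ (‖ξ‖ * ‖ζ‖) ^ 2 := by
    rw [← inner_self_eq_norm_sq (𝕜 := ℂ), inner_tmul_tmul]
    calc RCLike.re (inner ℂ ζ (π (ip B ξ ξ) ζ)) ≤ ‖inner ℂ ζ (π (ip B ξ ξ) ζ)‖ :=
          RCLike.re_le_norm _
      _ ≤ ‖ζ‖ * (‖π (ip B ξ ξ)‖ * ‖ζ‖) :=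
          (norm_inner_le_norm _ _).trans (by gcongr; exact (π _).le_opNorm _)
      _ ≤ ‖ζ‖ * (‖ip B ξ ξ‖ * ‖ζ‖) := by
          gcongr; exact NonUnitalStarAlgHom.norm_apply_le π _
      _ = (‖ξ‖ * ‖ζ‖) ^ 2 := by rw [← norm_sq_eq_ip]; ring
  exact abs_le_of_sq_le_sq' h (by positivity) |>.2

open Classical in
/-- The operator `T ⊗ s : E ⊗_π K → F ⊗_π K`, `ξ ⊗ ζ ↦ T ξ ⊗ s ζ`; it is unique if it exists. -/
def amp (T : E →L[ℂ] F) (s : K →L[ℂ] K) : ITensor π E →L[ℂ] ITensor π F :=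
  if h : ∃ R : ITensor π E →L[ℂ] ITensor π F, ∀ ξ ζ, R (tmul π ξ ζ) = tmul π (T ξ) (s ζ) then
    h.choose
  else 0

lemma amp_tmul_of_exists {T : E →L[ℂ] F} {s : K →L[ℂ] K}
    (h : ∃ R : ITensor π E →L[ℂ] ITensor π F, ∀ ξ ζ, R (tmul π ξ ζ) = tmul π (T ξ) (s ζ))
    (ξ : E) (ζ : K) : amp π T s (tmul π ξ ζ) = tmul π (T ξ) (s ζ) := by
  rw [amp, dif_pos h]
  exact h.choose_spec ξ ζ

lemma ext_tmul {V : Type*} [NormedAddCommGroup V] [NormedSpace ℂ V]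
    {R R' : ITensor π E →L[ℂ] V} (h : ∀ ξ ζ, R (tmul π ξ ζ) = R' (tmul π ξ ζ)) : R = R' := by
  have h1 : R.toLinearMap ∘ₗ toITensor π = R'.toLinearMap ∘ₗ toITensor π :=
    TensorProduct.ext' h
  refine ContinuousLinearMap.ext fun x => ?_
  refine congrFun ((denseRange_toITensor π).equalizer R.continuous R'.continuous ?_) x
  exact funext fun y => LinearMap.congr_fun h1 y

/-- Existence of `T ⊗ s` when there is a bounded `X` on `E` such that
`⟨T ξ ⊗ s ζ | T ξ' ⊗ s ζ'⟩ = ⟨X ξ ⊗ ζ | ξ' ⊗ ζ'⟩`. -/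
lemma exists_amp {T : E →L[ℂ] F} {s : K →L[ℂ] K} (X : E →L[ℂ] E)
    (h : ∀ ξ ξ' ζ ζ', inner ℂ (s ζ) (π (ip B (T ξ) (T ξ')) (s ζ'))
      = inner ℂ ζ (π (ip B (X ξ) ξ') ζ')) :
    ∃ R : ITensor π E →L[ℂ] ITensor π F, ∀ ξ ζ, R (tmul π ξ ζ) = tmul π (T ξ) (s ζ) := by
  let f : E ⊗[ℂ] K →ₗ[ℂ] ITensor π F :=
    toITensor π ∘ₗ TensorProduct.map T.toLinearMap s.toLinearMap
  let Y : E ⊗[ℂ] K →ₗ[ℂ] E ⊗[ℂ] K := TensorProduct.map X.toLinearMap LinearMap.id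
  have hf : ∀ x y, inner ℂ (f x) (f y) = inner ℂ (toITensor π (Y x)) (toITensor π y) := by
    intro x y
    induction x using TensorProduct.induction_on with
    | zero => simp
    | add x₁ x₂ h₁ h₂ => simp only [map_add, inner_add_left, h₁, h₂]
    | tmul ξ ζ =>
      induction y using TensorProduct.induction_on with
      | zero => simp
      | add y₁ y₂ h₁ h₂ => simp only [map_add, inner_add_right, h₁, h₂]
      | tmul ξ' ζ' =>
        change inner ℂ (tmul π (T ξ) (s ζ)) (tmul π (T ξ') (s ζ'))
          = inner ℂ (tmul π (X ξ) ζ) (tmul π ξ' ζ')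
        rw [inner_tmul_tmul, inner_tmul_tmul, h]
  have hsymm : ∀ x y, inner ℂ (toITensor π (Y x)) (toITensor π y)
      = inner ℂ (toITensor π x) (toITensor π (Y y)) := by
    intro x y
    rw [← hf, ← inner_conj_symm, hf, inner_conj_symm]
  let M : ℝ := ‖X‖ + 1
  have hM : 0 < M := by positivity
  have hgrow : ∀ x : E ⊗[ℂ] K, ∃ C : ℝ, ∀ n : ℕ, ‖toITensor π ((Y ^ n) x)‖ ≤ C * M ^ n := by
    intro x
    induction x using TensorProduct.induction_on with
    | zero => exact ⟨0, fun n => by simp⟩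
    | add x₁ x₂ h₁ h₂ =>
      obtain ⟨C₁, h₁⟩ := h₁
      obtain ⟨C₂, h₂⟩ := h₂
      refine ⟨C₁ + C₂, fun n => ?_⟩
      rw [map_add, map_add, add_mul]
      exact (norm_add_le _ _).trans (add_le_add (h₁ n) (h₂ n))
    | tmul ξ ζ =>
      have h1 : ∀ n : ℕ, (Y ^ n) (ξ ⊗ₜ ζ) = ((X ^ n) ξ) ⊗ₜ ζ := by
        intro n
        induction n with
        | zero => simp
        | succ n ih => rw [pow_succ', Module.End.mul_apply, ih, pow_succ']; rfl
      have h2 : ∀ n : ℕ, ‖(X ^ n) ξ‖ ≤ M ^ n * ‖ξ‖ := by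
        intro n
        induction n with
        | zero => simp
        | succ n ih =>
          have h3 : (X ^ (n + 1)) ξ = X ((X ^ n) ξ) := by rw [pow_succ']; rfl
          rw [h3]
          calc ‖X ((X ^ n) ξ)‖ ≤ ‖X‖ * ‖(X ^ n) ξ‖ := X.le_opNorm _
            _ ≤ M * (M ^ n * ‖ξ‖) := mul_le_mul (by simp [M]) ih (norm_nonneg _) hM.le
            _ = M ^ (n + 1) * ‖ξ‖ := by ring
      refine ⟨‖ξ‖ * ‖ζ‖, fun n => ?_⟩
      rw [h1]
      calc ‖tmul π ((X ^ n) ξ) ζ‖ ≤ ‖(X ^ n) ξ‖ * ‖ζ‖ := norm_tmul_le π _ _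
        _ ≤ M ^ n * ‖ξ‖ * ‖ζ‖ := by gcongr; exact h2 n
        _ = ‖ξ‖ * ‖ζ‖ * M ^ n := by ring
  have hstep : ∀ x : E ⊗[ℂ] K, ‖toITensor π (Y x)‖ ^ 2
      ≤ ‖toITensor π x‖ * ‖toITensor π (Y (Y x))‖ := by
    intro x
    rw [← inner_self_eq_norm_sq (𝕜 := ℂ), hsymm]
    exact (RCLike.re_le_norm _).trans (norm_inner_le_norm _ _)
  have hY : ∀ x : E ⊗[ℂ] K, ‖toITensor π (Y x)‖ ≤ M * ‖toITensor π x‖ := by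
    intro x
    by_contra! hlt
    obtain ⟨C, hC⟩ := hgrow x
    set a : ℕ → ℝ := fun n => ‖toITensor π ((Y ^ n) x)‖ with ha
    have hsucc : ∀ n, a (n + 1) ^ 2 ≤ a n * a (n + 2) := by
      intro n
      have := hstep ((Y ^ n) x)
      simpa only [ha, pow_succ', Module.End.mul_apply] using this
    have a0 : a 0 = ‖toITensor π x‖ := by simp [ha]
    have a1 : a 1 = ‖toITensor π (Y x)‖ := by simp [ha]
    rw [← a0, ← a1] at hlt
    have hnn : ∀ n, 0 ≤ a n := fun n => norm_nonneg _
    have ha0 : 0 < a 0 := by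
      rcases (hnn 0).eq_or_lt with h0 | h0
      · have h1 := hsucc 0
        rw [← h0, zero_mul] at h1
        have h2 : a 1 = 0 := by
          have := le_antisymm h1 (sq_nonneg _)
          exact pow_eq_zero_iff two_ne_zero |>.mp this
        rw [← h0, h2] at hlt
        simp at hlt
      · exact h0
    set r := a 1 / a 0 with hr
    have hrM : M < r := by rw [hr, lt_div_iff₀ ha0]; exact hlt
    have hr0 : 0 < r := hM.trans hrM
    have hratio : ∀ n, 0 < a n ∧ r * a n ≤ a (n + 1) := by
      intro n
      induction n with
      | zero => exact ⟨ha0, by rw [hr, div_mul_cancel₀ _ ha0.ne']⟩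
      | succ n ih =>
        have hpos : 0 < a (n + 1) := (mul_pos hr0 ih.1).trans_le ih.2
        refine ⟨hpos, ?_⟩
        have h1 := hsucc n
        have h2 : r * a n * a (n + 1) ≤ a (n + 1) ^ 2 := by
          rw [sq]; exact mul_le_mul_of_nonneg_right ih.2 hpos.le
        have h3 : a n * (r * a (n + 1)) ≤ a n * a (n + 2) := by nlinarith
        exact le_of_mul_le_mul_left h3 ih.1
    have hlow : ∀ n, r ^ n * a 0 ≤ a n := by
      intro n
      induction n with
      | zero => simp
      | succ n ih =>
        calc r ^ (n + 1) * a 0 = r * (r ^ n * a 0) := by ring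
          _ ≤ r * a n := by gcongr
          _ ≤ a (n + 1) := (hratio n).2
    have hbig : ∀ n : ℕ, (r / M) ^ n ≤ C / a 0 := by
      intro n
      rw [le_div_iff₀ ha0, div_pow, div_mul_eq_mul_div, div_le_iff₀ (by positivity)]
      exact (hlow n).trans (hC n)
    obtain ⟨n, hn⟩ := pow_unbounded_of_one_lt (C / a 0) ((one_lt_div hM).mpr hrM)
    exact absurd (hbig n) (not_le.mpr hn)
  have hbound : ∀ x, ‖f x‖ ≤ M * ‖toITensor π x‖ := by
    intro x
    have h1 : ‖f x‖ ^ 2 ≤ (M * ‖toITensor π x‖) ^ 2 := by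
      have hM1 : 1 ≤ M := by simp [M]
      rw [← inner_self_eq_norm_sq (𝕜 := ℂ), hf]
      calc RCLike.re (inner ℂ (toITensor π (Y x)) (toITensor π x))
          ≤ ‖toITensor π (Y x)‖ * ‖toITensor π x‖ :=
            (RCLike.re_le_norm _).trans (norm_inner_le_norm _ _)
        _ ≤ (M * ‖toITensor π x‖) * ‖toITensor π x‖ := by gcongr; exact hY x
        _ = M * ‖toITensor π x‖ ^ 2 := by ring
        _ ≤ M ^ 2 * ‖toITensor π x‖ ^ 2 := by gcongr; nlinarith
        _ = _ := by ring
    exact abs_le_of_sq_le_sq' h1 (by positivity) |>.2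
  refine ⟨f.extendOfNorm (toITensor π), fun ξ ζ => ?_⟩
  exact LinearMap.extendOfNorm_eq (denseRange_toITensor π) ⟨M, hbound⟩ (ξ ⊗ₜ ζ)

end Completion

/-! ### Partial automorphisms, homogeneous elements and operators -/

section PartialAutomorphisms

variable {B : Type*} [NonUnitalCStarAlgebra B]

/-- Closed two-sided ideals of a `C*`-algebra. -/
structure IsClosedIdeal (I : Set B) : Prop where
  isClosed : IsClosed I
  zero_mem : (0 : B) ∈ I
  add_mem : ∀ {a b : B}, a ∈ I → b ∈ I → a + b ∈ I
  smul_mem : ∀ (c : ℂ) {a : B}, a ∈ I → c • a ∈ I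
  mul_mem_left : ∀ (b : B) {a : B}, a ∈ I → b * a ∈ I
  mul_mem_right : ∀ (b : B) {a : B}, a ∈ I → a * b ∈ I

variable (B) in
/-- A partial automorphism `θ` of `B`: a `*`-isomorphism between two closed ideals of `B`. It is
given by a partial bijection of `B`; `c ∈ θ.map b` says that `b ∈ Dom θ` and `θ b = c`. -/
@[ext]
structure PAut where
  map : B ≃. B
  dom_ideal : IsClosedIdeal {b : B | ∃ c, c ∈ map b}
  img_ideal : IsClosedIdeal {c : B | ∃ b, c ∈ map b}
  map_add : ∀ {a b a' b' : B}, a' ∈ map a → b' ∈ map b → a' + b' ∈ map (a + b)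
  map_smul : ∀ (z : ℂ) {a a' : B}, a' ∈ map a → z • a' ∈ map (z • a)
  map_mul : ∀ {a b a' b' : B}, a' ∈ map a → b' ∈ map b → a' * b' ∈ map (a * b)
  map_star : ∀ {a a' : B}, a' ∈ map a → star a' ∈ map (star a)

namespace PAut

/-- The domain of a partial automorphism. -/
def dom (θ : PAut B) : Set B := {b | ∃ c, c ∈ θ.map b}

/-- The image of a partial automorphism. -/
def img (θ : PAut B) : Set B := {c | ∃ b, c ∈ θ.map b}

/-- `θ ≤ θ'` means that `θ'` extends `θ`. -/
instance : PartialOrder (PAut B) := PartialOrder.lift PAut.map fun _ _ => PAut.ext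

variable (B) in
/-- The identity of `B` as a partial automorphism. -/
def id : PAut B where
  map := PEquiv.refl B
  dom_ideal := by constructor <;> simp
  img_ideal := by constructor <;> simp
  map_add := by simp +contextual
  map_smul := by simp +contextual
  map_mul := by simp +contextual
  map_star := by simp +contextual

/-- The inverse `θ* = θ⁻¹`. -/
def symm (θ : PAut B) : PAut B where
  map := θ.map.symm
  dom_ideal := by simpa only [PEquiv.mem_iff_mem] using θ.img_ideal
  img_ideal := by simpa only [PEquiv.mem_iff_mem] using θ.dom_ideal
  map_add h h' := (PEquiv.mem_iff_mem _).mpr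
    (θ.map_add ((PEquiv.mem_iff_mem _).mp h) ((PEquiv.mem_iff_mem _).mp h'))
  map_smul z _ _ h := (PEquiv.mem_iff_mem _).mpr (θ.map_smul z ((PEquiv.mem_iff_mem _).mp h))
  map_mul h h' := (PEquiv.mem_iff_mem _).mpr
    (θ.map_mul ((PEquiv.mem_iff_mem _).mp h) ((PEquiv.mem_iff_mem _).mp h'))
  map_star h := (PEquiv.mem_iff_mem _).mpr (θ.map_star ((PEquiv.mem_iff_mem _).mp h))

/-- `τ` is the composition `θ θ'` (first `θ'`, then `θ`, wherever this is defined). -/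
def IsComp (θ θ' τ : PAut B) : Prop := τ.map = θ'.map.trans θ.map

/-- `τ` is the meet `θ ∧ θ'`, the largest partial automorphism extended by `θ` and `θ'`. -/
def IsMeet (θ θ' τ : PAut B) : Prop := IsGreatest {ρ : PAut B | ρ ≤ θ ∧ ρ ≤ θ'} τ

end PAut

/-- A set of partial automorphisms that is an inverse semigroup (under composition and `*`). -/
structure IsInverseSemigroup (Θ : Set (PAut B)) : Prop where
  comp_mem : ∀ θ ∈ Θ, ∀ θ' ∈ Θ, ∃ τ ∈ Θ, PAut.IsComp θ θ' τ
  symm_mem : ∀ θ ∈ Θ, θ.symm ∈ Θ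

end PartialAutomorphisms

section Homogeneous

variable {B : Type*} [NonUnitalCStarAlgebra B] [PartialOrder B] [StarOrderedRing B]
variable {E : Type*} [NormedAddCommGroup E] [NormedSpace ℂ E] [SMul Bᵐᵒᵖ E] [CStarModule Bᵐᵒᵖ E]
  [LeftAction B E]
variable {F : Type*} [NormedAddCommGroup F] [NormedSpace ℂ F] [SMul Bᵐᵒᵖ F] [CStarModule Bᵐᵒᵖ F]
  [LeftAction B F]
variable {G : Type*} [NormedAddCommGroup G] [NormedSpace ℂ G] [SMul Bᵐᵒᵖ G] [CStarModule Bᵐᵒᵖ G]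
  [LeftAction B G]

variable (E) in
/-- The `θ`-homogeneous elements of `E`: those `ξ ∈ E Dom(θ)` with `ξ b = θ(b) ξ` for all
`b ∈ Dom(θ)`. Here `E Dom(θ)` is written as the closed linear span of the products `η d`; by the
Cohen factorization theorem each element of it is a single product. -/
def homog (θ : PAut B) : Set E :=
  {ξ | ξ ∈ clspan {x : E | ∃ (η : E), ∃ d ∈ θ.dom, x = η <• d} ∧
    ∀ b c, c ∈ θ.map b → ξ <• b = LeftAction.lact c ξ}

variable (E) in
/-- `E` is `Θ`-decomposable: the `θ`-homogeneous elements, `θ ∈ Θ`, are linearly dense. -/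
def IsDecomposable (Θ : Set (PAut B)) : Prop :=
  clspan {ξ : E | ∃ θ ∈ Θ, ξ ∈ homog E θ} = ⊤

variable (E) in
/-- `E` is `Θ`-supported: for each partial automorphism `θ`, the space of `θ`-homogeneous elements
is the closed linear span of the `θ'`-homogeneous elements with `θ' ∈ Θ`, `θ' ≤ θ`. -/
def IsSupported (Θ : Set (PAut B)) : Prop :=
  ∀ θ : PAut B, homog E θ = (clspan {ξ : E | ∃ θ' ∈ Θ, θ' ≤ θ ∧ ξ ∈ homog E θ'} : Set E)

/-- Admissible inverse semigroups of partial automorphisms. -/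
structure IsAdmissible (Θ : Set (PAut B)) : Prop where
  inverseSemigroup : IsInverseSemigroup Θ
  supported : IsSupported B Θ
  id_mem : PAut.id B ∈ Θ
  meet_mem : ∀ θ ∈ Θ, ∀ θ' ∈ Θ, ∃ τ ∈ Θ, PAut.IsMeet θ θ' τ

/-- `S` is the adjoint of `T` relative to `σ`: `⟨S η | ξ⟩ ∈ Dom(σ)` and
`⟨η | T ξ⟩ = σ ⟨S η | ξ⟩`. -/
def IsAdjoint (σ : PAut B) (T : E →L[ℂ] F) (S : F →L[ℂ] E) : Prop :=
  ∀ ξ η, ip B η (T ξ) ∈ σ.map (ip B (S η) ξ)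

/-- `(ρ, σ)`-homogeneous operators (such operators, and their adjoints, are automatically linear
and bounded): the image of `T` lies in `[Img(ρ) F]`, `T a ξ = ρ(a) T ξ` for `a ∈ Dom(ρ)`, and `T`
has an adjoint relative to `σ`. -/
structure IsHomogeneous (ρ σ : PAut B) (T : E →L[ℂ] F) : Prop where
  range_subset : ∀ ξ, T ξ ∈ clspan {x : F | ∃ c ∈ ρ.img, ∃ η : F, x = LeftAction.lact c η}
  map_lact : ∀ a c, c ∈ ρ.map a → ∀ ξ, T (LeftAction.lact a ξ) = LeftAction.lact c (T ξ)
  exists_adjoint : ∃ S, IsAdjoint σ T S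

variable (B E F) in
/-- Families `C = (C^ρ_σ)` of sets of operators, indexed by pairs of partial automorphisms;
`C ρ σ` is `C^ρ_σ`. -/
abbrev OpFamily : Type _ := PAut B → PAut B → Set (E →L[ℂ] F)

namespace OpFamily

/-- The adjoint family, `(C*)^ρ_σ = (C^{ρ*}_{σ*})*`. -/
def adj (C : OpFamily B E F) : OpFamily B F E := fun ρ σ =>
  {S | ∃ T ∈ C ρ.symm σ.symm, IsAdjoint σ.symm T S}

/-- The product family: `[D C]^{ρ''}_{σ''}` is the closed linear span of all `T' T` with
`T' ∈ D^{ρ'}_{σ'}`, `T ∈ C^ρ_σ`, `ρ' ρ ≤ ρ''` and `σ' σ ≤ σ''`. -/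
def prod (D : OpFamily B F G) (C : OpFamily B E F) : OpFamily B E G := fun ρ'' σ'' =>
  clspan {R : E →L[ℂ] G | ∃ ρ' σ' ρ σ : PAut B, ρ.map.trans ρ'.map ≤ ρ''.map ∧
    σ.map.trans σ'.map ≤ σ''.map ∧ ∃ T' ∈ D ρ' σ', ∃ T ∈ C ρ σ, R = T' ∘L T}

end OpFamily

variable (B) in
/-- The operator `|ξ⟩ : B → E`, `b ↦ ξ b`. -/
def ket (ξ : E) : B →L[ℂ] E := rmul B E ξ

variable (B) in
/-- The operator `|ξ] : B → E`, `b ↦ b ξ`. -/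
def rket (ξ : E) : B →L[ℂ] E := (LeftAction.lact (B := B) (E := E)).flip ξ

variable (E) in
/-- The operator `E → E`, `ξ ↦ b ξ`. -/
def leftMul (b : B) : E →L[ℂ] E := LeftAction.lact b

variable (E) in
/-- The operator `E → E`, `ξ ↦ ξ b`. -/
def rightMul (b : B) : E →L[ℂ] E := (rmul B E).flip b

variable (B E) in
open Classical in
/-- The family `|E⟩` of operators from `B` to `E`: `|E⟩^θ_id = {|ξ⟩ : ξ ∈ E_θ}`, and the other
components are zero. -/
def ketFamily : OpFamily B B E := fun ρ σ =>
  if σ = PAut.id B then {T | ∃ ξ ∈ homog E ρ, T = ket B ξ} else {0}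

variable (B E) in
open Classical in
/-- The family `|E]` of operators from `B` to `E`: `|E]^id_θ = {|ξ] : ξ ∈ E_{θ*}}`, and the other
components are zero. -/
def rketFamily : OpFamily B B E := fun ρ σ =>
  if ρ = PAut.id B then {T | ∃ ξ ∈ homog E σ.symm, T = rket B ξ} else {0}

variable (E) in
/-- `Θ`-admissible right `C*`-`B`-`B`-bimodules. -/
structure IsAdmissibleBimodule (Θ : Set (PAut B)) : Prop where
  bimodule : IsRightBimodule B E
  decomposable : IsDecomposable E Θ
  ket_adj_ket : (ketFamily B E).adj.prod (ketFamily B E) = ketFamily B B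
  rket_adj_rket : (rketFamily B E).adj.prod (rketFamily B E) = rketFamily B B

end Homogeneous

/-! ### Covariant representations and the functor `F` -/

section Functor

variable {B : Type*} [NonUnitalCStarAlgebra B] [PartialOrder B] [StarOrderedRing B]

/-- A covariant representation `(π, υ)` of `(B, Θ)` on a Hilbert space `K`. (Only the values of
`υ` on `Θ` are used.) -/
structure CovariantRep (Θ : Set (PAut B)) (K : Type*) [NormedAddCommGroup K]
    [InnerProductSpace ℂ K] [CompleteSpace K] where
  π : B →⋆ₙₐ[ℂ] (K →L[ℂ] K)
  υ : PAut B → (K →L[ℂ] K)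
  υ_comp : ∀ θ ∈ Θ, ∀ θ' ∈ Θ, ∀ τ ∈ Θ, PAut.IsComp θ θ' τ → υ θ ∘L υ θ' = υ τ
  υ_symm : ∀ θ ∈ Θ, adjoint (υ θ) = υ θ.symm
  range_υ : ∀ θ ∈ Θ, Set.range (υ θ) = (clspan {x : K | ∃ b ∈ θ.img, ∃ ζ, x = π b ζ} : Set K)
  covariant : ∀ θ ∈ Θ, ∀ b c, c ∈ θ.map b → υ θ ∘L π b ∘L adjoint (υ θ) = π c

namespace CovariantRep

variable {K : Type*} [NormedAddCommGroup K] [InnerProductSpace ℂ K] [CompleteSpace K]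
variable {E : Type*} [NormedAddCommGroup E] [NormedSpace ℂ E] [SMul Bᵐᵒᵖ E] [CStarModule Bᵐᵒᵖ E]
  [LeftAction B E]
variable {F : Type*} [NormedAddCommGroup F] [NormedSpace ℂ F] [SMul Bᵐᵒᵖ F] [CStarModule Bᵐᵒᵖ F]
  [LeftAction B F]
variable {Θ : Set (PAut B)} (R : CovariantRep Θ K)

variable (E) in
/-- The functor `F` on objects: `F(E) = E ⊗_π K`. -/
abbrev obj : Type _ := ITensor R.π E

/-- The functor `F` on morphisms: `F(T) = T ⊗ υ(σ)` for a `(ρ, σ)`-homogeneous operator `T`. -/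
def mor (σ : PAut B) (T : E →L[ℂ] F) : R.obj E →L[ℂ] R.obj F := amp R.π T (R.υ σ)

/-- `F_*(C)` for a family `C`: the closed linear span of the operators `F(c)` with `c ∈ C^ρ_σ`, `ρ, σ ∈ Θ`. -/
def morSpan (C : OpFamily B E F) : Submodule ℂ (R.obj E →L[ℂ] R.obj F) :=
  clspan {S | ∃ ρ ∈ Θ, ∃ σ ∈ Θ, ∃ T ∈ C ρ σ, S = R.mor σ T}

lemma symm_trans_symm {α : Type*} (f : α ≃. α) :
    (f.symm.trans f).trans f.symm = f.symm := by
  refine PEquiv.ext fun x => Option.ext fun y => ?_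
  rw [← Option.mem_def, ← Option.mem_def]
  constructor
  · intro h
    obtain ⟨z, hz, hy⟩ := (PEquiv.mem_trans _ _ _ _).mp h
    obtain ⟨w, hw, hz'⟩ := (PEquiv.mem_trans _ _ _ _).mp hz
    have h1 : x ∈ f w := (PEquiv.mem_iff_mem _).mp hw
    have h2 : x = z := Option.mem_unique h1 hz'
    rwa [h2]
  · intro h
    exact (PEquiv.mem_trans _ _ _ _).mpr
      ⟨x, (PEquiv.mem_trans _ _ _ _).mpr ⟨y, h, (PEquiv.mem_iff_mem _).mp h⟩, h⟩

lemma υ_adjoint_comp_self (hΘ : IsInverseSemigroup Θ) {σ : PAut B} (hσ : σ ∈ Θ) {b : B}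
    (hb : b ∈ σ.dom) (ζ : K) : adjoint (R.υ σ) (R.υ σ (R.π b ζ)) = R.π b ζ := by
  have hs := hΘ.symm_mem σ hσ
  have hmem : R.π b ζ ∈ Set.range (R.υ σ.symm) := by
    rw [R.range_υ _ hs]
    refine Submodule.le_topologicalClosure _ (Submodule.subset_span ⟨b, ?_, ζ, rfl⟩)
    obtain ⟨c, hc⟩ := hb
    exact ⟨c, (PEquiv.mem_iff_mem _).mpr hc⟩
  obtain ⟨κ, hκ⟩ := hmem
  obtain ⟨τ, hτ, hcomp⟩ := hΘ.comp_mem σ.symm hs σ hσ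
  have h1 := R.υ_comp _ hs _ hσ _ hτ hcomp
  have h2 : PAut.IsComp τ σ.symm σ.symm := by
    unfold PAut.IsComp at *
    rw [hcomp]
    change σ.map.symm = σ.map.symm.trans (σ.map.trans σ.map.symm)
    rw [← PEquiv.trans_assoc]
    exact (symm_trans_symm σ.map).symm
  have h3 := R.υ_comp _ hτ _ hs _ hs h2
  rw [R.υ_symm σ hσ, ← hκ]
  calc R.υ σ.symm (R.υ σ (R.υ σ.symm κ)) = (R.υ σ.symm ∘L R.υ σ) (R.υ σ.symm κ) := rfl
    _ = (R.υ τ ∘L R.υ σ.symm) κ := by rw [h1]; rfl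
    _ = R.υ σ.symm κ := by rw [h3]

/-- `F(T)` satisfies its defining identity for every homogeneous operator. -/
theorem mor_tmul (hΘ : IsInverseSemigroup Θ) {ρ σ : PAut B} (hσ : σ ∈ Θ) {T : E →L[ℂ] F}
    (hT : IsHomogeneous ρ σ T) (ξ : E) (ζ : K) :
    R.mor σ T (tmul R.π ξ ζ) = tmul R.π (T ξ) (R.υ σ ζ) := by
  obtain ⟨S, hS⟩ := hT.exists_adjoint
  refine amp_tmul_of_exists _ (exists_amp _ (S ∘L T) fun ξ ξ' ζ ζ' => ?_) ξ ζ
  have hmem := hS ξ' (T ξ)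
  change inner ℂ (R.υ σ ζ) (R.π _ (R.υ σ ζ')) = inner ℂ ζ (R.π (ip B (S (T ξ)) ξ') ζ')
  rw [← R.covariant σ hσ _ _ hmem]
  set c := ip B (S (T ξ)) ξ'
  have hc : c ∈ σ.dom := ⟨_, hmem⟩
  have hc' : star c ∈ σ.dom := ⟨_, σ.map_star hmem⟩
  have hadj : ∀ x y : K, inner ℂ x (R.π c y) = inner ℂ (R.π (star c) x) y := by
    intro x y
    rw [map_star, ContinuousLinearMap.star_eq_adjoint,
      ContinuousLinearMap.adjoint_inner_left]
  change inner ℂ (R.υ σ ζ) (R.υ σ (R.π c (adjoint (R.υ σ) (R.υ σ ζ')))) = _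
  rw [← ContinuousLinearMap.adjoint_inner_right, R.υ_adjoint_comp_self hΘ hσ hc, hadj,
    ContinuousLinearMap.adjoint_inner_right, ← ContinuousLinearMap.adjoint_inner_left,
    R.υ_adjoint_comp_self hΘ hσ hc', ← hadj]

end CovariantRep

end Functor

/-! ### `C*`-bases and `C*`-factorizations -/

section Bases

variable {H : Type*} [NormedAddCommGroup H] [InnerProductSpace ℂ H] [CompleteSpace H]
variable {H' : Type*} [NormedAddCommGroup H'] [InnerProductSpace ℂ H'] [CompleteSpace H']
variable {K : Type*} [NormedAddCommGroup K] [InnerProductSpace ℂ K] [CompleteSpace K]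

variable (H) in
/-- A `C*`-base `(H, 𝔅, 𝔅†)`: a Hilbert space `H` with two commuting nondegenerate
`C*`-algebras `𝔅 = left` and `𝔅† = right` of operators on `H`. -/
structure CStarBase where
  left : NonUnitalStarSubalgebra ℂ (H →L[ℂ] H)
  right : NonUnitalStarSubalgebra ℂ (H →L[ℂ] H)
  isClosed_left : IsClosed (left : Set (H →L[ℂ] H))
  isClosed_right : IsClosed (right : Set (H →L[ℂ] H))
  commute : ∀ a ∈ left, ∀ b ∈ right, Commute a b
  nondegenerate_left : clspan {x : H | ∃ a ∈ left, ∃ ζ, x = a ζ} = ⊤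
  nondegenerate_right : clspan {x : H | ∃ b ∈ right, ∃ ζ, x = b ζ} = ⊤

namespace CStarBase

/-- The opposite `C*`-base `(H, 𝔅†, 𝔅)`. -/
def op (𝒞 : CStarBase H) : CStarBase H where
  left := 𝒞.right
  right := 𝒞.left
  isClosed_left := 𝒞.isClosed_right
  isClosed_right := 𝒞.isClosed_left
  commute a ha b hb := (𝒞.commute b hb a ha).symm
  nondegenerate_left := 𝒞.nondegenerate_right
  nondegenerate_right := 𝒞.nondegenerate_left

/-- `α` is a `C*`-factorization of `K` with respect to the `C*`-base `(H, 𝔅, 𝔅†)`: a closed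
subspace of the operators from `H` to `K` such that `[α* α] = 𝔅`, `[α 𝔅] = α`, `[α H] = K`. -/
structure IsFactorization (𝒞 : CStarBase H) (α : Submodule ℂ (H →L[ℂ] K)) : Prop where
  isClosed : IsClosed (α : Set (H →L[ℂ] K))
  adjoint_comp : (clspan {x : H →L[ℂ] H | ∃ ξ ∈ α, ∃ η ∈ α, x = adjoint ξ ∘L η} :
    Set (H →L[ℂ] H)) = 𝒞.left
  comp_left : clspan {x : H →L[ℂ] K | ∃ ξ ∈ α, ∃ a ∈ 𝒞.left, x = ξ ∘L a} = α
  nondegenerate : clspan {x : K | ∃ ξ ∈ α, ∃ ζ, x = ξ ζ} = ⊤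

namespace IsFactorization

variable {𝒞 : CStarBase H} {α : Submodule ℂ (H →L[ℂ] K)}

lemma adjoint_comp_mem (hα : 𝒞.IsFactorization α) {ξ η : H →L[ℂ] K} (hξ : ξ ∈ α) (hη : η ∈ α) :
    adjoint ξ ∘L η ∈ 𝒞.left := by
  rw [← SetLike.mem_coe, ← hα.adjoint_comp]
  exact Submodule.le_topologicalClosure _ (Submodule.subset_span ⟨ξ, hξ, η, hη, rfl⟩)

lemma ext_comp (hα : 𝒞.IsFactorization α) {T T' : K →L[ℂ] K}
    (h : ∀ ξ ∈ α, ∀ ζ, T (ξ ζ) = T' (ξ ζ)) : T = T' := by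
  have hle : clspan {x : K | ∃ ξ ∈ α, ∃ ζ, x = ξ ζ} ≤ (T - T').ker := by
    refine Submodule.topologicalClosure_minimal _ (Submodule.span_le.mpr ?_)
      (T - T').isClosed_ker
    rintro _ ⟨ξ, hξ, ζ, rfl⟩
    simp [h ξ hξ ζ]
  rw [hα.nondegenerate] at hle
  ext x
  have hx : (T - T') x = 0 := hle (Submodule.mem_top (x := x))
  exact sub_eq_zero.mp hx

/-- The map `ξ ⊗ ζ ↦ ξ b ζ` on the algebraic tensor product of `α` and `H`. -/
def evalMap (α : Submodule ℂ (H →L[ℂ] K)) (b : H →L[ℂ] H) : α ⊗[ℂ] H →ₗ[ℂ] K :=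
  TensorProduct.lift (LinearMap.mk₂ ℂ (fun (ξ : α) (ζ : H) => (ξ : H →L[ℂ] K) (b ζ))
    (by intros; simp) (by intros; simp) (by intros; simp) (by intros; simp))

@[simp] lemma evalMap_tmul (b : H →L[ℂ] H) (ξ : α) (ζ : H) :
    evalMap α b (ξ ⊗ₜ ζ) = (ξ : H →L[ℂ] K) (b ζ) := rfl

lemma inner_evalMap (hα : 𝒞.IsFactorization α) {b c : H →L[ℂ] H}
    (hb : ∀ a ∈ 𝒞.left, Commute a b) (x y : α ⊗[ℂ] H) :
    inner ℂ (evalMap α b x) (evalMap α c y)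
      = inner ℂ (evalMap α 1 x) (evalMap α (star b * c) y) := by
  induction x using TensorProduct.induction_on with
  | zero => simp
  | add x₁ x₂ h₁ h₂ => simp only [map_add, inner_add_left, h₁, h₂]
  | tmul ξ ζ =>
    induction y using TensorProduct.induction_on with
    | zero => simp
    | add y₁ y₂ h₁ h₂ => simp only [map_add, inner_add_right, h₁, h₂]
    | tmul η ω =>
      have hm := hα.adjoint_comp_mem ξ.2 η.2
      have hm' := hα.adjoint_comp_mem η.2 ξ.2
      have hcomm : star b * (adjoint ξ.1 ∘L η.1) = (adjoint ξ.1 ∘L η.1) * star b := by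
        have h1 := (hb _ (star_mem hm)).eq
        have h2 := congrArg star h1
        simpa [star_mul] using h2
      have h3 : ∀ z, star b (adjoint ξ.1 (η.1 z)) = adjoint ξ.1 (η.1 (star b z)) := fun z =>
        congrArg (fun T : H →L[ℂ] H => T z) hcomm
      simp only [evalMap_tmul]
      rw [← ContinuousLinearMap.adjoint_inner_right, ← ContinuousLinearMap.adjoint_inner_right,
        ← ContinuousLinearMap.star_eq_adjoint b, h3, ContinuousLinearMap.adjoint_inner_right]
      rfl

lemma norm_evalMap_le (hα : 𝒞.IsFactorization α) {b : H →L[ℂ] H} (hb : b ∈ 𝒞.right)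
    (x : α ⊗[ℂ] H) : ‖evalMap α b x‖ ≤ ‖b‖ * ‖evalMap α 1 x‖ := by
  have hbc : ∀ a ∈ 𝒞.left, Commute a b := fun a ha => 𝒞.commute a ha b hb
  set D : H →L[ℂ] H := algebraMap ℝ (H →L[ℂ] H) (‖b‖ ^ 2) - star b * b with hD
  have hD0 : 0 ≤ D := by
    have h1 := IsSelfAdjoint.le_algebraMap_norm_self (IsSelfAdjoint.star_mul_self b)
    rw [CStarRing.norm_star_mul_self, ← sq] at h1
    exact sub_nonneg.mpr h1
  have hDc : ∀ a ∈ 𝒞.left, Commute a D := by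
    intro a ha
    refine Commute.sub_right (Algebra.commute_algebraMap_right _ _) ?_
    have h1 : Commute a (star b) := by
      have h2 := (hbc _ (star_mem ha)).star_star
      rwa [star_star] at h2
    exact h1.mul_right (hbc a ha)
  set d := CFC.sqrt D with hd
  have hdd : star d * d = D := by
    rw [(CFC.sqrt_nonneg D).isSelfAdjoint.star_eq]
    exact CFC.sqrt_mul_sqrt_self D hD0
  have hdc : ∀ a ∈ 𝒞.left, Commute a d := fun a ha => by
    rw [hd, CFC.sqrt]
    exact ((hDc a ha).symm.cfcₙ_nnreal _).symm
  have e3 : evalMap α D x = (‖b‖ ^ 2 : ℝ) • evalMap α 1 x - evalMap α (star b * b) x := by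
    clear_value d D
    rw [hD]
    clear hD hD0 hDc hd hdd hdc
    induction x using TensorProduct.induction_on with
    | zero => simp
    | add x y hx hy => simp only [map_add, hx, hy, smul_add]; abel
    | tmul ξ ζ => simp [Algebra.algebraMap_eq_smul_one]
  have e1 := hα.inner_evalMap (c := b) hbc x x
  have e2 := hα.inner_evalMap (c := d) hdc x x
  rw [hdd, e3, inner_sub_right, ← e1, inner_smul_right_eq_smul] at e2
  have e4 := congrArg Complex.re e2
  rw [Complex.sub_re, Complex.smul_re, smul_eq_mul] at e4
  have e5 : 0 ≤ (inner ℂ (evalMap α d x) (evalMap α d x)).re := inner_self_nonneg (𝕜 := ℂ)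
  have e6 : (inner ℂ (evalMap α b x) (evalMap α b x)).re = ‖evalMap α b x‖ ^ 2 :=
    inner_self_eq_norm_sq (𝕜 := ℂ) _
  have e7 : (inner ℂ (evalMap α 1 x) (evalMap α 1 x)).re = ‖evalMap α 1 x‖ ^ 2 :=
    inner_self_eq_norm_sq (𝕜 := ℂ) _
  rw [e4, e6, e7] at e5
  have e8 : ‖evalMap α b x‖ ^ 2 ≤ (‖b‖ * ‖evalMap α 1 x‖) ^ 2 := by rw [mul_pow]; linarith
  exact abs_le_of_sq_le_sq' e8 (by positivity) |>.2

lemma exists_extension {A : Type*} [AddCommGroup A] [Module ℂ A] (f e : A →ₗ[ℂ] K)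
    (he : DenseRange e) (C : ℝ) (h : ∀ x, ‖f x‖ ≤ C * ‖e x‖) :
    ∃ T : K →L[ℂ] K, ∀ x, T (e x) = f x :=
  ⟨f.extendOfNorm e, LinearMap.extendOfNorm_eq he ⟨C, h⟩⟩

lemma exists_rep (hα : 𝒞.IsFactorization α) (b : 𝒞.right) :
    ∃ T : K →L[ℂ] K, ∀ ξ ∈ α, ∀ ζ, T (ξ ζ) = ξ (b.1 ζ) := by
  have hdense : DenseRange (evalMap α 1) := by
    have h1 : clspan {x : K | ∃ ξ ∈ α, ∃ ζ, x = ξ ζ} ≤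
        (LinearMap.range (evalMap α 1)).topologicalClosure := by
      refine Submodule.topologicalClosure_mono (Submodule.span_le.mpr ?_)
      rintro _ ⟨ξ, hξ, ζ, rfl⟩
      exact ⟨(⟨ξ, hξ⟩ : α) ⊗ₜ ζ, evalMap_tmul 1 ⟨ξ, hξ⟩ ζ⟩
    intro x
    have h2 := h1 (hα.nondegenerate ▸ Submodule.mem_top (x := x))
    rwa [← SetLike.mem_coe, Submodule.topologicalClosure_coe, LinearMap.coe_range] at h2
  have hn : ∀ x, ‖evalMap α b.1 x‖ ≤ ‖b.1‖ * ‖evalMap α 1 x‖ := hα.norm_evalMap_le b.2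
  have hf : ∀ (ξ : α) (ζ : H), evalMap α b.1 (ξ ⊗ₜ ζ) = ξ.1 (b.1 ζ) := fun ξ ζ => rfl
  have he : ∀ (ξ : α) (ζ : H), evalMap α 1 (ξ ⊗ₜ ζ) = ξ.1 ζ := fun ξ ζ => rfl
  generalize evalMap α b.1 = f at hn hf
  generalize evalMap α 1 = e at hn he hdense
  obtain ⟨T, hT⟩ := exists_extension (A := α ⊗[ℂ] H) f e hdense ‖b.1‖ hn
  refine ⟨T, fun ξ hξ ζ => ?_⟩
  have h := hT ((⟨ξ, hξ⟩ : α) ⊗ₜ ζ)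
  rw [he, hf] at h
  exact h

/-- The operator `ρ_α(b)`, determined by `ρ_α(b) ξ ζ = ξ b ζ` for `ξ ∈ α`, `ζ ∈ H`. -/
def repFun (hα : 𝒞.IsFactorization α) (b : 𝒞.right) : K →L[ℂ] K := (hα.exists_rep b).choose

lemma repFun_apply (hα : 𝒞.IsFactorization α) (b : 𝒞.right) {ξ : H →L[ℂ] K} (hξ : ξ ∈ α)
    (ζ : H) : hα.repFun b (ξ ζ) = ξ (b.1 ζ) :=
  (hα.exists_rep b).choose_spec ξ hξ ζ

/-- The representation `ρ_α` of `𝔅†` on `K` associated to a `C*`-factorization `α`; it is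
determined by `ρ_α(b) ξ ζ = ξ b ζ` for `b ∈ 𝔅†`, `ξ ∈ α`, `ζ ∈ H`. -/
def rep (hα : 𝒞.IsFactorization α) : 𝒞.right →⋆ₙₐ[ℂ] (K →L[ℂ] K) where
  toFun := hα.repFun
  map_smul' z b := hα.ext_comp fun ξ hξ ζ => by simp [hα.repFun_apply _ hξ]
  map_zero' := hα.ext_comp fun ξ hξ ζ => by simp [hα.repFun_apply _ hξ]
  map_add' b c := hα.ext_comp fun ξ hξ ζ => by simp [hα.repFun_apply _ hξ]
  map_mul' b c := hα.ext_comp fun ξ hξ ζ => by simp [hα.repFun_apply _ hξ]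
  map_star' b := by
    rw [ContinuousLinearMap.star_eq_adjoint, ContinuousLinearMap.eq_adjoint_iff]
    have key : ∀ ξ ∈ α, ∀ ζ, ∀ η ∈ α, ∀ ω,
        inner ℂ (hα.repFun (star b) (ξ ζ)) (η ω) = inner ℂ (ξ ζ) (hα.repFun b (η ω)) := by
      intro ξ hξ ζ η hη ω
      rw [hα.repFun_apply _ hξ, hα.repFun_apply _ hη]
      have h := hα.inner_evalMap (b := star b.1) (c := 1)
        (fun a ha => 𝒞.commute a ha _ (star_mem b.2)) ((⟨ξ, hξ⟩ : α) ⊗ₜ ζ) ((⟨η, hη⟩ : α) ⊗ₜ ω)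
      simpa using h
    have hd : ∀ (S T : K →L[ℂ] K), (∀ ξ ∈ α, ∀ ζ, ∀ η ∈ α, ∀ ω,
        inner ℂ (S (ξ ζ)) (η ω) = inner ℂ (ξ ζ) (T (η ω))) → S = adjoint T := by
      intro S T hST
      refine hα.ext_comp fun ξ hξ ζ => ?_
      refine ext_inner_right ℂ fun y => ?_
      rw [ContinuousLinearMap.adjoint_inner_left]
      have h2 : (innerSL ℂ (S (ξ ζ))) = (innerSL ℂ (ξ ζ)) ∘L T := by
        have hle : clspan {x : K | ∃ ξ ∈ α, ∃ ζ, x = ξ ζ} ≤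
            ((innerSL ℂ (S (ξ ζ))) - (innerSL ℂ (ξ ζ)) ∘L T).ker := by
          refine Submodule.topologicalClosure_minimal _ (Submodule.span_le.mpr ?_)
            (ContinuousLinearMap.isClosed_ker _)
          rintro _ ⟨η, hη, ω, rfl⟩
          simp [hST ξ hξ ζ η hη ω]
        rw [hα.nondegenerate] at hle
        ext x
        exact sub_eq_zero.mp (hle (Submodule.mem_top (x := x)))
      exact congrArg (fun T => T y) h2
    intro x y
    rw [hd _ _ key, ContinuousLinearMap.adjoint_inner_left]

theorem rep_apply (hα : 𝒞.IsFactorization α) (b : 𝒞.right) {ξ : H →L[ℂ] K} (hξ : ξ ∈ α) (ζ : H) :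
    hα.rep b (ξ ζ) = ξ (b.1 ζ) :=
  hα.repFun_apply b hξ ζ

/-- Compatibility of `C*`-factorizations `α`, `β` of the same Hilbert space, with respect to
`C*`-bases `(H, 𝔅, 𝔅†)` and `(H', ℭ, ℭ†)`: `[ρ_α(𝔅†) β] = β` and `[ρ_β(ℭ†) α] = α`. -/
def Compatible {𝒟 : CStarBase H'} {β : Submodule ℂ (H' →L[ℂ] K)} (hα : 𝒞.IsFactorization α)
    (hβ : 𝒟.IsFactorization β) : Prop :=
  clspan {x : H' →L[ℂ] K | ∃ b, ∃ η ∈ β, x = hα.rep b ∘L η} = β ∧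
    clspan {x : H →L[ℂ] K | ∃ c, ∃ ξ ∈ α, x = hβ.rep c ∘L ξ} = α

end IsFactorization

end CStarBase

end Bases

end HomMod

end

open HomMod

/-!
For homogeneous elements everything reduces to identities in `B`. The operators satisfy
`F(|ξ⟩)* F(|η⟩) = F(l_⟨ξ|η⟩)`, and for a `θ`-homogeneous `ξ` the adjoint of `F(|ξ])` is
`F(|ξ]*)`, where `|ξ]* η = θ ⟨ξ|η⟩`. For `b ∈ B_θ` the elements `b* b` and `b b*` are central and
equal, which gives `θ b = b` and `θ (x b) = b x`; hence products of homogeneous elements are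
homogeneous for the composed partial automorphisms, and the operators multiply accordingly.

The delicate identity is `[β* β] = 𝔅†` for `β = F_*(|E])`. The coefficients `θ ⟨ξ|η⟩` with
`ξ, η ∈ E_θ` and `θ ∈ Θ` are central and span a `*`-algebra. As `E` is decomposable, an approximate
unit `e` of its closure satisfies `e ξ → ξ` on `E`, and then `e c → c` for every homogeneous
`c ∈ B`, because `[|E]* |E]] = |B]` puts `c` in the closed span of elements `θ ⟨ξ|η⟩`. So `c` is
approximated by linear combinations of elements `θ ⟨ξ|η⟩ c` with `ξ, η ∈ E_θ`, and
`F(|θ ⟨ξ|η⟩ c]) = F(|ξ])* F(|c η])` lies in `β* β`.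
-/

noncomputable section

open Filter Topology
open HomMod.LeftAction (lact)

universe u

namespace HomMod

/-! ### Closed spans and approximate units -/

section ClosedSpan

variable {V W X : Type*} [SeminormedAddCommGroup V] [NormedSpace ℂ V]
  [SeminormedAddCommGroup W] [NormedSpace ℂ W] [SeminormedAddCommGroup X] [NormedSpace ℂ X]

lemma subset_clspan (S : Set V) : S ⊆ clspan S :=
  Submodule.subset_span.trans (Submodule.le_topologicalClosure _)

lemma isClosed_clspan (S : Set V) : IsClosed (clspan S : Set V) :=
  Submodule.isClosed_topologicalClosure _

lemma clspan_le {S : Set V} {M : Submodule ℂ V} (hM : IsClosed (M : Set V)) (h : S ⊆ M) :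
    clspan S ≤ M :=
  Submodule.topologicalClosure_minimal _ (Submodule.span_le.mpr h) hM

lemma clspan_mono {S T : Set V} (h : S ⊆ T) : clspan S ≤ clspan T :=
  clspan_le (isClosed_clspan T) (h.trans (subset_clspan T))

lemma map_mem_of_mem_clspan {σ : ℂ →+* ℂ} (f : V →SL[σ] W) {S : Set V} {M : Submodule ℂ W}
    (hM : IsClosed (M : Set W)) (h : ∀ x ∈ S, f x ∈ M) {x : V} (hx : x ∈ clspan S) : f x ∈ M :=
  clspan_le (M := M.comap f.toLinearMap) (hM.preimage f.continuous) h hx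

lemma map₂_mem_of_mem_clspan {σ : ℂ →+* ℂ} [RingHomIsometric σ] (f : V →SL[σ] W →L[ℂ] X)
    {S : Set V} {T : Set W} {M : Submodule ℂ X} (hM : IsClosed (M : Set X))
    (h : ∀ x ∈ S, ∀ y ∈ T, f x y ∈ M) {x : V} {y : W} (hx : x ∈ clspan S) (hy : y ∈ clspan T) :
    f x y ∈ M :=
  map_mem_of_mem_clspan (f.flip y) hM
    (fun x hx => map_mem_of_mem_clspan (f x) hM (h x hx) hy) hx

lemma map_mem_of_coe_mem_clspan {P : Submodule ℂ V} (hP : IsClosed (P : Set V)) (f : P →L[ℂ] W)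
    {S : Set V} (hSP : S ⊆ P) {M : Submodule ℂ W} (hM : IsClosed (M : Set W))
    (h : ∀ x : P, (x : V) ∈ S → f x ∈ M) {x : P} (hx : (x : V) ∈ clspan S) : f x ∈ M := by
  let N : Submodule ℂ V := (M.comap f.toLinearMap).map P.subtype
  have hN : IsClosed (N : Set V) :=
    hP.isClosedEmbedding_subtypeVal.isClosedMap _ (hM.preimage f.continuous)
  have hSN : S ⊆ N := fun x hx => ⟨⟨x, hSP hx⟩, h _ hx, rfl⟩
  obtain ⟨y, hy, hyx⟩ := clspan_le hN hSN hx
  rwa [← Subtype.ext hyx]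

lemma tendsto_of_mem_clspan {ι : Type*} {l : Filter ι} {T : ι → V →L[ℂ] V} {C : ℝ}
    (hC : ∀ i, ‖T i‖ ≤ C) {S : Set V} (h : ∀ x ∈ S, Tendsto (fun i => T i x) l (𝓝 x)) {x : V}
    (hx : x ∈ clspan S) : Tendsto (fun i => T i x) l (𝓝 x) := by
  let N : Submodule ℂ V :=
    { carrier := {x | Tendsto (fun i => T i x) l (𝓝 x)}
      add_mem' := fun {a b} ha hb => by
        simpa only [Set.mem_ofPred_eq, map_add] using Tendsto.add ha hb
      zero_mem' := by
        simpa only [Set.mem_ofPred_eq, map_zero] using tendsto_const_nhds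
      smul_mem' := fun c x hx => by
        simpa only [Set.mem_ofPred_eq, map_smul] using Tendsto.const_smul hx c }
  have hT : Equicontinuous ((↑) ∘ T) :=
    ((NormedSpace.equicontinuous_TFAE T).out 5 1).mp (show ∃ C, ∀ i, ‖T i‖ ≤ C from ⟨C, hC⟩)
  exact clspan_le (M := N) (hT.isClosed_setOfPred_tendsto continuous_id) h hx

/-- The closed linear span of a set that is stable under products and adjoints, as a
`*`-subalgebra. -/
def clspanAlg {A : Type*} [NonUnitalCStarAlgebra A] (S : Set A)
    (hmul : ∀ x ∈ S, ∀ y ∈ S, x * y ∈ S) (hstar : ∀ x ∈ S, star x ∈ S) :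
    NonUnitalStarSubalgebra ℂ A where
  __ := clspan S
  mul_mem' := map₂_mem_of_mem_clspan (ContinuousLinearMap.mul ℂ A) (isClosed_clspan S)
    fun x hx y hy => subset_clspan S (hmul x hx y hy)
  star_mem' := map_mem_of_mem_clspan (starL ℂ (A := A) : A →L⋆[ℂ] A) (isClosed_clspan S)
    fun x hx => subset_clspan S (hstar x hx)

end ClosedSpan

section ApproximateUnits

variable {B : Type*} [NonUnitalCStarAlgebra B]

/-- A contractive self-adjoint approximate unit, indexed by a filter, of a subset `S` of a
`C*`-algebra. -/
structure IsApproxUnit (S : Set B) {ι : Type*} (l : Filter ι) (e : ι → B) : Prop where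
  neBot : l.NeBot
  mem : ∀ i, e i ∈ S
  norm_le : ∀ i, ‖e i‖ ≤ 1
  star_eq : ∀ i, star (e i) = e i
  mul_right : ∀ x ∈ S, Tendsto (fun i => x * e i) l (𝓝 x)
  mul_left : ∀ x ∈ S, Tendsto (fun i => e i * x) l (𝓝 x)

lemma exists_isApproxUnit {B : Type u} [NonUnitalCStarAlgebra B]
    (S : NonUnitalStarSubalgebra ℂ B) (hS : IsClosed (S : Set B)) :
    ∃ (ι : Type u) (l : Filter ι) (e : ι → B), IsApproxUnit (S : Set B) l e := by
  have : IsClosed (S : Set B) := hS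
  let : PartialOrder S := CStarAlgebra.spectralOrder S
  have : StarOrderedRing S := CStarAlgebra.spectralOrderedRing S
  have h := CStarAlgebra.increasingApproximateUnit S
  refine ⟨{x : S // ‖x‖ ≤ 1 ∧ IsSelfAdjoint x},
    (CStarAlgebra.approximateUnit (A := S)).comap Subtype.val, fun x => (x.1 : B), ?_,
    fun i => i.1.2, fun i => i.2.1, fun i => congrArg Subtype.val i.2.2.star_eq,
    fun x hx => ?_, fun x hx => ?_⟩
  · refine comap_neBot_iff_frequently.mpr (Eventually.frequently ?_)
    filter_upwards [h.eventually_norm, h.eventually_isSelfAdjoint] with x hnorm hsa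
    exact ⟨⟨x, hnorm, hsa⟩, rfl⟩
  · exact (continuous_subtype_val.tendsto _).comp
      ((h.tendsto_mul_left ⟨x, hx⟩).comp tendsto_comap)
  · exact (continuous_subtype_val.tendsto _).comp
      ((h.tendsto_mul_right ⟨x, hx⟩).comp tendsto_comap)

lemma exists_isApproxUnit_univ (B : Type u) [NonUnitalCStarAlgebra B] :
    ∃ (ι : Type u) (l : Filter ι) (e : ι → B), IsApproxUnit (Set.univ : Set B) l e := by
  simpa using exists_isApproxUnit (⊤ : NonUnitalStarSubalgebra ℂ B) (by simp)

namespace IsApproxUnit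

variable {S : Set B} {ι : Type*} {l : Filter ι} {e : ι → B}

lemma mem_of_tendsto (h : IsApproxUnit S l e) {X : Type*} [TopologicalSpace X] {C : Set X}
    (hC : IsClosed C) {f : ι → X} {x : X} (hf : Tendsto f l (𝓝 x)) (hm : ∀ i, f i ∈ C) : x ∈ C :=
  have := h.neBot
  hC.mem_of_tendsto hf (Eventually.of_forall hm)

lemma tendsto_mul_sub_sub (h : IsApproxUnit S l e) {p : B} (hp : p ∈ S) :
    Tendsto (fun i => e i * (p * e i - p) - (p * e i - p)) l (𝓝 0) := by
  have hsub : Tendsto (fun i => p * e i - p) l (𝓝 0) :=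
    tendsto_sub_nhds_zero_iff.mpr (h.mul_right p hp)
  simpa using (isBoundedUnder_le_mul_tendsto_zero
    (isBoundedUnder_of ⟨1, h.norm_le⟩) hsub).sub hsub

end IsApproxUnit

end ApproximateUnits

/-! ### Partial automorphisms and modules -/

section PartialAutomorphisms

variable {B : Type*} [NonUnitalCStarAlgebra B]

/-- A closed ideal as a complex subspace. -/
def IsClosedIdeal.toSubmodule {I : Set B} (h : IsClosedIdeal I) : Submodule ℂ B where
  carrier := I
  add_mem' := h.add_mem
  zero_mem' := h.zero_mem
  smul_mem' := fun c _ => h.smul_mem c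

namespace PAut

/-- The value `θ b` of a partial automorphism, set to `0` outside the domain of `θ`. -/
def app (θ : PAut B) (b : B) : B := (θ.map b).getD 0

lemma isClosedIdeal_dom (θ : PAut B) : IsClosedIdeal θ.dom := θ.dom_ideal

lemma isClosedIdeal_img (θ : PAut B) : IsClosedIdeal θ.img := θ.img_ideal

variable {θ θ' τ : PAut B} {a b c : B}

lemma app_mem_map (hb : b ∈ θ.dom) : θ.app b ∈ θ.map b := by
  obtain ⟨c, hc⟩ := hb
  rw [Option.mem_def] at hc
  rw [app, hc]
  rfl

lemma app_eq (h : c ∈ θ.map b) : θ.app b = c :=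
  Option.mem_unique (app_mem_map ⟨c, h⟩) h

lemma mem_map_iff : c ∈ θ.map b ↔ b ∈ θ.dom ∧ θ.app b = c :=
  ⟨fun h => ⟨⟨c, h⟩, app_eq h⟩, fun h => h.2 ▸ app_mem_map h.1⟩

lemma app_mem_img (hb : b ∈ θ.dom) : θ.app b ∈ θ.img := ⟨b, app_mem_map hb⟩

@[simp] lemma symm_symm (θ : PAut B) : θ.symm.symm = θ := rfl

@[simp] lemma dom_symm (θ : PAut B) : θ.symm.dom = θ.img :=
  Set.ext fun _ => exists_congr fun _ => PEquiv.mem_iff_mem _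

@[simp] lemma img_symm (θ : PAut B) : θ.symm.img = θ.dom := (dom_symm θ.symm).symm

lemma symm_app_app (hb : b ∈ θ.dom) : θ.symm.app (θ.app b) = b :=
  app_eq ((PEquiv.mem_iff_mem _).mpr (app_mem_map hb))

lemma app_symm_app (hc : c ∈ θ.img) : θ.app (θ.symm.app c) = c :=
  symm_app_app (θ := θ.symm) (by rwa [dom_symm])

lemma symm_app_mem_dom (hc : c ∈ θ.img) : θ.symm.app c ∈ θ.dom := by
  simpa using app_mem_img (θ := θ.symm) (by rwa [dom_symm])

@[simp] lemma id_symm : (PAut.id B).symm = PAut.id B := rfl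

lemma mem_id_map : c ∈ (PAut.id B).map b ↔ b = c :=
  Option.some_inj

@[simp] lemma dom_id : (PAut.id B).dom = Set.univ :=
  Set.eq_univ_of_forall fun b => ⟨b, mem_id_map.mpr rfl⟩

@[simp] lemma img_id : (PAut.id B).img = Set.univ :=
  Set.eq_univ_of_forall fun b => ⟨b, mem_id_map.mpr rfl⟩

@[simp] lemma id_app (b : B) : (PAut.id B).app b = b :=
  app_eq (mem_id_map.mpr rfl)

lemma star_mem_dom (hb : b ∈ θ.dom) : star b ∈ θ.dom :=
  ⟨_, θ.map_star (app_mem_map hb)⟩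

lemma app_add (ha : a ∈ θ.dom) (hb : b ∈ θ.dom) : θ.app (a + b) = θ.app a + θ.app b :=
  app_eq (θ.map_add (app_mem_map ha) (app_mem_map hb))

lemma app_smul (z : ℂ) (ha : a ∈ θ.dom) : θ.app (z • a) = z • θ.app a :=
  app_eq (θ.map_smul z (app_mem_map ha))

lemma app_mul (ha : a ∈ θ.dom) (hb : b ∈ θ.dom) : θ.app (a * b) = θ.app a * θ.app b :=
  app_eq (θ.map_mul (app_mem_map ha) (app_mem_map hb))

lemma app_star (ha : a ∈ θ.dom) : θ.app (star a) = star (θ.app a) :=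
  app_eq (θ.map_star (app_mem_map ha))

/-- The domain of a partial automorphism as a `*`-subalgebra. -/
def domAlg (θ : PAut B) : NonUnitalStarSubalgebra ℂ B where
  __ := θ.isClosedIdeal_dom.toSubmodule
  mul_mem' := fun {a _} _ => θ.isClosedIdeal_dom.mul_mem_left a
  star_mem' := star_mem_dom

/-- A partial automorphism as a `*`-homomorphism on its domain. -/
def domHom (θ : PAut B) : θ.domAlg →⋆ₙₐ[ℂ] B where
  toFun x := θ.app x
  map_smul' z x := app_smul z x.2
  map_zero' := by simpa using app_smul (θ := θ) 0 θ.isClosedIdeal_dom.zero_mem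
  map_add' x y := app_add x.2 y.2
  map_mul' x y := app_mul x.2 y.2
  map_star' x := app_star x.2

lemma app_sub (ha : a ∈ θ.dom) (hb : b ∈ θ.dom) : θ.app (a - b) = θ.app a - θ.app b :=
  map_sub θ.domHom ⟨a, ha⟩ ⟨b, hb⟩

lemma norm_app_le (hb : b ∈ θ.dom) : ‖θ.app b‖ ≤ ‖b‖ :=
  have : IsClosed (θ.domAlg : Set B) := θ.isClosedIdeal_dom.isClosed
  NonUnitalStarAlgHom.norm_apply_le θ.domHom ⟨b, hb⟩

lemma norm_app (hb : b ∈ θ.dom) : ‖θ.app b‖ = ‖b‖ := by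
  refine le_antisymm (norm_app_le hb) ?_
  simpa only [symm_app_app hb] using
    norm_app_le (θ := θ.symm) (b := θ.app b) (by simpa using app_mem_img hb)

lemma eq_of_forall_mul_eq (ha : a ∈ θ.dom) (hb : b ∈ θ.dom)
    (h : ∀ d ∈ θ.dom, d * a = d * b) : a = b := by
  refine sub_eq_zero.mp ((CStarRing.star_mul_self_eq_zero_iff _).mp ?_)
  have hab : a - b ∈ θ.dom := θ.isClosedIdeal_dom.toSubmodule.sub_mem ha hb
  rw [mul_sub, h _ (star_mem_dom hab), sub_self]

lemma mul_comm_of_mem_dom (ha : a ∈ θ.dom) (h : ∀ d ∈ θ.dom, a * d = d * a) (b : B) :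
    a * b = b * a :=
  eq_of_forall_mul_eq (θ.isClosedIdeal_dom.mul_mem_right b ha)
    (θ.isClosedIdeal_dom.mul_mem_left b ha) fun d hd => by
      rw [← mul_assoc, ← h d hd, mul_assoc, h _ (θ.isClosedIdeal_dom.mul_mem_right b hd), mul_assoc]

lemma IsComp.mem_map_iff (h : IsComp θ θ' τ) : c ∈ τ.map b ↔ ∃ a ∈ θ'.map b, c ∈ θ.map a := by
  rw [h, PEquiv.mem_trans]

lemma IsComp.mem_dom_iff (h : IsComp θ θ' τ) :
    b ∈ τ.dom ↔ b ∈ θ'.dom ∧ θ'.app b ∈ θ.dom := by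
  constructor
  · rintro ⟨c, hc⟩
    obtain ⟨a, ha, hac⟩ := h.mem_map_iff.mp hc
    exact ⟨⟨a, ha⟩, app_eq ha ▸ ⟨c, hac⟩⟩
  · rintro ⟨hb, c, hc⟩
    exact ⟨c, h.mem_map_iff.mpr ⟨_, app_mem_map hb, hc⟩⟩

lemma IsComp.app_eq (h : IsComp θ θ' τ) (hb : b ∈ τ.dom) : τ.app b = θ.app (θ'.app b) := by
  obtain ⟨hb', hbθ⟩ := h.mem_dom_iff.mp hb
  exact PAut.app_eq (h.mem_map_iff.mpr ⟨_, app_mem_map hb', app_mem_map hbθ⟩)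

end PAut

lemma PAut.exists_isApproxUnit_dom {B : Type u} [NonUnitalCStarAlgebra B] (θ : PAut B) :
    ∃ (ι : Type u) (l : Filter ι) (e : ι → B), IsApproxUnit θ.dom l e :=
  exists_isApproxUnit θ.domAlg θ.isClosedIdeal_dom.isClosed

end PartialAutomorphisms

section Modules

variable {B : Type*} [NonUnitalCStarAlgebra B]

variable [PartialOrder B]
variable {E : Type*} [NormedAddCommGroup E] [NormedSpace ℂ E] [SMul Bᵐᵒᵖ E] [CStarModule Bᵐᵒᵖ E]
variable {ι : Type*} {l : Filter ι} {e : ι → B} {S : Set B}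

lemma ip_sub_left (ξ ξ' η : E) : ip B (ξ - ξ') η = ip B ξ η - ip B ξ' η := by
  simp [ip]

lemma ip_lact_right [LeftAction B E] (b : B) (ξ η : E) :
    ip B ξ (lact b η) = ip B (lact (star b) ξ) η := by
  rw [LeftAction.ip_lact, star_star]

variable [StarOrderedRing B]

@[simp] lemma lact_self (b c : B) : lact b c = b * c := rfl

lemma rsmul_mul (ξ : E) (a b : B) : ξ <• (a * b) = (ξ <• a) <• b :=
  ext_ip (B := B) fun ζ => by simp only [ip_rsmul_right, mul_assoc]

variable (B) in
/-- The bounded operator `⟨ξ| : E → B`, `η ↦ ⟨ξ | η⟩`, which is the adjoint of `|ξ⟩`. -/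
def bra (ξ : E) : E →L[ℂ] B :=
  (opContinuousLinearEquiv ℂ).symm.toContinuousLinearMap ∘L CStarModule.innerSL ξ

@[simp] lemma bra_apply (ξ η : E) : bra B ξ η = ip B ξ η := rfl

lemma ip_sub_right (ξ η η' : E) : ip B ξ (η - η') = ip B ξ η - ip B ξ η' :=
  map_sub (bra B ξ) η η'

lemma tendsto_of_tendsto_ip_self {f : ι → E} {ξ : E}
    (h : Tendsto (fun i => ip B (f i - ξ) (f i - ξ)) l (𝓝 0)) : Tendsto f l (𝓝 ξ) := by
  rw [tendsto_iff_norm_sub_tendsto_zero]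
  simpa [← norm_sq_eq_ip] using h.norm.sqrt

namespace IsApproxUnit

lemma tendsto_rsmul (he : IsApproxUnit S l e) {ξ : E}
    (hξ : ξ ∈ clspan {x : E | ∃ (η : E), ∃ d ∈ S, x = η <• d}) :
    Tendsto (fun i => ξ <• e i) l (𝓝 ξ) := by
  refine tendsto_of_mem_clspan (T := fun i => (rmul B E).flip (e i)) (C := 1) (fun i => ?_) ?_ hξ
  · refine opNorm_le_bound _ zero_le_one fun x => ?_
    rw [one_mul]
    exact (norm_rsmul_le _ _).trans (mul_le_of_le_one_right (norm_nonneg _) (he.norm_le i))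
  · rintro _ ⟨η, d, hd, rfl⟩
    exact (((rmul B E η).continuous.tendsto d).comp (he.mul_right d hd)).congr
      fun i => rsmul_mul η d (e i)

lemma tendsto_rsmul_of_ip_self_mem (he : IsApproxUnit S l e) {ξ : E} (hξ : ip B ξ ξ ∈ S) :
    Tendsto (fun i => ξ <• e i) l (𝓝 ξ) := by
  refine tendsto_of_tendsto_ip_self (B := B) ((he.tendsto_mul_sub_sub hξ).congr fun i => ?_)
  simp only [ip_sub_left, ip_sub_right, ip_rsmul_left, ip_rsmul_right, he.star_eq, mul_sub,
    sub_mul, mul_assoc]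
  abel

lemma mem_clspan_rsmul (he : IsApproxUnit S l e) {ξ : E} (hξ : ip B ξ ξ ∈ S) :
    ξ ∈ clspan {x : E | ∃ (η : E), ∃ d ∈ S, x = η <• d} :=
  he.mem_of_tendsto (isClosed_clspan _) (he.tendsto_rsmul_of_ip_self_mem hξ)
    fun i => subset_clspan _ ⟨ξ, e i, he.mem i, rfl⟩

end IsApproxUnit

variable [LeftAction B E]

lemma lact_rsmul (b c : B) (ξ : E) : lact b (ξ <• c) = lact b ξ <• c :=
  ext_ip (B := B) fun ζ => by rw [ip_lact_right, ip_rsmul_right, ip_rsmul_right, ip_lact_right]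

end Modules

/-! ### Homogeneous elements -/

section HomogeneousElements

variable {B : Type*} [NonUnitalCStarAlgebra B] [PartialOrder B]
variable {E : Type*} [NormedAddCommGroup E] [NormedSpace ℂ E] [SMul Bᵐᵒᵖ E] [CStarModule Bᵐᵒᵖ E]
  [LeftAction B E]
variable {θ : PAut B} {ξ η : E}

lemma homog.rsmul_eq (hξ : ξ ∈ homog E θ) {b : B} (hb : b ∈ θ.dom) :
    ξ <• b = lact (θ.app b) ξ :=
  hξ.2 b _ (PAut.app_mem_map hb)

variable [StarOrderedRing B]

variable (E θ) in
/-- The `θ`-homogeneous elements of `E` as a complex subspace. -/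
def homogSub : Submodule ℂ E where
  carrier := homog E θ
  add_mem' := fun {ξ η} hξ hη => ⟨add_mem hξ.1 hη.1, fun b c hc => by
    rw [map_add, ← hξ.2 b c hc, ← hη.2 b c hc]
    exact map_add ((rmul B E).flip b) ξ η⟩
  zero_mem' := ⟨zero_mem _, fun b c _ => by
    rw [map_zero]
    exact map_zero ((rmul B E).flip b)⟩
  smul_mem' := fun z ξ hξ => ⟨Submodule.smul_mem _ z hξ.1, fun b c hc => by
    rw [map_smul, ← hξ.2 b c hc]
    exact map_smul ((rmul B E).flip b) z ξ⟩

namespace homog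

lemma tendsto_lact_app (hξ : ξ ∈ homog E θ) {ι : Type*} {l : Filter ι} {e : ι → B}
    (he : IsApproxUnit θ.dom l e) : Tendsto (fun i => lact (θ.app (e i)) ξ) l (𝓝 ξ) :=
  (he.tendsto_rsmul hξ.1).congr fun i => rsmul_eq hξ (he.mem i)

lemma ip_right_mem_dom (hξ : ξ ∈ homog E θ) (η : E) : ip B η ξ ∈ θ.dom :=
  map_mem_of_mem_clspan (bra B η) (M := θ.isClosedIdeal_dom.toSubmodule)
    θ.isClosedIdeal_dom.isClosed
    (by
      rintro _ ⟨ζ, d, hd, rfl⟩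
      rw [bra_apply, ip_rsmul_right]
      exact θ.isClosedIdeal_dom.mul_mem_left _ hd) hξ.1

lemma ip_left_mem_dom (hξ : ξ ∈ homog E θ) (η : E) : ip B ξ η ∈ θ.dom := by
  rw [← star_ip]
  exact PAut.star_mem_dom (ip_right_mem_dom hξ η)

lemma ip_lact_left_mem_dom (hξ : ξ ∈ homog E θ) (b : B) (η : E) : ip B (lact b ξ) η ∈ θ.dom := by
  rw [LeftAction.ip_lact]
  exact ip_left_mem_dom hξ _

end homog

lemma mem_homog_iff :
    ξ ∈ homog E θ ↔ ip B ξ ξ ∈ θ.dom ∧ ∀ d ∈ θ.dom, ξ <• d = lact (θ.app d) ξ := by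
  refine ⟨fun hξ => ⟨homog.ip_right_mem_dom hξ ξ, fun d => homog.rsmul_eq hξ⟩, fun ⟨h, heq⟩ => ?_⟩
  obtain ⟨_, _, _, he⟩ := θ.exists_isApproxUnit_dom
  refine ⟨he.mem_clspan_rsmul h, fun b c hc => ?_⟩
  obtain ⟨hb, rfl⟩ := PAut.mem_map_iff.mp hc
  exact heq b hb

namespace homog

lemma mem_clspan_img (hξ : ξ ∈ homog E θ) :
    ξ ∈ clspan {x : E | ∃ c ∈ θ.img, ∃ η : E, x = lact c η} := by
  obtain ⟨_, _, _, he⟩ := θ.exists_isApproxUnit_dom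
  exact he.mem_of_tendsto (isClosed_clspan _) (tendsto_lact_app hξ he)
    fun i => subset_clspan _ ⟨_, PAut.app_mem_img (he.mem i), ξ, rfl⟩

lemma ip_mul_comm (hξ : ξ ∈ homog E θ) (hη : η ∈ homog E θ) (b : B) :
    ip B ξ η * b = b * ip B ξ η := by
  refine PAut.mul_comm_of_mem_dom (ip_right_mem_dom hη ξ) (fun d hd => ?_) b
  rw [← ip_rsmul_right, rsmul_eq hη hd, ip_lact_right, ← PAut.app_star hd,
    ← rsmul_eq hξ (PAut.star_mem_dom hd), ip_rsmul_left, star_star]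

lemma app_ip_mul_comm (hξ : ξ ∈ homog E θ) (hη : η ∈ homog E θ) (b : B) :
    θ.app (ip B ξ η) * b = b * θ.app (ip B ξ η) := by
  have hdom := ip_right_mem_dom hη ξ
  refine PAut.mul_comm_of_mem_dom (θ := θ.symm) (by simpa using PAut.app_mem_img hdom)
    (fun c hc => ?_) b
  rw [PAut.dom_symm] at hc
  have hd := PAut.symm_app_mem_dom hc
  rw [← PAut.app_symm_app hc, ← PAut.app_mul hdom hd, ip_mul_comm hξ hη, PAut.app_mul hd hdom]

lemma app_ip_lact_left (hξ : ξ ∈ homog E θ) (η : E) (b : B) :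
    θ.app (ip B (lact b ξ) η) = star b * θ.app (ip B ξ η) := by
  have hdom := ip_lact_left_mem_dom hξ b η
  have himg := PAut.app_mem_img (ip_left_mem_dom hξ η)
  refine PAut.eq_of_forall_mul_eq (θ := θ.symm) (by simpa using PAut.app_mem_img hdom)
    (by simpa using θ.isClosedIdeal_img.mul_mem_left _ himg) fun c hc => ?_
  rw [PAut.dom_symm] at hc
  have hcb := θ.isClosedIdeal_img.mul_mem_right (star b) hc
  have hd := PAut.symm_app_mem_dom hc
  have hdb := PAut.symm_app_mem_dom hcb
  have key : θ.symm.app c * ip B (lact b ξ) η = θ.symm.app (c * star b) * ip B ξ η := by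
    rw [← star_star (θ.symm.app c), ← star_star (θ.symm.app (c * star b)), ← ip_rsmul_left,
      ← ip_rsmul_left, ← lact_rsmul, rsmul_eq hξ (PAut.star_mem_dom hd),
      rsmul_eq hξ (PAut.star_mem_dom hdb), PAut.app_star hd, PAut.app_star hdb,
      PAut.app_symm_app hc, PAut.app_symm_app hcb, star_mul, star_star, LeftAction.lact_mul]
  simpa only [PAut.app_mul hd hdom, PAut.app_mul hdb (ip_left_mem_dom hξ η),
    PAut.app_symm_app hc, PAut.app_symm_app hcb, mul_assoc] using congrArg θ.app key

lemma app_ip_lact_right (hξ : ξ ∈ homog E θ) (η : E) (b : B) :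
    θ.app (ip B η (lact b ξ)) = θ.app (ip B η ξ) * b := by
  rw [← star_ip, PAut.app_star (ip_lact_left_mem_dom hξ b η), app_ip_lact_left hξ, star_mul,
    star_star, ← PAut.app_star (ip_left_mem_dom hξ η), star_ip]

lemma lact_central (hξ : ξ ∈ homog E θ) {z : B} (hz : ∀ b, z * b = b * z) :
    lact z ξ ∈ homog E θ := by
  refine mem_homog_iff.mpr ⟨ip_lact_left_mem_dom hξ z _, fun d hd => ?_⟩
  rw [← lact_rsmul, rsmul_eq hξ hd, ← LeftAction.lact_mul, hz, LeftAction.lact_mul]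

end homog

lemma homog_id_of_central {z : B} (hz : ∀ b, z * b = b * z) : z ∈ homog B (PAut.id B) :=
  mem_homog_iff.mpr ⟨by simp, fun d _ => by simpa using hz d⟩

end HomogeneousElements

section HomogeneousSelf

variable {B : Type*} [NonUnitalCStarAlgebra B] [PartialOrder B] [StarOrderedRing B]
variable {θ : PAut B} {b : B}

namespace homog

lemma mul_eq (hb : b ∈ homog B θ) {d : B} (hd : d ∈ θ.dom) : b * d = θ.app d * b :=
  rsmul_eq hb hd

lemma star_mul_eq (hb : b ∈ homog B θ) {d : B} (hd : d ∈ θ.dom) :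
    star b * θ.app d = d * star b := by
  simpa [PAut.app_star hd] using (congrArg star (mul_eq hb (PAut.star_mem_dom hd))).symm

lemma mem_dom (hb : b ∈ homog B θ) : b ∈ θ.dom :=
  clspan_le (M := θ.isClosedIdeal_dom.toSubmodule) θ.isClosedIdeal_dom.isClosed
    (by rintro _ ⟨η, d, hd, rfl⟩; exact θ.isClosedIdeal_dom.mul_mem_left η hd) hb.1

lemma mem_img (hb : b ∈ homog B θ) : b ∈ θ.img :=
  clspan_le (M := θ.isClosedIdeal_img.toSubmodule) θ.isClosedIdeal_img.isClosed
    (by rintro _ ⟨c, hc, η, rfl⟩; exact θ.isClosedIdeal_img.mul_mem_right η hc)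
    (mem_clspan_img hb)

lemma star_mem (hb : b ∈ homog B θ) : star b ∈ homog B θ.symm := by
  refine mem_homog_iff.mpr ⟨?_, fun c hc => ?_⟩
  · rw [PAut.dom_symm]
    exact θ.isClosedIdeal_img.mul_mem_left _ <| by
      simpa using PAut.star_mem_dom (θ := θ.symm) (by simpa using mem_img hb)
  · rw [PAut.dom_symm] at hc
    simpa [PAut.app_symm_app hc] using star_mul_eq hb (PAut.symm_app_mem_dom hc)

end homog

lemma eq_of_mul_self_sub_eq_zero {A : Type*} [NonUnitalCStarAlgebra A] {p q : A}
    (hp : IsSelfAdjoint p) (hq : IsSelfAdjoint q) (h : (p - q) * (p - q) = 0) : p = q := by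
  refine sub_eq_zero.mp ((CStarRing.star_mul_self_eq_zero_iff (p - q)).mp ?_)
  rwa [(hp.sub hq).star_eq]

namespace homog

lemma star_mul_self_comm (hb : b ∈ homog B θ) (a : B) : star b * b * a = a * (star b * b) :=
  ip_mul_comm hb hb a

lemma mul_star_self_comm (hb : b ∈ homog B θ) (a : B) : b * star b * a = a * (b * star b) := by
  simpa using star_mul_self_comm (star_mem hb) a

lemma star_mul_self_eq (hb : b ∈ homog B θ) : star b * b = b * star b := by
  refine eq_of_mul_self_sub_eq_zero (.star_mul_self b) (.mul_star_self b) ?_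
  have hleft : star b * b * (star b * b) = star b * b * (b * star b) := by
    rw [mul_assoc, ← mul_assoc b, mul_star_self_comm hb, ← mul_assoc]
  have hright : b * star b * (b * star b) = b * star b * (star b * b) := by
    rw [mul_assoc, ← mul_assoc (star b), star_mul_self_comm hb, ← mul_assoc]
  rw [sub_mul, mul_sub, mul_sub, hleft, hright, star_mul_self_comm hb]
  simp

lemma app_star_mul_self (hb : b ∈ homog B θ) : θ.app (star b * b) = star b * b := by
  have hself (θ : PAut B) {b : B} (hb : b ∈ homog B θ) :
      θ.app (star b * b) * (star b * b) = star b * b * (star b * b) := by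
    have hd := θ.isClosedIdeal_dom.mul_mem_left (star b) (mem_dom hb)
    calc θ.app (star b * b) * (star b * b) = θ.app (star b * b) * b * star b := by
          rw [mul_assoc, star_mul_self_eq hb]
      _ = b * star b * (b * star b) := by rw [← mul_eq hb hd]; simp only [mul_assoc]
      _ = star b * b * (star b * b) := by rw [star_mul_self_eq hb]
  have hdom := θ.isClosedIdeal_dom.mul_mem_left (star b) (mem_dom hb)
  have himg := θ.isClosedIdeal_img.mul_mem_left (star b) (mem_img hb)
  have hsymm : star b * b * θ.app (star b * b) = θ.app (star b * b) * θ.app (star b * b) := by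
    have h := hself θ.symm (star_mem hb)
    rw [star_star, ← star_mul_self_eq hb] at h
    simpa only [PAut.app_mul (PAut.symm_app_mem_dom himg) hdom, PAut.app_mul hdom hdom,
      PAut.app_symm_app himg] using congrArg θ.app h
  refine eq_of_mul_self_sub_eq_zero ?_ (.star_mul_self b) ?_
  · rw [IsSelfAdjoint, ← PAut.app_star hdom, star_mul, star_star]
  · rw [sub_mul, mul_sub, mul_sub, hself θ hb, hsymm]
    simp

lemma app_self (hb : b ∈ homog B θ) : θ.app b = b := by
  have hdom := mem_dom hb
  have hcross : star b * θ.app b = star b * b := by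
    rw [star_mul_eq hb hdom, star_mul_self_eq hb]
  have hcross_star : star (θ.app b) * b = star b * b := by
    simpa using congrArg star hcross
  refine sub_eq_zero.mp ((CStarRing.star_mul_self_eq_zero_iff _).mp ?_)
  rw [star_sub, sub_mul, mul_sub, mul_sub, hcross, hcross_star, ← PAut.app_star hdom,
    ← PAut.app_mul (PAut.star_mem_dom hdom) hdom, app_star_mul_self hb]
  simp

lemma app_mul_right (hb : b ∈ homog B θ) (x : B) : θ.app (x * b) = b * x := by
  have hdom := mem_dom hb
  have hx := θ.isClosedIdeal_dom.mul_mem_left x hdom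
  refine PAut.eq_of_forall_mul_eq (θ := θ.symm) (by simpa using PAut.app_mem_img hx)
    (by simpa using θ.isClosedIdeal_img.mul_mem_right x (mem_img hb)) fun c hc => ?_
  rw [PAut.dom_symm] at hc
  have hd := PAut.symm_app_mem_dom hc
  have hdx := θ.isClosedIdeal_dom.mul_mem_right x hd
  calc c * θ.app (x * b) = θ.app (θ.symm.app c * x * b) := by
        rw [mul_assoc, PAut.app_mul hd hx, PAut.app_symm_app hc]
    _ = b * (θ.symm.app c * x) := by rw [PAut.app_mul hdx hdom, app_self hb, ← mul_eq hb hdx]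
    _ = c * (b * x) := by rw [← mul_assoc, mul_eq hb hd, PAut.app_symm_app hc, mul_assoc]

end homog

end HomogeneousSelf

section Composition

variable {B : Type*} [NonUnitalCStarAlgebra B] [PartialOrder B] [StarOrderedRing B]
variable {E : Type*} [NormedAddCommGroup E] [NormedSpace ℂ E] [SMul Bᵐᵒᵖ E] [CStarModule Bᵐᵒᵖ E]
  [LeftAction B E]
variable {θ θ' τ : PAut B} {ξ : E} {b : B}

namespace homog

lemma rsmul_mem (hξ : ξ ∈ homog E θ) (hb : b ∈ homog B θ') (h : PAut.IsComp θ θ' τ) :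
    ξ <• b ∈ homog E τ := by
  refine mem_homog_iff.mpr ⟨h.mem_dom_iff.mpr ?_, fun d hd => ?_⟩
  · rw [ip_rsmul_left, ip_rsmul_right, ← mul_assoc, app_mul_right hb]
    exact ⟨θ'.isClosedIdeal_dom.mul_mem_left _ (mem_dom hb), θ.isClosedIdeal_dom.mul_mem_left b
      (θ.isClosedIdeal_dom.mul_mem_left _ (ip_right_mem_dom hξ ξ))⟩
  · obtain ⟨hd', hdθ⟩ := h.mem_dom_iff.mp hd
    rw [← rsmul_mul, mul_eq hb hd', rsmul_mul, rsmul_eq hξ hdθ, h.app_eq hd, lact_rsmul]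

lemma lact_mem (hb : b ∈ homog B θ) (hξ : ξ ∈ homog E θ') (h : PAut.IsComp θ θ' τ) :
    lact b ξ ∈ homog E τ := by
  refine mem_homog_iff.mpr ⟨h.mem_dom_iff.mpr ?_, fun d hd => ?_⟩
  · rw [LeftAction.ip_lact, ← LeftAction.lact_mul]
    refine ⟨ip_right_mem_dom (lact_central hξ (star_mul_self_comm hb)) ξ, ?_⟩
    rw [app_ip_lact_right hξ]
    exact θ.isClosedIdeal_dom.mul_mem_left _ (θ.isClosedIdeal_dom.mul_mem_left _ (mem_dom hb))
  · obtain ⟨hd', hdθ⟩ := h.mem_dom_iff.mp hd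
    rw [← lact_rsmul, rsmul_eq hξ hd', ← LeftAction.lact_mul, mul_eq hb hdθ, h.app_eq hd,
      LeftAction.lact_mul]

end homog

end Composition

/-! ### Operators on internal tensor products -/

section StandardOperators

variable {B : Type*} [NonUnitalCStarAlgebra B] [PartialOrder B]
variable {E : Type*} [NormedAddCommGroup E] [NormedSpace ℂ E] [SMul Bᵐᵒᵖ E] [CStarModule Bᵐᵒᵖ E]
variable {θ : PAut B} {ξ : E} {b : B}

lemma ip_leftMul [LeftAction B E] (b : B) (ξ η : E) :
    ip B (leftMul E (star b) η) ξ = ip B η (leftMul E b ξ) :=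
  (ip_lact_right b η ξ).symm

variable [StarOrderedRing B]

lemma add_rsmul (ξ η : E) (b : B) : (ξ + η) <• b = ξ <• b + η <• b :=
  congrArg (fun f => f b) (map_add (rmul B E) ξ η)

lemma smul_rsmul (z : ℂ) (ξ : E) (b : B) : (z • ξ) <• b = z • (ξ <• b) :=
  congrArg (fun f => f b) (map_smul (rmul B E) z ξ)

lemma ip_bra (ξ η : E) (b : B) : ip B (bra B ξ η) b = ip B η (ket B ξ b) := by
  simp [ket, ip_rsmul_right, star_ip]

lemma isAdjoint_rightMul (hb : b ∈ homog B θ) :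
    IsAdjoint θ.symm (rightMul E b) (rightMul E (star b)) := fun ξ η => by
  change ip B η (ξ <• b) ∈ θ.map.symm (ip B (η <• star b) ξ)
  rw [PEquiv.mem_iff_mem, ip_rsmul_right, ip_rsmul_left, star_star, ← homog.app_mul_right hb]
  exact PAut.app_mem_map (θ.isClosedIdeal_dom.mul_mem_left _ (homog.mem_dom hb))

variable [LeftAction B E]

/-- The operator `η ↦ θ ⟨ξ | η⟩`, which is adjoint to `|ξ]` relative to `θ*` for a `θ`-homogeneous
element `ξ`. -/
def rbra (hξ : ξ ∈ homog E θ) : E →L[ℂ] B :=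
  LinearMap.mkContinuous
    { toFun := fun η => θ.app (ip B ξ η)
      map_add' := fun η η' => by
        rw [ip_add_right,
          PAut.app_add (homog.ip_left_mem_dom hξ η) (homog.ip_left_mem_dom hξ η')]
      map_smul' := fun c η => by
        rw [ip_smul_right, PAut.app_smul _ (homog.ip_left_mem_dom hξ η), RingHom.id_apply] } ‖ξ‖
    fun η => (PAut.norm_app_le (homog.ip_left_mem_dom hξ η)).trans (norm_ip_le ξ η)

@[simp] lemma rbra_apply (hξ : ξ ∈ homog E θ) (η : E) : rbra hξ η = θ.app (ip B ξ η) := rfl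

lemma isAdjoint_rket (hξ : ξ ∈ homog E θ) : IsAdjoint θ.symm (rket B ξ) (rbra hξ) := fun b η => by
  change ip B η (lact b ξ) ∈ θ.map.symm (ip B (rbra hξ η) b)
  rw [PEquiv.mem_iff_mem, rbra_apply, ip_self, ← PAut.app_star (homog.ip_left_mem_dom hξ η),
    star_ip, ← homog.app_ip_lact_right hξ]
  refine PAut.app_mem_map ?_
  rw [ip_lact_right]
  exact homog.ip_right_mem_dom hξ _

lemma isHomogeneous_ket (hξ : ξ ∈ homog E θ) : IsHomogeneous θ (PAut.id B) (ket B ξ) where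
  range_subset b := by
    refine map_mem_of_mem_clspan ((rmul B E).flip b) (isClosed_clspan _) ?_
      (homog.mem_clspan_img hξ)
    rintro _ ⟨c, hc, η, rfl⟩
    exact subset_clspan _ ⟨c, hc, η <• b, (lact_rsmul c b η).symm⟩
  map_lact a c hc b := by
    change ξ <• (a * b) = lact c (ξ <• b)
    rw [rsmul_mul, hξ.2 a c hc, lact_rsmul]
  exists_adjoint := ⟨bra B ξ, fun b η => PAut.mem_id_map.mpr (ip_bra ξ η b)⟩

lemma isHomogeneous_rket (hξ : ξ ∈ homog E θ) :
    IsHomogeneous (PAut.id B) θ.symm (rket B ξ) where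
  range_subset b := subset_clspan _ ⟨b, by simp, ξ, rfl⟩
  map_lact a c hc b := by
    rw [PAut.mem_id_map] at hc
    subst hc
    exact LeftAction.lact_mul a b ξ
  exists_adjoint := ⟨rbra hξ, isAdjoint_rket hξ⟩

lemma isHomogeneous_leftMul (hb : b ∈ homog B θ) :
    IsHomogeneous θ (PAut.id B) (leftMul E b) where
  range_subset ξ := subset_clspan _ ⟨b, homog.mem_img hb, ξ, rfl⟩
  map_lact a c hc ξ := by
    change lact b (lact a ξ) = lact c (lact b ξ)
    rw [← LeftAction.lact_mul, ← LeftAction.lact_mul]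
    exact congrArg (fun x => lact x ξ) (hb.2 a c hc)
  exists_adjoint := ⟨leftMul E (star b), fun ξ η => PAut.mem_id_map.mpr (ip_leftMul b ξ η)⟩

lemma isHomogeneous_rightMul (hE : IsRightBimodule B E) (hb : b ∈ homog B θ) :
    IsHomogeneous (PAut.id B) θ.symm (rightMul E b) where
  range_subset ξ := by
    have hmem : ξ <• b ∈ clspan {x : E | ∃ (c : B) (η : E), x = lact c η} :=
      hE.nondegenerate ▸ Submodule.mem_top
    refine clspan_mono ?_ hmem
    rintro _ ⟨c, η, rfl⟩
    exact ⟨c, by simp, η, rfl⟩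
  map_lact a c hc ξ := by
    rw [PAut.mem_id_map] at hc
    subst hc
    exact (lact_rsmul a b ξ).symm
  exists_adjoint := ⟨rightMul E (star b), isAdjoint_rightMul hb⟩

end StandardOperators

section InternalTensor

variable {B : Type*} [NonUnitalCStarAlgebra B]
variable {K : Type*} [NormedAddCommGroup K] [InnerProductSpace ℂ K] [CompleteSpace K]
variable (π : B →⋆ₙₐ[ℂ] (K →L[ℂ] K))

lemma inner_rep_right (b : B) (x y : K) : inner ℂ x (π b y) = inner ℂ (π (star b) x) y := by
  rw [map_star, ContinuousLinearMap.star_eq_adjoint, ContinuousLinearMap.adjoint_inner_left]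

variable [PartialOrder B] [StarOrderedRing B]
variable {E : Type*} [NormedAddCommGroup E] [NormedSpace ℂ E] [SMul Bᵐᵒᵖ E] [CStarModule Bᵐᵒᵖ E]
variable {F : Type*} [NormedAddCommGroup F] [NormedSpace ℂ F] [SMul Bᵐᵒᵖ F] [CStarModule Bᵐᵒᵖ F]

lemma ext_inner_tmul {x y : ITensor π E}
    (h : ∀ η ω, inner ℂ (tmul π η ω) x = inner ℂ (tmul π η ω) y) : x = y := by
  have hfun : innerSL ℂ x = innerSL ℂ y := ext_tmul π fun η ω => by
    rw [innerSL_apply_apply, innerSL_apply_apply, ← inner_conj_symm, h, inner_conj_symm]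
  exact ext_inner_right ℂ fun z => congrArg (fun f => f z) hfun

lemma tmul_congr {ξ : E} {ζ ζ' : K} (h : ∀ η : E, π (ip B η ξ) ζ = π (ip B η ξ) ζ') :
    tmul π ξ ζ = tmul π ξ ζ' :=
  ext_inner_tmul π fun η ω => by rw [inner_tmul_tmul, inner_tmul_tmul, h]

lemma tmul_rsmul (ξ : E) (b : B) (ζ : K) : tmul π (ξ <• b) ζ = tmul π ξ (π b ζ) :=
  ext_inner_tmul π fun η ω => by
    rw [inner_tmul_tmul, inner_tmul_tmul, ip_rsmul_right, map_mul]
    rfl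

/-- The elementary tensors as a bounded bilinear map. -/
def tmulL : E →L[ℂ] K →L[ℂ] ITensor π E :=
  LinearMap.mkContinuous₂ ((TensorProduct.mk ℂ E K).compr₂ (toITensor π)) 1
    fun ξ ζ => by rw [one_mul]; exact norm_tmul_le π ξ ζ

lemma add_tmul (ξ η : E) (ζ : K) : tmul π (ξ + η) ζ = tmul π ξ ζ + tmul π η ζ :=
  congrArg (fun f => f ζ) (map_add (tmulL π) ξ η)

lemma smul_tmul (z : ℂ) (ξ : E) (ζ : K) : tmul π (z • ξ) ζ = z • tmul π ξ ζ :=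
  congrArg (fun f => f ζ) (map_smul (tmulL π) z ξ)

lemma zero_tmul (ζ : K) : tmul π (0 : E) ζ = 0 :=
  congrArg (fun f => f ζ) (map_zero (tmulL (E := E) π))

lemma eq_top_of_tmul_mem {M : Submodule ℂ (ITensor π E)} (hM : IsClosed (M : Set (ITensor π E)))
    {S : Set E} (hS : clspan S = ⊤) (h : ∀ ξ ∈ S, ∀ ζ, tmul π ξ ζ ∈ M) : M = ⊤ := by
  have htmul (ξ : E) (ζ : K) : tmul π ξ ζ ∈ M :=
    map_mem_of_mem_clspan ((tmulL π).flip ζ) hM (fun ξ hξ => h ξ hξ ζ)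
      (hS ▸ Submodule.mem_top (x := ξ))
  have hrange : Set.range (toITensor (E := E) π) ⊆ M := by
    rintro _ ⟨y, rfl⟩
    induction y using TensorProduct.induction_on with
    | zero => rw [map_zero]; exact M.zero_mem
    | tmul ξ ζ => exact htmul ξ ζ
    | add y z hy hz => rw [map_add]; exact M.add_mem hy hz
  exact eq_top_iff.mpr fun x _ => closure_minimal hrange hM (denseRange_toITensor π x)

lemma amp_tmul_of_adjoint {T : E →L[ℂ] F} {S : F →L[ℂ] E} {s : K →L[ℂ] K}
    (hTS : ∀ ξ η, ip B (S η) ξ = ip B η (T ξ)) (hs : ∀ b ζ, π b (s ζ) = π b ζ) (ξ : E) (ζ : K) :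
    amp π T s (tmul π ξ ζ) = tmul π (T ξ) ζ := by
  have hexists := exists_amp π (T := T) (s := s) (S ∘L T) fun ξ ξ' ζ ζ' => by
    rw [hs, inner_rep_right, hs, ← inner_rep_right, ContinuousLinearMap.comp_apply, hTS]
  rw [amp_tmul_of_exists π hexists]
  exact tmul_congr π fun _ => hs _ ζ

section AmplificationByOne

variable {π} {T : E →L[ℂ] F} {S : F →L[ℂ] E} (hTS : ∀ ξ η, ip B (S η) ξ = ip B η (T ξ))
include hTS

lemma amp_one_tmul (ξ : E) (ζ : K) : amp π T 1 (tmul π ξ ζ) = tmul π (T ξ) ζ :=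
  amp_tmul_of_adjoint π hTS (fun _ _ => rfl) ξ ζ

lemma adjoint_amp_one_tmul (η : F) (ω : K) :
    adjoint (amp π T 1) (tmul π η ω) = tmul π (S η) ω :=
  ext_inner_tmul π fun ξ ζ => by
    rw [ContinuousLinearMap.adjoint_inner_right, amp_one_tmul hTS, inner_tmul_tmul,
      inner_tmul_tmul, ← star_ip, ← hTS, star_ip]

end AmplificationByOne

variable [LeftAction B E]

variable (E) in
/-- The representation `b ↦ l_b ⊗ 1` of `B` on `E ⊗_π K`; its values are the operators `F(l_b)`. -/
def leftRep : B →⋆ₙₐ[ℂ] (ITensor π E →L[ℂ] ITensor π E) where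
  toFun b := amp π (leftMul E b) 1
  map_smul' z b := ext_tmul π fun ξ ζ => by
    rw [amp_one_tmul (ip_leftMul _), MonoidHom.id_apply, _root_.smul_apply,
      amp_one_tmul (ip_leftMul _), leftMul, map_smul, _root_.smul_apply, smul_tmul]
    rfl
  map_zero' := ext_tmul π fun ξ ζ => by
    rw [amp_one_tmul (ip_leftMul _), leftMul, map_zero, _root_.zero_apply, zero_tmul]
    rfl
  map_add' b c := ext_tmul π fun ξ ζ => by
    rw [amp_one_tmul (ip_leftMul _), _root_.add_apply, amp_one_tmul (ip_leftMul _),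
      amp_one_tmul (ip_leftMul _), leftMul, map_add, _root_.add_apply, add_tmul]
    rfl
  map_mul' b c := ext_tmul π fun ξ ζ => by
    rw [amp_one_tmul (ip_leftMul _), mul_apply_eq_comp, amp_one_tmul (ip_leftMul _),
      amp_one_tmul (ip_leftMul _)]
    exact congrArg (fun x => tmul π x ζ) (LeftAction.lact_mul b c ξ)
  map_star' b := ext_tmul π fun ξ ζ => by
    rw [amp_one_tmul (ip_leftMul _), ContinuousLinearMap.star_eq_adjoint,
      adjoint_amp_one_tmul (ip_leftMul _)]

@[simp] lemma leftRep_tmul (b : B) (ξ : E) (ζ : K) :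
    leftRep π E b (tmul π ξ ζ) = tmul π (lact b ξ) ζ :=
  amp_one_tmul (ip_leftMul _) ξ ζ

end InternalTensor

lemma norm_le_of_adjoint_comp {H H' : Type*} [NormedAddCommGroup H] [InnerProductSpace ℂ H]
    [CompleteSpace H] [NormedAddCommGroup H'] [InnerProductSpace ℂ H'] [CompleteSpace H']
    (T : H →L[ℂ] H') {C : ℝ} (hC : 0 ≤ C) (h : ‖adjoint T ∘L T‖ ≤ C ^ 2) : ‖T‖ ≤ C := by
  rw [ContinuousLinearMap.norm_adjoint_comp_self, ← sq] at h
  exact abs_le_of_sq_le_sq' h hC |>.2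

section KetOperators

variable {B : Type*} [NonUnitalCStarAlgebra B] [PartialOrder B] [StarOrderedRing B]
variable {K : Type*} [NormedAddCommGroup K] [InnerProductSpace ℂ K] [CompleteSpace K]
variable (π : B →⋆ₙₐ[ℂ] (K →L[ℂ] K))
variable {E : Type*} [NormedAddCommGroup E] [NormedSpace ℂ E] [SMul Bᵐᵒᵖ E] [CStarModule Bᵐᵒᵖ E]

lemma amp_ket_tmul (ξ : E) (b : B) (ζ : K) :
    amp π (ket B ξ) 1 (tmul π b ζ) = tmul π (ξ <• b) ζ :=
  amp_one_tmul (fun b η => ip_bra ξ η b) b ζ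

lemma adjoint_amp_ket_comp (ξ η : E) :
    adjoint (amp π (ket B ξ) 1) ∘L amp π (ket B η) 1 = leftRep π B (ip B ξ η) :=
  ext_tmul π fun b ζ => by
    rw [ContinuousLinearMap.comp_apply, amp_ket_tmul,
      adjoint_amp_one_tmul (fun b η => ip_bra ξ η b), leftRep_tmul, bra_apply, ip_rsmul_right,
      lact_self]

variable (E) in
/-- The operators `|ξ⟩ ⊗ 1 : B ⊗_π K → E ⊗_π K`, as a bounded linear map on `E`; its values are
the operators `F(|ξ⟩)`. -/
def ketOp : E →L[ℂ] ITensor π B →L[ℂ] ITensor π E :=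
  LinearMap.mkContinuous
    { toFun := fun ξ => amp π (ket B ξ) 1
      map_add' := fun ξ η => ext_tmul π fun b ζ => by
        rw [_root_.add_apply, amp_ket_tmul, amp_ket_tmul, amp_ket_tmul, add_rsmul, add_tmul]
      map_smul' := fun z ξ => ext_tmul π fun b ζ => by
        rw [RingHom.id_apply, _root_.smul_apply, amp_ket_tmul, amp_ket_tmul, smul_rsmul,
          smul_tmul] } 1 fun ξ => by
    rw [one_mul]
    refine norm_le_of_adjoint_comp _ (norm_nonneg ξ) ?_
    change ‖adjoint (amp π (ket B ξ) 1) ∘L amp π (ket B ξ) 1‖ ≤ _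
    rw [adjoint_amp_ket_comp, norm_sq_eq_ip (B := B)]
    exact NonUnitalStarAlgHom.norm_apply_le (leftRep π B) _

@[simp] lemma ketOp_tmul (ξ : E) (b : B) (ζ : K) :
    ketOp π E ξ (tmul π b ζ) = tmul π (ξ <• b) ζ :=
  amp_ket_tmul π ξ b ζ

lemma adjoint_ketOp_comp (ξ η : E) :
    adjoint (ketOp π E ξ) ∘L ketOp π E η = leftRep π B (ip B ξ η) :=
  adjoint_amp_ket_comp π ξ η

lemma ketOp_comp_leftRep (ξ : E) (b : B) :
    ketOp π E ξ ∘L leftRep π B b = ketOp π E (ξ <• b) :=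
  ext_tmul π fun c ζ => by
    rw [ContinuousLinearMap.comp_apply, leftRep_tmul, ketOp_tmul, ketOp_tmul, lact_self, rsmul_mul]

lemma leftRep_comp_ketOp [LeftAction B E] (b : B) (ξ : E) :
    leftRep π E b ∘L ketOp π E ξ = ketOp π E (lact b ξ) :=
  ext_tmul π fun c ζ => by
    rw [ContinuousLinearMap.comp_apply, ketOp_tmul, ketOp_tmul, leftRep_tmul, lact_rsmul]

end KetOperators

/-! ### Operators of a covariant representation -/

namespace CovariantRep

section Relations

variable {B : Type*} [NonUnitalCStarAlgebra B]
variable {K : Type*} [NormedAddCommGroup K] [InnerProductSpace ℂ K] [CompleteSpace K]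
variable {Θ : Set (PAut B)} (R : CovariantRep Θ K) {θ : PAut B} {d : B}

lemma υ_id_π (hid : PAut.id B ∈ Θ) (b : B) (ζ : K) :
    R.υ (PAut.id B) (R.π b ζ) = R.π b ζ := by
  have hidem : R.υ (PAut.id B) ∘L R.υ (PAut.id B) = R.υ (PAut.id B) :=
    R.υ_comp _ hid _ hid _ hid (PEquiv.refl_trans _).symm
  obtain ⟨κ, hκ⟩ : R.π b ζ ∈ Set.range (R.υ (PAut.id B)) := by
    rw [R.range_υ _ hid]
    exact subset_clspan _ ⟨b, by simp, ζ, rfl⟩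
  rw [← hκ]
  exact congrArg (fun f => f κ) hidem

lemma π_υ_id (hid : PAut.id B ∈ Θ) (b : B) (ζ : K) :
    R.π b (R.υ (PAut.id B) ζ) = R.π b ζ := by
  refine ext_inner_left ℂ fun x => ?_
  rw [inner_rep_right, ← ContinuousLinearMap.adjoint_inner_left, R.υ_symm _ hid, PAut.id_symm,
    R.υ_id_π hid, ← inner_rep_right]

lemma υ_symm_comp (hΘ : IsInverseSemigroup Θ) {θ' τ : PAut B} (hθ : θ ∈ Θ) (hθ' : θ' ∈ Θ)
    (hτ : τ ∈ Θ) (h : PAut.IsComp θ θ' τ) (ζ : K) :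
    R.υ θ'.symm (R.υ θ.symm ζ) = R.υ τ.symm ζ := by
  have hsymm : PAut.IsComp θ'.symm θ.symm τ.symm :=
    (congrArg PEquiv.symm h).trans (PEquiv.symm_trans_rev _ _)
  exact congrArg (fun f => f ζ) (R.υ_comp _ (hΘ.symm_mem _ hθ') _ (hΘ.symm_mem _ hθ) _
    (hΘ.symm_mem _ hτ) hsymm)

variable [PartialOrder B] [StarOrderedRing B] (hΘ : IsInverseSemigroup Θ) (hθ : θ ∈ Θ)
include hΘ hθ

lemma π_υ_adjoint_υ (hd : d ∈ θ.dom) (ζ : K) :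
    R.π d (adjoint (R.υ θ) (R.υ θ ζ)) = R.π d ζ := by
  refine ext_inner_left ℂ fun x => ?_
  rw [inner_rep_right, ContinuousLinearMap.adjoint_inner_right,
    ← ContinuousLinearMap.adjoint_inner_left,
    R.υ_adjoint_comp_self hΘ hθ (PAut.star_mem_dom hd), ← inner_rep_right]

lemma υ_π (hd : d ∈ θ.dom) (ζ : K) : R.υ θ (R.π d ζ) = R.π (θ.app d) (R.υ θ ζ) := by
  rw [← R.covariant θ hθ d _ (PAut.app_mem_map hd)]
  change _ = R.υ θ (R.π d (adjoint (R.υ θ) (R.υ θ ζ)))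
  rw [R.π_υ_adjoint_υ hΘ hθ hd]

lemma π_υ_υ_symm (hd : d ∈ θ.img) (ζ : K) :
    R.π d (R.υ θ (R.υ θ.symm ζ)) = R.π d ζ := by
  have h := R.π_υ_adjoint_υ hΘ (hΘ.symm_mem θ hθ) (d := d) (by rwa [PAut.dom_symm]) ζ
  rwa [R.υ_symm _ (hΘ.symm_mem θ hθ), PAut.symm_symm] at h

end Relations

section Operators

variable {B : Type*} [NonUnitalCStarAlgebra B] [PartialOrder B] [StarOrderedRing B]
variable {K : Type*} [NormedAddCommGroup K] [InnerProductSpace ℂ K] [CompleteSpace K]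
variable {E : Type*} [NormedAddCommGroup E] [NormedSpace ℂ E] [SMul Bᵐᵒᵖ E] [CStarModule Bᵐᵒᵖ E]
variable {F : Type*} [NormedAddCommGroup F] [NormedSpace ℂ F] [SMul Bᵐᵒᵖ F] [CStarModule Bᵐᵒᵖ F]
variable {Θ : Set (PAut B)} (R : CovariantRep Θ K) {θ : PAut B} {ξ : E}

section Identity

variable (hid : PAut.id B ∈ Θ)
include hid

lemma mor_id_of_adjoint {T : E →L[ℂ] F} {S : F →L[ℂ] E}
    (hTS : ∀ ξ η, ip B (S η) ξ = ip B η (T ξ)) : R.mor (PAut.id B) T = amp R.π T 1 :=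
  ext_tmul R.π fun ξ ζ => by
    rw [mor, amp_tmul_of_adjoint R.π hTS (R.π_υ_id hid), amp_one_tmul hTS]

lemma mor_id_ket (ξ : E) : R.mor (PAut.id B) (ket B ξ) = ketOp R.π E ξ :=
  R.mor_id_of_adjoint hid fun b η => ip_bra ξ η b

lemma mor_id_leftMul [LeftAction B E] (b : B) :
    R.mor (PAut.id B) (leftMul E b) = leftRep R.π E b :=
  R.mor_id_of_adjoint hid (ip_leftMul b)

end Identity

lemma mor_zero (σ : PAut B) : R.mor σ (0 : E →L[ℂ] F) = 0 := by
  have hzero (ξ : E) (ζ : K) : (0 : R.obj E →L[ℂ] R.obj F) (tmul R.π ξ ζ)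
      = tmul R.π ((0 : E →L[ℂ] F) ξ) (R.υ σ ζ) := by
    rw [_root_.zero_apply, _root_.zero_apply, zero_tmul]
  refine ext_tmul R.π fun ξ ζ => ?_
  rw [mor, amp_tmul_of_exists _ ⟨0, hzero⟩, hzero]

variable [LeftAction B E] [LeftAction B F]
variable (hΘ : IsInverseSemigroup Θ) (hθ : θ ∈ Θ)

section
include hΘ

lemma adjoint_mor_tmul {ρ σ : PAut B} (hσ : σ ∈ Θ) {T : E →L[ℂ] F}
    {S : F →L[ℂ] E} (hT : IsHomogeneous ρ σ T) (hS : IsAdjoint σ T S) (η : F) (ω : K) :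
    adjoint (R.mor σ T) (tmul R.π η ω) = tmul R.π (S η) (R.υ σ.symm ω) := by
  refine ext_inner_tmul R.π fun ξ ζ => ?_
  have hmap := hS ξ η
  rw [ContinuousLinearMap.adjoint_inner_right, R.mor_tmul hΘ hσ hT, inner_tmul_tmul,
    inner_tmul_tmul, inner_rep_right, inner_rep_right, ← R.υ_symm σ hσ, star_ip, star_ip,
    ← PAut.app_eq hmap, ← R.υ_π hΘ hσ ⟨_, hmap⟩, ContinuousLinearMap.adjoint_inner_right]

include hθ

lemma mor_rket_tmul (hξ : ξ ∈ homog E θ) (b : B) (ζ : K) :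
    R.mor θ.symm (rket B ξ) (tmul R.π b ζ) = tmul R.π (lact b ξ) (R.υ θ.symm ζ) :=
  R.mor_tmul hΘ (hΘ.symm_mem θ hθ) (isHomogeneous_rket hξ) b ζ

lemma adjoint_mor_rket_tmul (hξ : ξ ∈ homog E θ) (η : E) (ω : K) :
    adjoint (R.mor θ.symm (rket B ξ)) (tmul R.π η ω)
      = tmul R.π (θ.app (ip B ξ η)) (R.υ θ ω) :=
  R.adjoint_mor_tmul hΘ (hΘ.symm_mem θ hθ) (isHomogeneous_rket hξ) (isAdjoint_rket hξ) η ω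

lemma adjoint_mor_rket_comp_self (hξ : ξ ∈ homog E θ) :
    adjoint (R.mor θ.symm (rket B ξ)) ∘L R.mor θ.symm (rket B ξ)
      = leftRep R.π B (θ.app (ip B ξ ξ)) :=
  ext_tmul R.π fun b ζ => by
    rw [ContinuousLinearMap.comp_apply, R.mor_rket_tmul hΘ hθ hξ,
      R.adjoint_mor_rket_tmul hΘ hθ hξ, leftRep_tmul, homog.app_ip_lact_right hξ, lact_self]
    refine tmul_congr R.π fun c => R.π_υ_υ_symm hΘ hθ ?_ ζ
    exact θ.isClosedIdeal_img.mul_mem_left _ (θ.isClosedIdeal_img.mul_mem_right _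
      (PAut.app_mem_img (homog.ip_right_mem_dom hξ ξ)))

end

variable (E θ) in
/-- The operators `F(|ξ])`, as a bounded linear map on the `θ`-homogeneous elements `ξ`. -/
def rketOp : homogSub E θ →L[ℂ] R.obj B →L[ℂ] R.obj E :=
  LinearMap.mkContinuous
    { toFun := fun ξ => R.mor θ.symm (rket B ξ.1)
      map_add' := fun ξ η => ext_tmul R.π fun b ζ => by
        rw [_root_.add_apply, R.mor_rket_tmul hΘ hθ (ξ + η).2, R.mor_rket_tmul hΘ hθ ξ.2,
          R.mor_rket_tmul hΘ hθ η.2, Submodule.coe_add, map_add, add_tmul]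
      map_smul' := fun z ξ => ext_tmul R.π fun b ζ => by
        rw [RingHom.id_apply, _root_.smul_apply, R.mor_rket_tmul hΘ hθ (z • ξ).2,
          R.mor_rket_tmul hΘ hθ ξ.2, Submodule.coe_smul, map_smul, smul_tmul] } 1 fun ξ => by
    rw [one_mul]
    refine norm_le_of_adjoint_comp _ (norm_nonneg ξ) ?_
    change ‖adjoint (R.mor θ.symm (rket B ξ.1)) ∘L R.mor θ.symm (rket B ξ.1)‖ ≤ ‖ξ.1‖ ^ 2
    rw [R.adjoint_mor_rket_comp_self hΘ hθ ξ.2, norm_sq_eq_ip (B := B),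
      ← PAut.norm_app (homog.ip_right_mem_dom ξ.2 ξ.1)]
    exact NonUnitalStarAlgHom.norm_apply_le (leftRep R.π B) _

end Operators

end CovariantRep

/-! ### Spaces of operators and factorizations -/

section OperatorSpaces

variable {H H' H'' : Type*} [NormedAddCommGroup H] [InnerProductSpace ℂ H]
  [NormedAddCommGroup H'] [InnerProductSpace ℂ H'] [NormedAddCommGroup H'']
  [InnerProductSpace ℂ H'']

lemma comp_mem_of_mem_clspan {S : Set (H' →L[ℂ] H'')} {S' : Set (H →L[ℂ] H')}
    {M : Submodule ℂ (H →L[ℂ] H'')} (hM : IsClosed (M : Set (H →L[ℂ] H'')))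
    (h : ∀ x ∈ S, ∀ y ∈ S', x ∘L y ∈ M) {x : H' →L[ℂ] H''} {y : H →L[ℂ] H'}
    (hx : x ∈ clspan S) (hy : y ∈ clspan S') : x ∘L y ∈ M :=
  map₂_mem_of_mem_clspan (compL ℂ H H' H'') hM h hx hy

lemma comp_eq_comp_of_mem_clspan {S : Set (H →L[ℂ] H')} {a : H' →L[ℂ] H'} {b : H →L[ℂ] H}
    (h : ∀ x ∈ S, a ∘L x = x ∘L b) {x : H →L[ℂ] H'} (hx : x ∈ clspan S) : a ∘L x = x ∘L b := by
  have hmem := map_mem_of_mem_clspan (M := ⊥) (compL ℂ H H' H' a - (compL ℂ H H H').flip b)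
    (by simp) (fun x hx => by simpa [sub_eq_zero] using h x hx) hx
  simpa [sub_eq_zero] using hmem

variable [CompleteSpace H]

lemma adjoint_comp_mem_of_mem_clspan [CompleteSpace H''] {S : Set (H →L[ℂ] H'')}
    {S' : Set (H' →L[ℂ] H'')} {M : Submodule ℂ (H' →L[ℂ] H)}
    (hM : IsClosed (M : Set (H' →L[ℂ] H))) (h : ∀ x ∈ S, ∀ y ∈ S', adjoint x ∘L y ∈ M)
    {x : H →L[ℂ] H''} {y : H' →L[ℂ] H''} (hx : x ∈ clspan S) (hy : y ∈ clspan S') :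
    adjoint x ∘L y ∈ M :=
  map₂_mem_of_mem_clspan ((compL ℂ H' H'' H).comp
    (adjoint (𝕜 := ℂ) (E := H) (F := H'')).toContinuousLinearEquiv.toContinuousLinearMap) hM h hx hy

variable [CompleteSpace H']

lemma tendsto_comp_of_adjoint_comp_mem {A : Set (H →L[ℂ] H)} {ι : Type*} {l : Filter ι}
    {e : ι → H →L[ℂ] H} (he : IsApproxUnit A l e) {T : H →L[ℂ] H'} (hT : adjoint T ∘L T ∈ A) :
    Tendsto (fun i => T ∘L e i) l (𝓝 T) := by
  have hsq (i : ι) : ‖T ∘L e i - T‖ = √‖e i * (adjoint T ∘L T * e i - adjoint T ∘L T)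
      - (adjoint T ∘L T * e i - adjoint T ∘L T)‖ := by
    have hadj : adjoint (e i) = e i := he.star_eq i
    have hcomp : adjoint (T ∘L e i - T) ∘L (T ∘L e i - T) =
        e i * (adjoint T ∘L T * e i - adjoint T ∘L T) -
          (adjoint T ∘L T * e i - adjoint T ∘L T) := by
      rw [map_sub, adjoint_comp, hadj, comp_sub, sub_comp, sub_comp, mul_sub, sub_sub_sub_comm]
      rfl
    rw [← hcomp, norm_adjoint_comp_self, Real.sqrt_mul_self (norm_nonneg _)]
  rw [tendsto_iff_norm_sub_tendsto_zero]
  simpa only [hsq, norm_zero, Real.sqrt_zero] using (he.tendsto_mul_sub_sub hT).norm.sqrt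

lemma clspan_comp_eq {M : Submodule ℂ (H →L[ℂ] H')} (hM : IsClosed (M : Set (H →L[ℂ] H')))
    {A : NonUnitalStarSubalgebra ℂ (H →L[ℂ] H)} (hA : IsClosed (A : Set (H →L[ℂ] H)))
    (hadj : ∀ x ∈ M, adjoint x ∘L x ∈ A) (hcomp : ∀ x ∈ M, ∀ a ∈ A, x ∘L a ∈ M) :
    clspan {x : H →L[ℂ] H' | ∃ ξ ∈ M, ∃ a ∈ A, x = ξ ∘L a} = M := by
  refine le_antisymm (clspan_le hM ?_) fun x hx => ?_
  · rintro _ ⟨ξ, hξ, a, ha, rfl⟩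
    exact hcomp ξ hξ a ha
  · obtain ⟨_, _, _, he⟩ := exists_isApproxUnit A hA
    exact he.mem_of_tendsto (isClosed_clspan _) (tendsto_comp_of_adjoint_comp_mem he (hadj x hx))
      fun i => subset_clspan _ ⟨x, hx, _, he.mem i, rfl⟩

end OperatorSpaces

namespace CStarBase.IsFactorization

variable {H H' K : Type*} [NormedAddCommGroup H] [InnerProductSpace ℂ H] [CompleteSpace H]
  [NormedAddCommGroup H'] [InnerProductSpace ℂ H'] [NormedAddCommGroup K] [InnerProductSpace ℂ K]
  [CompleteSpace K] {𝒞 : CStarBase H} {α : Submodule ℂ (H →L[ℂ] K)}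

lemma rep_eq_of_forall_comp_eq {S : Set (H →L[ℂ] K)} (hα : 𝒞.IsFactorization (clspan S))
    (b : 𝒞.right) {a : K →L[ℂ] K} (h : ∀ x ∈ S, a ∘L x = x ∘L b) : hα.rep b = a := by
  refine hα.ext_comp fun ξ hξ ζ => ?_
  rw [hα.rep_apply _ hξ]
  exact congrArg (fun f => f ζ) (comp_eq_comp_of_mem_clspan h hξ).symm

open scoped CStarAlgebra in
lemma continuous_rep (hα : 𝒞.IsFactorization α) : Continuous hα.rep :=
  have : IsClosed (𝒞.right : Set (H →L[ℂ] H)) := 𝒞.isClosed_right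
  map_continuous hα.rep

lemma rep_comp_mem (hα : 𝒞.IsFactorization α) {S : Set (H →L[ℂ] H)}
    (hS : (𝒞.right : Set (H →L[ℂ] H)) = clspan S) {N : Submodule ℂ (H' →L[ℂ] K)}
    (hN : IsClosed (N : Set (H' →L[ℂ] K))) {S' : Set (H' →L[ℂ] K)}
    (h : ∀ b : 𝒞.right, (b : H →L[ℂ] H) ∈ S → ∀ η ∈ S', hα.rep b ∘L η ∈ N) (b : 𝒞.right)
    {η : H' →L[ℂ] K} (hη : η ∈ clspan S') : hα.rep b ∘L η ∈ N := by
  let rep : 𝒞.right.toSubmodule →L[ℂ] K →L[ℂ] K :=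
    { toFun := hα.rep
      map_add' := map_add hα.rep
      map_smul' := map_smul hα.rep
      cont := hα.continuous_rep }
  have hb : (b : H →L[ℂ] H) ∈ clspan S := SetLike.mem_coe.mp (hS ▸ b.2)
  have hclosed : IsClosed (𝒞.right.toSubmodule : Set (H →L[ℂ] H)) := 𝒞.isClosed_right
  exact map_mem_of_coe_mem_clspan (x := b) hclosed ((compL ℂ H' K K).flip η ∘L rep)
    (hS ▸ subset_clspan S) hN
    (fun c hc => map_mem_of_mem_clspan (compL ℂ H' K K (hα.rep c)) hN (h c hc) hη) hb

end CStarBase.IsFactorization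

/-! ### Coefficients of homogeneous elements -/

section Nondegenerate

variable {B : Type*} [NonUnitalCStarAlgebra B] [PartialOrder B] [StarOrderedRing B]

lemma clspan_rsmul_eq_top {E : Type*} [NormedAddCommGroup E] [NormedSpace ℂ E] [SMul Bᵐᵒᵖ E]
    [CStarModule Bᵐᵒᵖ E] : clspan {x : E | ∃ (ξ : E) (b : B), x = ξ <• b} = ⊤ := by
  refine eq_top_iff.mpr fun ξ _ => ?_
  obtain ⟨_, _, _, he⟩ := exists_isApproxUnit_univ B
  simpa using he.mem_clspan_rsmul (Set.mem_univ (ip B ξ ξ))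

lemma clspan_lact_self : clspan {x : B | ∃ b c : B, x = lact b c} = ⊤ :=
  clspan_rsmul_eq_top (B := B) (E := B)

lemma isDecomposable_of_supported {Θ : Set (PAut B)}
    (hB : IsDecomposable B (Set.univ : Set (PAut B))) (hΘ : IsSupported B Θ) :
    IsDecomposable B Θ := by
  refine eq_top_iff.mpr (hB.symm.le.trans (clspan_le (isClosed_clspan _) ?_))
  rintro b ⟨θ, -, hb⟩
  rw [hΘ θ] at hb
  refine clspan_mono ?_ hb
  rintro c ⟨θ', hθ', -, hc⟩
  exact ⟨θ', hθ', hc⟩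

end Nondegenerate

section Families

variable {B : Type*} [NonUnitalCStarAlgebra B] [PartialOrder B]
variable {E : Type*} [NormedAddCommGroup E] [NormedSpace ℂ E] [SMul Bᵐᵒᵖ E] [CStarModule Bᵐᵒᵖ E]

section Adjoints

variable [StarOrderedRing B]
variable {F : Type*} [NormedAddCommGroup F] [NormedSpace ℂ F] [SMul Bᵐᵒᵖ F] [CStarModule Bᵐᵒᵖ F]

lemma isAdjoint_unique {σ : PAut B} {T : E →L[ℂ] F} {S S' : F →L[ℂ] E} (h : IsAdjoint σ T S)
    (h' : IsAdjoint σ T S') (η : F) : S η = S' η :=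
  ext_ip (B := B) fun ξ => by rw [← star_ip, σ.map.inj (h ξ η) (h' ξ η), star_ip]

lemma isAdjoint_zero (σ : PAut B) : IsAdjoint σ (0 : E →L[ℂ] F) 0 := fun ξ η => by
  have hright : ip B η ((0 : E →L[ℂ] F) ξ) = 0 := map_zero (bra B η)
  have hleft : ip B ((0 : F →L[ℂ] E) η) ξ = 0 := by
    rw [← star_ip]
    exact star_eq_zero.mpr (map_zero (bra B ξ))
  rw [hright, hleft]
  exact PAut.mem_map_iff.mpr ⟨zero_mem σ.isClosedIdeal_dom.toSubmodule, by
    simpa using PAut.app_smul 0 (zero_mem σ.isClosedIdeal_dom.toSubmodule)⟩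

end Adjoints

variable [LeftAction B E] {ρ σ θ : PAut B} {T : B →L[ℂ] E}

lemma mem_rketFamily (hT : T ∈ rketFamily B E ρ σ) :
    (∃ ξ ∈ homog E σ.symm, T = rket B ξ) ∨ T = 0 := by
  rw [rketFamily] at hT
  split_ifs at hT
  · exact Or.inl hT
  · exact Or.inr hT

lemma rketFamily_id (σ : PAut B) :
    rketFamily B E (PAut.id B) σ = {T | ∃ ξ ∈ homog E σ.symm, T = rket B ξ} := by
  rw [rketFamily, if_pos rfl]

variable [StarOrderedRing B]

lemma mem_ketFamily (hT : T ∈ ketFamily B E ρ σ) :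
    (σ = PAut.id B ∧ ∃ ξ ∈ homog E ρ, T = ket B ξ) ∨ T = 0 := by
  rw [ketFamily] at hT
  split_ifs at hT with hσ
  · exact Or.inl ⟨hσ, hT⟩
  · exact Or.inr hT

lemma mem_clspan_app_ip (h : (rketFamily B E).adj.prod (rketFamily B E) = rketFamily B B)
    {b : B} (hb : b ∈ homog B θ) :
    b ∈ clspan {x : B | ∃ σ : PAut B, ∃ ξ ∈ homog E σ, ∃ η, x = σ.app (ip B ξ η)} := by
  have hrket : rket B b ∈ (rketFamily B E).adj.prod (rketFamily B E) (PAut.id B) θ.symm := by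
    rw [h, rketFamily_id]
    exact ⟨b, hb, rfl⟩
  obtain ⟨_, _, _, he⟩ := exists_isApproxUnit_univ B
  refine he.mem_of_tendsto (isClosed_clspan _) (he.mul_left b trivial) fun i => ?_
  refine map_mem_of_mem_clspan (ContinuousLinearMap.apply ℂ B _) (isClosed_clspan _) ?_ hrket
  rintro _ ⟨_, _, _, σ, -, -, S, ⟨T, hT, hTS⟩, T', -, rfl⟩
  rw [ContinuousLinearMap.apply_apply, ContinuousLinearMap.comp_apply]
  rcases mem_rketFamily hT with ⟨ξ, hξ, rfl⟩ | rfl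
  · rw [isAdjoint_unique hTS (isAdjoint_rket hξ)]
    exact subset_clspan _ ⟨_, ξ, hξ, _, rfl⟩
  · rw [isAdjoint_unique hTS (isAdjoint_zero _)]
    exact zero_mem _

end Families

section CoefficientAlgebra

variable {B : Type*} [NonUnitalCStarAlgebra B] [PartialOrder B] [StarOrderedRing B]
variable {E : Type*} [NormedAddCommGroup E] [NormedSpace ℂ E] [SMul Bᵐᵒᵖ E] [CStarModule Bᵐᵒᵖ E]
  [LeftAction B E]
variable {θ : PAut B} {Θ : Set (PAut B)} {ξ : E} {ι : Type*} {l : Filter ι} {e : ι → B}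
  {S : Set B}

variable (E Θ) in
/-- The coefficients `θ ⟨ξ | η⟩` with `θ ∈ Θ` and both `ξ` and `η` homogeneous for `θ`; they are
central in `B`. -/
def homogCoeffs : Set B :=
  {x | ∃ θ ∈ Θ, ∃ ξ ∈ homog E θ, ∃ η ∈ homog E θ, x = θ.app (ip B ξ η)}

variable (E Θ) in
/-- The `C*`-subalgebra of the centre of `B` spanned by the coefficients `θ ⟨ξ | η⟩`. Its
approximate units serve to approximate homogeneous elements `c` of `B` by elements `θ ⟨ξ | η⟩ c`. -/
def homogCoeffAlg : NonUnitalStarSubalgebra ℂ B :=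
  clspanAlg (homogCoeffs E Θ)
    (by
      rintro _ ⟨θ, -, ξ, hξ, η, hη, rfl⟩ _ ⟨θ', hθ', ξ', hξ', η', hη', rfl⟩
      have hcentral := homog.app_ip_mul_comm hξ hη
      refine ⟨θ', hθ', ξ', hξ', _, homog.lact_central hη' hcentral, ?_⟩
      rw [homog.app_ip_lact_right hη', hcentral])
    (by
      rintro _ ⟨θ, hθ, ξ, hξ, η, hη, rfl⟩
      exact ⟨θ, hθ, η, hη, ξ, hξ, by
        rw [← PAut.app_star (homog.ip_left_mem_dom hξ η), star_ip]⟩)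

namespace homog

lemma ip_lact_sub_mem_dom (hξ : ξ ∈ homog E θ) (η : E) (b : B) :
    ip B (lact b ξ - ξ) η ∈ θ.dom := by
  rw [ip_sub_left]
  exact Submodule.sub_mem θ.isClosedIdeal_dom.toSubmodule (ip_lact_left_mem_dom hξ b η)
    (ip_left_mem_dom hξ η)

lemma app_ip_lact_sub_left (hξ : ξ ∈ homog E θ) (η : E) (b : B) :
    θ.app (ip B (lact b ξ - ξ) η) = star b * θ.app (ip B ξ η) - θ.app (ip B ξ η) := by
  rw [ip_sub_left, PAut.app_sub (ip_lact_left_mem_dom hξ b η) (ip_left_mem_dom hξ η),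
    app_ip_lact_left hξ]

lemma app_ip_lact_sub_right (hξ : ξ ∈ homog E θ) (η : E) (b : B) :
    θ.app (ip B η (lact b ξ - ξ)) = θ.app (ip B η ξ) * b - θ.app (ip B η ξ) := by
  rw [← star_ip, PAut.app_star (ip_lact_sub_mem_dom hξ η b), app_ip_lact_sub_left hξ, star_sub,
    star_mul, star_star, ← PAut.app_star (ip_left_mem_dom hξ η), star_ip]

end homog

namespace IsApproxUnit

lemma tendsto_lact_of_app_ip_self_mem (he : IsApproxUnit S l e) (hξ : ξ ∈ homog E θ)
    (h : θ.app (ip B ξ ξ) ∈ S) : Tendsto (fun i => lact (e i) ξ) l (𝓝 ξ) := by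
  refine tendsto_of_tendsto_ip_self (B := B) (tendsto_zero_iff_norm_tendsto_zero.mpr ?_)
  refine (tendsto_zero_iff_norm_tendsto_zero.mp (he.tendsto_mul_sub_sub h)).congr fun i => ?_
  rw [← PAut.norm_app (homog.ip_lact_sub_mem_dom hξ _ _), homog.app_ip_lact_sub_left hξ,
    homog.app_ip_lact_sub_right hξ, he.star_eq]

lemma tendsto_mul_app_ip (he : IsApproxUnit S l e) (hξ : ξ ∈ homog E θ)
    (h : Tendsto (fun i => lact (e i) ξ) l (𝓝 ξ)) (η : E) :
    Tendsto (fun i => e i * θ.app (ip B ξ η)) l (𝓝 (θ.app (ip B ξ η))) := by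
  rw [tendsto_iff_norm_sub_tendsto_zero] at h ⊢
  refine squeeze_zero (fun _ => norm_nonneg _) (fun i => ?_) (by simpa using h.mul_const ‖η‖)
  have happ : e i * θ.app (ip B ξ η) - θ.app (ip B ξ η) = θ.app (ip B (lact (e i) ξ - ξ) η) := by
    rw [homog.app_ip_lact_sub_left hξ, he.star_eq]
  rw [happ, PAut.norm_app (homog.ip_lact_sub_mem_dom hξ η _)]
  exact norm_ip_le (B := B) _ η

variable (he : IsApproxUnit (homogCoeffAlg E Θ : Set B) l e)
include he

lemma tendsto_lact_of_isDecomposable (hE : IsDecomposable E Θ) (ξ : E) :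
    Tendsto (fun i => lact (e i) ξ) l (𝓝 ξ) := by
  refine tendsto_of_mem_clspan (T := fun i => lact (B := B) (E := E) (e i))
    (C := ‖lact (B := B) (E := E)‖) (fun i => ?_) ?_ (hE ▸ Submodule.mem_top (x := ξ))
  · exact (le_opNorm _ _).trans (mul_le_of_le_one_right (norm_nonneg _) (he.norm_le i))
  · rintro ξ ⟨θ, hθ, hξ⟩
    exact he.tendsto_lact_of_app_ip_self_mem hξ (subset_clspan _ ⟨θ, hθ, ξ, hξ, ξ, hξ, rfl⟩)

lemma tendsto_mul_of_isDecomposable (hE : IsDecomposable E Θ)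
    (h : (rketFamily B E).adj.prod (rketFamily B E) = rketFamily B B) {c : B}
    (hc : c ∈ homog B θ) : Tendsto (fun i => e i * c) l (𝓝 c) := by
  refine tendsto_of_mem_clspan (T := fun i => ContinuousLinearMap.mul ℂ B (e i)) (C := 1)
    (fun i => (opNorm_mul_apply_le ℂ B _).trans (he.norm_le i)) ?_ (mem_clspan_app_ip h hc)
  rintro _ ⟨σ, ξ, hξ, η, rfl⟩
  exact he.tendsto_mul_app_ip hξ (he.tendsto_lact_of_isDecomposable hE ξ) η

end IsApproxUnit

lemma mem_clspan_homogCoeffs_mul (hE : IsDecomposable E Θ)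
    (h : (rketFamily B E).adj.prod (rketFamily B E) = rketFamily B B) {c : B}
    (hc : c ∈ homog B θ) : c ∈ clspan {x | ∃ z ∈ homogCoeffs E Θ, x = z * c} := by
  obtain ⟨_, _, _, he⟩ := exists_isApproxUnit (homogCoeffAlg E Θ) (isClosed_clspan _)
  refine he.mem_of_tendsto (isClosed_clspan _) (he.tendsto_mul_of_isDecomposable hE h hc)
    fun i => ?_
  refine map_mem_of_mem_clspan ((ContinuousLinearMap.mul ℂ B).flip c) (isClosed_clspan _) ?_
    (he.mem i)
  exact fun z hz => subset_clspan _ ⟨z, hz, rfl⟩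

end CoefficientAlgebra

section CentralElements

variable {B : Type*} [NonUnitalCStarAlgebra B] [PartialOrder B] [StarOrderedRing B]
variable {E : Type*} [NormedAddCommGroup E] [NormedSpace ℂ E] [SMul Bᵐᵒᵖ E] [CStarModule Bᵐᵒᵖ E]
  [LeftAction B E]
variable {θ : PAut B}

lemma isClosed_homogSub (θ : PAut B) : IsClosed (homogSub E θ : Set E) := by
  have h : (homogSub E θ : Set E) =
      (clspan {x : E | ∃ (η : E), ∃ d ∈ θ.dom, x = η <• d} : Set E) ∩
        ⋂ (b : B) (c : B) (_ : c ∈ θ.map b), {ξ | ξ <• b = lact c ξ} := by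
    ext ξ
    simp [homogSub, homog]
  rw [h]
  exact (isClosed_clspan _).inter (isClosed_iInter fun b => isClosed_iInter fun c =>
    isClosed_iInter fun _ => isClosed_eq ((rmul B E).flip b).continuous
      (lact (B := B) (E := E) c).continuous)

lemma homog.mem_clspan_rsmul_central {ξ : E} (hξ : ξ ∈ homog E θ) :
    ξ ∈ clspan {x | ∃ z : B, (∀ b, z * b = b * z) ∧ x = ξ <• z} := by
  have hcenter {z : B} : z ∈ NonUnitalStarSubalgebra.center ℂ B ↔ ∀ b, z * b = b * z := by
    simp only [NonUnitalStarSubalgebra.mem_center_iff, eq_comm]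
  have hclosed : IsClosed (NonUnitalStarSubalgebra.center ℂ B : Set B) := by
    rw [NonUnitalStarSubalgebra.coe_center, ← Set.centralizer_univ]
    exact Set.isClosed_centralizer _
  obtain ⟨_, _, _, he⟩ := exists_isApproxUnit _ hclosed
  exact he.mem_of_tendsto (isClosed_clspan _)
    (he.tendsto_rsmul_of_ip_self_mem (hcenter.mpr (homog.ip_mul_comm hξ hξ)))
    fun i => subset_clspan _ ⟨_, hcenter.mp (he.mem i), rfl⟩

end CentralElements

/-! ### The `C*`-base and its factorizations -/

section KetSpan

variable {B : Type*} [NonUnitalCStarAlgebra B] [PartialOrder B] [StarOrderedRing B]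
variable {K : Type*} [NormedAddCommGroup K] [InnerProductSpace ℂ K] [CompleteSpace K]
variable (π : B →⋆ₙₐ[ℂ] (K →L[ℂ] K))
variable {E : Type*} [NormedAddCommGroup E] [NormedSpace ℂ E] [SMul Bᵐᵒᵖ E] [CStarModule Bᵐᵒᵖ E]

lemma clspan_ketOp_apply :
    clspan {x : ITensor π E | ∃ a ∈ clspan (Set.range (ketOp π E)), ∃ ζ, x = a ζ} = ⊤ := by
  refine eq_top_of_tmul_mem π (isClosed_clspan _) (clspan_rsmul_eq_top (B := B) (E := E)) ?_
  rintro _ ⟨ξ, b, rfl⟩ ζ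
  exact subset_clspan _ ⟨_, subset_clspan _ ⟨ξ, rfl⟩, tmul π b ζ, (ketOp_tmul π ξ b ζ).symm⟩

lemma adjoint_comp_mem_clspan_ketOp {x y : ITensor π B →L[ℂ] ITensor π E}
    (hx : x ∈ clspan (Set.range (ketOp π E))) (hy : y ∈ clspan (Set.range (ketOp π E))) :
    adjoint x ∘L y ∈ clspan (Set.range (ketOp π B)) := by
  refine adjoint_comp_mem_of_mem_clspan (isClosed_clspan _) ?_ hx hy
  rintro _ ⟨ξ, rfl⟩ _ ⟨η, rfl⟩
  exact subset_clspan _ ⟨_, (adjoint_ketOp_comp π ξ η).symm⟩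

end KetSpan

namespace CovariantRep

variable {B : Type*} [NonUnitalCStarAlgebra B] [PartialOrder B] [StarOrderedRing B]
variable {K : Type*} [NormedAddCommGroup K] [InnerProductSpace ℂ K] [CompleteSpace K]
variable {E : Type*} [NormedAddCommGroup E] [NormedSpace ℂ E] [SMul Bᵐᵒᵖ E] [CStarModule Bᵐᵒᵖ E]
  [LeftAction B E]
variable {Θ : Set (PAut B)} (R : CovariantRep Θ K)

section Generators

variable (E) in
/-- The operators `F(|ξ])` for homogeneous `ξ`, which generate `F_*(|E])`. -/
def rketOps : Set (R.obj B →L[ℂ] R.obj E) :=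
  {T | ∃ θ ∈ Θ, ∃ ξ ∈ homog E θ, T = R.mor θ.symm (rket B ξ)}

variable (hid : PAut.id B ∈ Θ)
include hid

lemma morSpan_ketFamily (hE : IsDecomposable E Θ) :
    R.morSpan (ketFamily B E) = clspan (Set.range (ketOp R.π E)) := by
  refine le_antisymm (clspan_le (isClosed_clspan _) ?_) (clspan_le (isClosed_clspan _) ?_)
  · rintro _ ⟨ρ, -, σ, -, T, hT, rfl⟩
    rcases mem_ketFamily hT with ⟨rfl, ξ, -, rfl⟩ | rfl
    · exact subset_clspan _ ⟨ξ, (R.mor_id_ket hid ξ).symm⟩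
    · rw [R.mor_zero]
      exact zero_mem _
  · rintro _ ⟨ξ, rfl⟩
    refine map_mem_of_mem_clspan (W := R.obj B →L[ℂ] R.obj E) (ketOp R.π E) (isClosed_clspan _) ?_
      (hE ▸ Submodule.mem_top (x := ξ))
    rintro η ⟨θ, hθ, hη⟩
    refine subset_clspan _ ⟨θ, hθ, PAut.id B, hid, ket B η, ?_, (R.mor_id_ket hid η).symm⟩
    rw [ketFamily, if_pos rfl]
    exact ⟨η, hη, rfl⟩

lemma morSpan_rketFamily (hΘ : IsInverseSemigroup Θ) :
    R.morSpan (rketFamily B E) = clspan (R.rketOps E) := by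
  refine le_antisymm (clspan_le (isClosed_clspan _) ?_) (clspan_mono ?_)
  · rintro _ ⟨ρ, -, σ, hσ, T, hT, rfl⟩
    rcases mem_rketFamily hT with ⟨ξ, hξ, rfl⟩ | rfl
    · exact subset_clspan _ ⟨σ.symm, hΘ.symm_mem σ hσ, ξ, hξ, rfl⟩
    · rw [R.mor_zero]
      exact zero_mem _
  · rintro _ ⟨θ, hθ, ξ, hξ, rfl⟩
    refine ⟨PAut.id B, hid, θ.symm, hΘ.symm_mem θ hθ, rket B ξ, ?_, rfl⟩
    rw [rketFamily_id]
    exact ⟨ξ, hξ, rfl⟩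

end Generators

section Products

variable {θ θ' τ : PAut B} {ξ η : E} {b c : B} (hΘ : IsInverseSemigroup Θ) (hθ : θ ∈ Θ)
include hΘ hθ

lemma mor_rket_comp_mor_rket (hθ' : θ' ∈ Θ) (hτ : τ ∈ Θ) (h : PAut.IsComp θ θ' τ)
    (hb : b ∈ homog B θ) (hξ : ξ ∈ homog E θ') :
    R.mor θ'.symm (rket B ξ) ∘L R.mor θ.symm (rket B b) = R.mor τ.symm (rket B (lact b ξ)) :=
  ext_tmul R.π fun c ζ => by
    rw [ContinuousLinearMap.comp_apply, R.mor_rket_tmul hΘ hθ hb, R.mor_rket_tmul hΘ hθ' hξ,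
      R.mor_rket_tmul hΘ hτ (homog.lact_mem hb hξ h), R.υ_symm_comp hΘ hθ hθ' hτ h, lact_self,
      LeftAction.lact_mul]

lemma mor_rightMul_tmul (hE : IsRightBimodule B E) (hb : b ∈ homog B θ) (ξ : E) (ζ : K) :
    R.mor θ.symm (rightMul E b) (tmul R.π ξ ζ) = tmul R.π (ξ <• b) (R.υ θ.symm ζ) :=
  R.mor_tmul hΘ (hΘ.symm_mem θ hθ) (isHomogeneous_rightMul hE hb) ξ ζ

lemma mor_rightMul_comp_mor_rket (hE : IsRightBimodule B E) (hθ' : θ' ∈ Θ) (hτ : τ ∈ Θ)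
    (h : PAut.IsComp θ θ' τ) (hξ : ξ ∈ homog E θ) (hb : b ∈ homog B θ') :
    R.mor θ'.symm (rightMul E b) ∘L R.mor θ.symm (rket B ξ) = R.mor τ.symm (rket B (ξ <• b)) :=
  ext_tmul R.π fun c ζ => by
    rw [ContinuousLinearMap.comp_apply, R.mor_rket_tmul hΘ hθ hξ,
      R.mor_rightMul_tmul hΘ hθ' hE hb, R.mor_rket_tmul hΘ hτ (homog.rsmul_mem hξ hb h),
      R.υ_symm_comp hΘ hθ hθ' hτ h, lact_rsmul]

lemma mor_rightMul_comp_ketOp (hE : IsRightBimodule B E) (hb : b ∈ homog B θ) (ξ : E) :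
    R.mor θ.symm (rightMul E b) ∘L ketOp R.π E ξ
      = ketOp R.π E ξ ∘L R.mor θ.symm (rket B b) :=
  ext_tmul R.π fun c ζ => by
    rw [ContinuousLinearMap.comp_apply, ketOp_tmul, R.mor_rightMul_tmul hΘ hθ hE hb,
      ContinuousLinearMap.comp_apply, R.mor_rket_tmul hΘ hθ hb, ketOp_tmul, lact_self, rsmul_mul]

lemma leftRep_comp_mor_rket (b : B) (hξ : ξ ∈ homog E θ) :
    leftRep R.π E b ∘L R.mor θ.symm (rket B ξ) = R.mor θ.symm (rket B ξ) ∘L leftRep R.π B b :=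
  ext_tmul R.π fun c ζ => by
    rw [ContinuousLinearMap.comp_apply, R.mor_rket_tmul hΘ hθ hξ, leftRep_tmul,
      ContinuousLinearMap.comp_apply, leftRep_tmul, R.mor_rket_tmul hΘ hθ hξ, lact_self,
      LeftAction.lact_mul]

lemma adjoint_mor_rket (hb : b ∈ homog B θ) :
    adjoint (R.mor θ.symm (rket B b)) = R.mor θ.symm.symm (rket B (star b)) :=
  ext_tmul R.π fun c ζ => by
    have happ : θ.app (star b * c) = c * star b := by
      have hdom : star c * b ∈ θ.dom := homog.ip_right_mem_dom hb c
      have h := congrArg star (homog.app_mul_right hb (star c))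
      rwa [← PAut.app_star hdom, star_mul, star_mul, star_star] at h
    rw [R.adjoint_mor_rket_tmul hΘ hθ hb, R.mor_rket_tmul hΘ (hΘ.symm_mem θ hθ)
      (homog.star_mem hb), PAut.symm_symm, ip_self, lact_self, happ]

lemma adjoint_mor_rket_comp_mor_rket_lact (hθ' : θ' ∈ Θ) (hτ : τ ∈ Θ)
    (h : PAut.IsComp θ' θ τ) (hξ : ξ ∈ homog E θ) (hη : η ∈ homog E θ) (hc : c ∈ homog B θ') :
    adjoint (R.mor θ.symm (rket B ξ)) ∘L R.mor τ.symm (rket B (lact c η))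
      = R.mor θ'.symm (rket B (θ.app (ip B ξ η) * c)) := by
  have hcentral := homog.app_ip_mul_comm hξ hη
  have hmul : θ.app (ip B ξ η) * c ∈ homog B θ' := homog.lact_central hc hcentral
  refine ext_tmul R.π fun b ζ => ?_
  rw [ContinuousLinearMap.comp_apply, R.mor_rket_tmul hΘ hτ (homog.lact_mem hc hη h),
    R.mor_rket_tmul hΘ hθ' hmul, R.adjoint_mor_rket_tmul hΘ hθ hξ,
    ← LeftAction.lact_mul, homog.app_ip_lact_right hη, ← R.υ_symm_comp hΘ hθ' hθ hτ h,
    lact_self, ← mul_assoc b, ← hcentral b, mul_assoc]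
  refine tmul_congr R.π fun d => R.π_υ_υ_symm hΘ hθ ?_ _
  exact θ.isClosedIdeal_img.mul_mem_left _ (θ.isClosedIdeal_img.mul_mem_right _
    (PAut.app_mem_img (homog.ip_right_mem_dom hη ξ)))

end Products

section Spans

variable (hΘ : IsInverseSemigroup Θ)
include hΘ

lemma adjoint_mor_rket_comp_mem
    (h : (rketFamily B E).adj.prod (rketFamily B E) = rketFamily B B) {x y : R.obj B →L[ℂ] R.obj E}
    (hx : x ∈ R.rketOps E) (hy : y ∈ R.rketOps E) : adjoint x ∘L y ∈ clspan (R.rketOps B) := by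
  obtain ⟨θ, hθ, ξ, hξ, rfl⟩ := hx
  obtain ⟨θ', hθ', η, hη, rfl⟩ := hy
  have hs := hΘ.symm_mem
  obtain ⟨τ, hτ, hcomp⟩ := hΘ.comp_mem θ hθ θ'.symm (hs _ hθ')
  have hprod : rbra hξ ∘L rket B η ∈ (rketFamily B E).adj.prod (rketFamily B E) (PAut.id B) τ := by
    refine subset_clspan _ ⟨PAut.id B, θ, PAut.id B, θ'.symm, le_of_eq (PEquiv.refl_trans _),
      le_of_eq hcomp.symm, rbra hξ, ⟨rket B ξ, ?_, isAdjoint_rket hξ⟩, rket B η, ?_, rfl⟩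
    · rw [PAut.id_symm, rketFamily_id]
      exact ⟨ξ, hξ, rfl⟩
    · rw [rketFamily_id]
      exact ⟨η, hη, rfl⟩
  rw [h, rketFamily_id] at hprod
  obtain ⟨c, hc, hrket⟩ := hprod
  refine subset_clspan _ ⟨τ.symm, hs _ hτ, c, hc, ext_tmul R.π fun b ζ => ?_⟩
  rw [ContinuousLinearMap.comp_apply, R.mor_rket_tmul hΘ hθ' hη, R.adjoint_mor_rket_tmul hΘ hθ hξ,
    R.mor_rket_tmul hΘ (hs _ hτ) hc, PAut.symm_symm, ← R.υ_comp θ hθ _ (hs _ hθ') τ hτ hcomp]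
  exact congrArg (fun f => tmul R.π (f b) _) hrket

lemma tmul_lact_mem {θ : PAut B} (hθ : θ ∈ Θ) {ξ : E} (hξ : ξ ∈ homog E θ) (b : B) (ζ : K) :
    tmul R.π (lact b ξ) ζ ∈
      clspan {x : R.obj E | ∃ a ∈ clspan (R.rketOps E), ∃ ζ, x = a ζ} := by
  obtain ⟨_, l, e, he⟩ := θ.exists_isApproxUnit_dom
  have hlim : Tendsto (fun i => tmul R.π (lact b (ξ <• e i)) ζ) l (𝓝 (tmul R.π (lact b ξ) ζ)) :=
    (((tmulL R.π).flip ζ ∘L lact b).continuous.tendsto ξ).comp (he.tendsto_rsmul hξ.1)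
  refine he.mem_of_tendsto (isClosed_clspan _) hlim fun i => ?_
  obtain ⟨κ, hκ⟩ : R.π (e i) ζ ∈ Set.range (R.υ θ.symm) := by
    rw [R.range_υ _ (hΘ.symm_mem θ hθ)]
    exact subset_clspan _ ⟨e i, by rw [PAut.img_symm]; exact he.mem i, ζ, rfl⟩
  refine subset_clspan _ ⟨_, subset_clspan _ ⟨θ, hθ, ξ, hξ, rfl⟩, tmul R.π b κ, ?_⟩
  rw [R.mor_rket_tmul hΘ hθ hξ, lact_rsmul, tmul_rsmul, hκ]

lemma clspan_rketOps_apply (hE : IsDecomposable E Θ)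
    (hlact : clspan {ξ : E | ∃ (b : B) (η : E), ξ = lact b η} = ⊤) :
    clspan {x : R.obj E | ∃ a ∈ clspan (R.rketOps E), ∃ ζ, x = a ζ} = ⊤ := by
  refine eq_top_of_tmul_mem R.π (isClosed_clspan _) hlact ?_
  rintro _ ⟨b, η, rfl⟩ ζ
  refine map_mem_of_mem_clspan ((tmulL R.π).flip ζ ∘L lact b) (isClosed_clspan _) ?_
    (hE ▸ Submodule.mem_top (x := η))
  rintro ξ ⟨θ, hθ, hξ⟩
  exact R.tmul_lact_mem hΘ hθ hξ b ζ

end Spans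

section Base

/-- The `C*`-base `(F(B), F_*(|B⟩), F_*(|B]))`. -/
def base (hΘ : IsInverseSemigroup Θ) (hB : IsDecomposable B Θ) : CStarBase (R.obj B) where
  left := clspanAlg (Set.range (ketOp R.π B))
    (by
      rintro _ ⟨b, rfl⟩ _ ⟨c, rfl⟩
      exact ⟨b * c, map_mul (leftRep R.π B) b c⟩)
    (by
      rintro _ ⟨b, rfl⟩
      exact ⟨star b, map_star (leftRep R.π B) b⟩)
  right := clspanAlg (R.rketOps B)
    (by
      rintro _ ⟨θ, hθ, b, hb, rfl⟩ _ ⟨θ', hθ', c, hc, rfl⟩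
      obtain ⟨τ, hτ, h⟩ := hΘ.comp_mem θ' hθ' θ hθ
      exact ⟨τ, hτ, _, homog.lact_mem hc hb h,
        R.mor_rket_comp_mor_rket hΘ hθ' hθ hτ h hc hb⟩)
    (by
      rintro _ ⟨θ, hθ, b, hb, rfl⟩
      exact ⟨θ.symm, hΘ.symm_mem θ hθ, star b, homog.star_mem hb, R.adjoint_mor_rket hΘ hθ hb⟩)
  isClosed_left := isClosed_clspan _
  isClosed_right := isClosed_clspan _
  commute a ha b hb := by
    refine comp_eq_comp_of_mem_clspan (a := a) (b := a) ?_ hb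
    rintro _ ⟨θ, hθ, b, hb, rfl⟩
    refine (comp_eq_comp_of_mem_clspan ?_ ha).symm
    rintro _ ⟨c, rfl⟩
    exact (R.leftRep_comp_mor_rket hΘ hθ c hb).symm
  nondegenerate_left := clspan_ketOp_apply R.π
  nondegenerate_right := R.clspan_rketOps_apply hΘ hB clspan_lact_self

variable (hΘ : IsInverseSemigroup Θ) (hB : IsDecomposable B Θ)

lemma mor_id_ket_mem (hid : PAut.id B ∈ Θ) (b : B) :
    R.mor (PAut.id B) (ket B b) ∈ (R.base hΘ hB).op.right :=
  subset_clspan _ ⟨b, (R.mor_id_ket hid b).symm⟩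

lemma mor_rket_mem {θ : PAut B} (hθ : θ ∈ Θ) {b : B} (hb : b ∈ homog B θ) :
    R.mor θ.symm (rket B b) ∈ (R.base hΘ hB).right :=
  subset_clspan _ ⟨θ, hθ, b, hb, rfl⟩

end Base

section Factorizations

variable (hΘ : IsInverseSemigroup Θ) (hB : IsDecomposable B Θ) (hE : IsRightBimodule B E)

include hE in
lemma isFactorization_ket : (R.base hΘ hB).IsFactorization (clspan (Set.range (ketOp R.π E))) where
  isClosed := isClosed_clspan _
  adjoint_comp := by
    refine congrArg SetLike.coe (a₂ := clspan (Set.range (ketOp R.π B))) (le_antisymm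
      (clspan_le (isClosed_clspan _) ?_) (clspan_le (isClosed_clspan _) ?_))
    · rintro _ ⟨ξ, hξ, η, hη, rfl⟩
      exact adjoint_comp_mem_clspan_ketOp R.π hξ hη
    · rintro _ ⟨b, rfl⟩
      refine map_mem_of_mem_clspan (ketOp R.π B) (isClosed_clspan _) ?_
        (hE.full ▸ Submodule.mem_top (x := b))
      rintro _ ⟨ξ, η, rfl⟩
      exact subset_clspan _ ⟨_, subset_clspan _ ⟨ξ, rfl⟩, _, subset_clspan _ ⟨η, rfl⟩,
        (adjoint_ketOp_comp R.π ξ η).symm⟩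
  comp_left := by
    refine clspan_comp_eq (isClosed_clspan _) (R.base hΘ hB).isClosed_left
      (fun x hx => adjoint_comp_mem_clspan_ketOp R.π hx hx) fun x hx a ha =>
      comp_mem_of_mem_clspan (isClosed_clspan _) ?_ hx ha
    rintro _ ⟨ξ, rfl⟩ _ ⟨b, rfl⟩
    exact subset_clspan _ ⟨_, (ketOp_comp_leftRep R.π ξ b).symm⟩
  nondegenerate := clspan_ketOp_apply R.π

section RKet

variable (hdec : IsDecomposable E Θ)
  (h : (rketFamily B E).adj.prod (rketFamily B E) = rketFamily B B)
include hΘ h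

lemma adjoint_comp_mem_clspan_rketOps {x y : R.obj B →L[ℂ] R.obj E}
    (hx : x ∈ clspan (R.rketOps E)) (hy : y ∈ clspan (R.rketOps E)) :
    adjoint x ∘L y ∈ clspan (R.rketOps B) :=
  adjoint_comp_mem_of_mem_clspan (isClosed_clspan _)
    (fun _ hx _ hy => R.adjoint_mor_rket_comp_mem hΘ h hx hy) hx hy

include hdec

lemma mor_rket_mem_clspan_adjoint_comp {θ : PAut B} (hθ : θ ∈ Θ) {c : B} (hc : c ∈ homog B θ) :
    R.mor θ.symm (rket B c) ∈
      clspan {x | ∃ ξ ∈ clspan (R.rketOps E), ∃ η ∈ clspan (R.rketOps E), x = adjoint ξ ∘L η} := by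
  have hsub : {x | ∃ z ∈ homogCoeffs E Θ, x = z * c} ⊆ homogSub B θ := by
    rintro _ ⟨_, ⟨θ', -, ξ, hξ, η, hη, rfl⟩, rfl⟩
    exact homog.lact_central hc (homog.app_ip_mul_comm hξ hη)
  refine map_mem_of_coe_mem_clspan (isClosed_homogSub θ) (R.rketOp B θ hΘ hθ) hsub
    (isClosed_clspan _) ?_ (x := ⟨c, hc⟩) (mem_clspan_homogCoeffs_mul hdec h hc)
  rintro ⟨_, -⟩ ⟨_, ⟨θ', hθ', ξ, hξ, η, hη, rfl⟩, rfl⟩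
  obtain ⟨τ, hτ, hcomp⟩ := hΘ.comp_mem θ hθ θ' hθ'
  exact subset_clspan _ ⟨_, subset_clspan _ ⟨θ', hθ', ξ, hξ, rfl⟩, _,
    subset_clspan _ ⟨τ, hτ, _, homog.lact_mem hc hη hcomp, rfl⟩,
    (R.adjoint_mor_rket_comp_mor_rket_lact hΘ hθ' hθ hτ hcomp hξ hη hc).symm⟩

include hE in
lemma isFactorization_rket : (R.base hΘ hB).op.IsFactorization (clspan (R.rketOps E)) where
  isClosed := isClosed_clspan _
  adjoint_comp := by
    refine congrArg SetLike.coe (a₂ := clspan (R.rketOps B)) (le_antisymm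
      (clspan_le (isClosed_clspan _) ?_) (clspan_le (isClosed_clspan _) ?_))
    · rintro _ ⟨ξ, hξ, η, hη, rfl⟩
      exact R.adjoint_comp_mem_clspan_rketOps hΘ h hξ hη
    · rintro _ ⟨θ, hθ, c, hc, rfl⟩
      exact R.mor_rket_mem_clspan_adjoint_comp hΘ hdec h hθ hc
  comp_left := by
    refine clspan_comp_eq (isClosed_clspan _) (R.base hΘ hB).isClosed_right
      (fun x hx => R.adjoint_comp_mem_clspan_rketOps hΘ h hx hx) fun x hx a ha =>
      comp_mem_of_mem_clspan (isClosed_clspan _) ?_ hx ha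
    rintro _ ⟨θ', hθ', ξ, hξ, rfl⟩ _ ⟨θ, hθ, b, hb, rfl⟩
    obtain ⟨τ, hτ, hcomp⟩ := hΘ.comp_mem θ hθ θ' hθ'
    exact subset_clspan _ ⟨τ, hτ, _, homog.lact_mem hb hξ hcomp,
      R.mor_rket_comp_mor_rket hΘ hθ hθ' hτ hcomp hb hξ⟩
  nondegenerate := R.clspan_rketOps_apply hΘ hdec hE.nondegenerate

end RKet

end Factorizations

section Representations

variable {hΘ} {hB : IsDecomposable B Θ} (hid : PAut.id B ∈ Θ) (hE : IsRightBimodule B E)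

include hE

lemma rep_ket (hα : (R.base hΘ hB).IsFactorization (clspan (Set.range (ketOp R.π E))))
    {θ : PAut B} (hθ : θ ∈ Θ) {b : B} (hb : b ∈ homog B θ) :
    hα.rep ⟨_, R.mor_rket_mem hΘ hB hθ hb⟩ = R.mor θ.symm (rightMul E b) := by
  refine hα.rep_eq_of_forall_comp_eq _ ?_
  rintro _ ⟨η, rfl⟩
  exact R.mor_rightMul_comp_ketOp hΘ hθ hE hb η

include hid

omit hE in
lemma rep_rket (hβ : (R.base hΘ hB).op.IsFactorization (clspan (R.rketOps E))) (b : B) :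
    hβ.rep ⟨_, R.mor_id_ket_mem hΘ hB hid b⟩ = leftRep R.π E b := by
  refine hβ.rep_eq_of_forall_comp_eq _ ?_
  rintro _ ⟨θ, hθ, η, hη, rfl⟩
  change _ = _ ∘L R.mor (PAut.id B) (ket B b)
  rw [R.mor_id_ket hid]
  exact R.leftRep_comp_mor_rket hΘ hθ b hη

lemma clspan_rep_ket_comp
    (hα : (R.base hΘ hB).IsFactorization (clspan (Set.range (ketOp R.π E)))) :
    clspan {x | ∃ b, ∃ η ∈ clspan (R.rketOps E), x = hα.rep b ∘L η} = clspan (R.rketOps E) := by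
  refine le_antisymm (clspan_le (isClosed_clspan _) ?_) (clspan_le (isClosed_clspan _) ?_)
  · rintro _ ⟨b, η, hη, rfl⟩
    refine hα.rep_comp_mem rfl (isClosed_clspan _) ?_ b hη
    rintro ⟨_, -⟩ ⟨θ', hθ', b, hb, rfl⟩ _ ⟨θ, hθ, ξ, hξ, rfl⟩
    obtain ⟨τ, hτ, hcomp⟩ := hΘ.comp_mem θ hθ θ' hθ'
    rw [R.rep_ket hE hα hθ' hb, R.mor_rightMul_comp_mor_rket hΘ hθ hE hθ' hτ hcomp hξ hb]
    exact subset_clspan _ ⟨τ, hτ, _, homog.rsmul_mem hξ hb hcomp, rfl⟩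
  · rintro _ ⟨θ, hθ, ξ, hξ, rfl⟩
    have hcomp : PAut.IsComp θ (PAut.id B) θ := (PEquiv.refl_trans _).symm
    have hsub : {x | ∃ z : B, (∀ b, z * b = b * z) ∧ x = ξ <• z} ⊆ homogSub E θ := by
      rintro _ ⟨z, hz, rfl⟩
      exact homog.rsmul_mem hξ (homog_id_of_central hz) hcomp
    refine map_mem_of_coe_mem_clspan (W := R.obj B →L[ℂ] R.obj E) (isClosed_homogSub θ)
      (R.rketOp E θ hΘ hθ) hsub (isClosed_clspan _) ?_ (x := ⟨ξ, hξ⟩)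
      (homog.mem_clspan_rsmul_central hξ)
    rintro ⟨_, -⟩ ⟨z, hz, rfl⟩
    refine subset_clspan _ ⟨⟨_, R.mor_rket_mem hΘ hB hid (homog_id_of_central hz)⟩, _,
      subset_clspan _ ⟨θ, hθ, ξ, hξ, rfl⟩, ?_⟩
    rw [R.rep_ket hE hα hid (homog_id_of_central hz),
      R.mor_rightMul_comp_mor_rket hΘ hθ hE hid hθ hcomp hξ (homog_id_of_central hz)]
    rfl

lemma clspan_rep_rket_comp
    (hβ : (R.base hΘ hB).op.IsFactorization (clspan (R.rketOps E))) :
    clspan {x | ∃ c, ∃ ξ ∈ clspan (Set.range (ketOp R.π E)), x = hβ.rep c ∘L ξ}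
      = clspan (Set.range (ketOp R.π E)) := by
  have hrep (b : B) (ξ : E) : hβ.rep ⟨_, R.mor_id_ket_mem hΘ hB hid b⟩ ∘L ketOp R.π E ξ
      = ketOp R.π E (lact b ξ) := by
    rw [R.rep_rket hid hβ, leftRep_comp_ketOp]
  refine le_antisymm (clspan_le (isClosed_clspan _) ?_) (clspan_le (isClosed_clspan _) ?_)
  · rintro _ ⟨b, η, hη, rfl⟩
    refine hβ.rep_comp_mem (S := Set.range (ketOp R.π B)) rfl (isClosed_clspan _) ?_ b hη
    rintro ⟨_, hmem⟩ ⟨b, rfl⟩ _ ⟨ξ, rfl⟩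
    simp only [← R.mor_id_ket hid b, hrep]
    exact subset_clspan _ ⟨_, rfl⟩
  · rintro _ ⟨ξ, rfl⟩
    refine map_mem_of_mem_clspan (W := R.obj B →L[ℂ] R.obj E) (ketOp R.π E) (isClosed_clspan _) ?_
      (hE.nondegenerate ▸ Submodule.mem_top (x := ξ))
    rintro _ ⟨b, η, rfl⟩
    exact subset_clspan _ ⟨_, _, subset_clspan _ ⟨η, rfl⟩, (hrep b η).symm⟩

end Representations

end CovariantRep

end HomMod

end

theorem mainTheorem12_general {B : Type*} [NonUnitalCStarAlgebra B] [PartialOrder B]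
    [StarOrderedRing B] {Θ : Set (PAut B)} (hΘ : IsInverseSemigroup Θ) (hid : PAut.id B ∈ Θ)
    (hB : IsDecomposable B Θ)
    {K : Type*} [NormedAddCommGroup K] [InnerProductSpace ℂ K] [CompleteSpace K]
    (R : CovariantRep Θ K) :
    ∃ 𝒞 : CStarBase (R.obj B),
      (𝒞.left : Set (R.obj B →L[ℂ] R.obj B)) = R.morSpan (ketFamily B B) ∧
      (𝒞.right : Set (R.obj B →L[ℂ] R.obj B)) = R.morSpan (rketFamily B B) ∧
      (∀ θ ∈ Θ, ∀ b ∈ homog B θ,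
        IsHomogeneous θ (PAut.id B) (ket B b) ∧ IsHomogeneous (PAut.id B) θ.symm (rket B b)) ∧
      ∀ (E : Type*) [NormedAddCommGroup E] [NormedSpace ℂ E] [SMul Bᵐᵒᵖ E]
        [CStarModule Bᵐᵒᵖ E] [LeftAction B E], IsRightBimodule B E → IsDecomposable E Θ →
        (rketFamily B E).adj.prod (rketFamily B E) = rketFamily B B →
        (∀ θ ∈ Θ, ∀ ξ ∈ homog E θ,
          IsHomogeneous θ (PAut.id B) (ket B ξ) ∧ IsHomogeneous (PAut.id B) θ.symm (rket B ξ)) ∧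
        (∀ θ ∈ Θ, ∀ b ∈ homog B θ,
          IsHomogeneous θ (PAut.id B) (leftMul E b) ∧
          IsHomogeneous (PAut.id B) θ.symm (rightMul E b)) ∧
        ∃ (hβ : 𝒞.op.IsFactorization (R.morSpan (rketFamily B E)))
          (hα : 𝒞.IsFactorization (R.morSpan (ketFamily B E))),
          hα.Compatible hβ ∧
          ∀ θ ∈ Θ, ∀ b ∈ homog B θ,
            (∃ h : R.mor (PAut.id B) (ket B b) ∈ 𝒞.op.right,
              hβ.rep ⟨_, h⟩ = R.mor (PAut.id B) (leftMul E b)) ∧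
            (∃ h : R.mor θ.symm (rket B b) ∈ 𝒞.right,
              hα.rep ⟨_, h⟩ = R.mor θ.symm (rightMul E b)) := by
  refine ⟨R.base hΘ hB, ?_, ?_, fun θ _ b hb => ⟨isHomogeneous_ket hb, isHomogeneous_rket hb⟩, ?_⟩
  · exact congrArg SetLike.coe (R.morSpan_ketFamily hid hB).symm
  · exact congrArg SetLike.coe (R.morSpan_rketFamily hid hΘ).symm
  intro E _ _ _ _ _ hE hdec hadj
  rw [R.morSpan_ketFamily hid hdec, R.morSpan_rketFamily hid hΘ]
  have hα := R.isFactorization_ket hΘ hB hE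
  have hβ := R.isFactorization_rket hΘ hB hE hdec hadj
  refine ⟨fun θ _ ξ hξ => ⟨isHomogeneous_ket hξ, isHomogeneous_rket hξ⟩,
    fun θ _ b hb => ⟨isHomogeneous_leftMul hb, isHomogeneous_rightMul hE hb⟩, hβ, hα,
    ⟨R.clspan_rep_ket_comp hid hE hα, R.clspan_rep_rket_comp hid hE hβ⟩, fun θ hθ b hb => ⟨?_, ?_⟩⟩
  · exact ⟨R.mor_id_ket_mem hΘ hB hid b,
      (R.rep_rket hid hβ b).trans (R.mor_id_leftMul hid b).symm⟩
  · exact ⟨R.mor_rket_mem hΘ hB hθ hb, R.rep_ket hE hα hθ hb⟩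

theorem mainTheorem12 {B : Type*} [NonUnitalCStarAlgebra B] [PartialOrder B]
    [StarOrderedRing B] (hB : IsDecomposable B (Set.univ : Set (PAut B)))
    (Θ : Set (PAut B)) (hΘ : IsAdmissible Θ)
    {K : Type*} [NormedAddCommGroup K] [InnerProductSpace ℂ K] [CompleteSpace K]
    (R : CovariantRep Θ K) (hπ : Function.Injective R.π) :
    ∃ 𝒞 : CStarBase (R.obj B),
      (𝒞.left : Set (R.obj B →L[ℂ] R.obj B)) = R.morSpan (ketFamily B B) ∧
      (𝒞.right : Set (R.obj B →L[ℂ] R.obj B)) = R.morSpan (rketFamily B B) ∧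
      (∀ θ ∈ Θ, ∀ b ∈ homog B θ,
        IsHomogeneous θ (PAut.id B) (ket B b) ∧ IsHomogeneous (PAut.id B) θ.symm (rket B b)) ∧
      ∀ (E : Type*) [NormedAddCommGroup E] [NormedSpace ℂ E] [SMul Bᵐᵒᵖ E]
        [CStarModule Bᵐᵒᵖ E] [LeftAction B E], IsAdmissibleBimodule E Θ →
        (∀ θ ∈ Θ, ∀ ξ ∈ homog E θ,
          IsHomogeneous θ (PAut.id B) (ket B ξ) ∧ IsHomogeneous (PAut.id B) θ.symm (rket B ξ)) ∧
        (∀ θ ∈ Θ, ∀ b ∈ homog B θ,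
          IsHomogeneous θ (PAut.id B) (leftMul E b) ∧
          IsHomogeneous (PAut.id B) θ.symm (rightMul E b)) ∧
        ∃ (hβ : 𝒞.op.IsFactorization (R.morSpan (rketFamily B E)))
          (hα : 𝒞.IsFactorization (R.morSpan (ketFamily B E))),
          hα.Compatible hβ ∧
          ∀ θ ∈ Θ, ∀ b ∈ homog B θ,
            (∃ h : R.mor (PAut.id B) (ket B b) ∈ 𝒞.op.right,
              hβ.rep ⟨_, h⟩ = R.mor (PAut.id B) (leftMul E b)) ∧
            (∃ h : R.mor θ.symm (rket B b) ∈ 𝒞.right,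
              hα.rep ⟨_, h⟩ = R.mor θ.symm (rightMul E b)) := by
  obtain ⟨𝒞, hleft, hright, hhom, hE⟩ := mainTheorem12_general hΘ.inverseSemigroup hΘ.id_mem
    (isDecomposable_of_supported hB hΘ.supported) R
  exact ⟨𝒞, hleft, hright, hhom,
    fun E _ _ _ _ _ h => hE E h.bimodule h.decomposable h.rket_adj_rket⟩
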